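/- Let $\mathcal A$ be a unital complex $*$-algebra with two positive unital linear functionals $\phi,\psi$. Define the functionals $R^\psi$ and $R^{\phi,\psi}$ by $$\psi[X_1\cdots X_n]=\sum_{\pi\in NC(n)}\prod_{V\in\pi}R^\psi(X_1,\dots,X_n:V),\qquad \phi[X_1\cdots X_n]=\sum_{\pi\in NC(n)}\ \prod_{V\ \mathrm{outer}}R^{\phi,\psi}(X_1,\dots,X_n:V)\prod_{V\ \mathrm{inner}}R^\psi(X_1,\dots,X_n:V),$$ where $(X_1,\dots,X_n:V)$ is the subtuple indexed by $V$ and a block $V$ of a non-crossing partition is inner if it lies strictly between two elements of another block, and outer otherwise; put $R_n(X)=R(X,\dots,X)$. Subalgebras $\mathcal A_i$ are two-state freely independent if, whenever $n\ge1$, $a_j\in\mathcal A_{i(j)}$, $i(j)\ne i(j+1)$ and $\psi[a_j]=0$ for all $j$, one has $\psi[a_1\cdots a_n]=0$ and $\phi[a_1\cdots a_n]=\phi[a_1]\cdots\phi[a_n]$. An algebraic two-state free Brownian motion is a family of self-adjoint $X(t)\in\mathcal A$, $0\le t\le T$, with $X(0)=0$, whose increments over disjoint intervals $[s,t)$ (that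 is, the unital algebras they generate) are two-state freely independent, whose increments have stationary distributions with respect to both $\phi$ and $\psi$, and such that $\phi[X(t)-X(s)]=0$, $\phi[(X(t)-X(s))^2]=t-s$ and $R^{\phi,\psi}_n(X(t)-X(s))=0$ for $n>2$. It has parameter $\alpha\in\mathbb R$ if $R^\psi_1(X(t))=\alpha t$ for all $t$. Let $\{X(t),\,0\le t\le T\}$ be an algebraic two-state free Brownian motion with parameter $\alpha$. Assume that * (W*-setting) $\mathcal A$ is a von Neumann algebra, $\phi$ is a faithful normal state, and $\psi$ is a normal state; or, alternatively, * (algebraic setting) $R^\psi_2(X(t))=t$ and $R^\psi_k(X(t))=0$ for all $k>2$ and all $t\in[0,T]$. Let $0<t\le T$. A distribution of $a\in\mathcal A$ with respect to $\phi$ is a probability measure on $\mathbb R$ with all moments finite whose $n$-th moment is $\phi[a^n]$ for all $n\ge 0$ (and similarly for $\psi$). Then: 1. $X(t)$ has exactly one distribution $\nu_t$ with respect to $\psi$, and it is semicircular with mean $\alpha t$ and variance $t$: $$d\nu_t(x)=\frac1{2\pi t}\sqrt{\bigl(4t-(x-\alpha t)^2\bigr)_+}\,dx .$$ 2. $X(t)$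 has exactly one distribution $\mu_t$ with respect to $\phi$, and $\mu_t=\Phi_t[\nu_t]$, that is, $G_{\mu_t}(z)=\dfrac1{z-t\,G_{\nu_t}(z)}$ for $\operatorname{Im}z>0$, where $G_\nu(z)=\int_{\mathbb R}\frac{d\nu(x)}{z-x}$. 3. If $\alpha\ne0$, then $$d\mu_t(x)=\frac1{2\pi t}\,\frac{\sqrt{\bigl(4t-(x-\alpha t)^2\bigr)_+}}{1+\alpha x}\,dx+\max\Bigl(1-\frac1{\alpha^2t},0\Bigr)\delta_{-1/\alpha}.$$ 4. If $\alpha\ne0$, then $C_t=1+\alpha X(t)$ has exactly one distribution with respect to $\phi$, namely $$\frac1{2\pi}\,\frac1{\alpha^2t}\,\frac{\sqrt{\bigl(((1+\alpha\sqrt t)^2-y)(y-(1-\alpha\sqrt t)^2)\bigr)_+}}{y}\,dy+\max\Bigl(1-\frac1{\alpha^2t},0\Bigr)\delta_0 .$$ In particular this holds for $C_T$. -/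

import Mathlib

open MeasureTheory
open scoped ComplexOrder InnerProductSpace

universe u

noncomputable section

/-! ### Non-crossing partitions -/

/-- A partition of `{0, …, n-1}` is non-crossing if `x₁ < y₁ < x₂ < y₂` with `x₁, x₂ ∈ U` and
`y₁, y₂ ∈ V`, for blocks `U`, `V`, implies `U = V`. -/
def IsNonCrossing {n : ℕ} (π : Finpartition (Finset.univ : Finset (Fin n))) : Prop :=
  ∀ U ∈ π.parts, ∀ V ∈ π.parts, ∀ x₁ ∈ U, ∀ x₂ ∈ U, ∀ y₁ ∈ V, ∀ y₂ ∈ V,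
    x₁ < y₁ → y₁ < x₂ → x₂ < y₂ → U = V

/-- The non-crossing partitions of `{0, …, n-1}`. -/
def NC (n : ℕ) : Finset (Finpartition (Finset.univ : Finset (Fin n))) :=
  open Classical in Finset.univ.filter IsNonCrossing

/-- A block `V` of a partition is inner if it lies strictly between two elements of one block. -/
def IsInner {n : ℕ} (π : Finpartition (Finset.univ : Finset (Fin n)))
    (V : Finset (Fin n)) : Prop :=
  ∃ W ∈ π.parts, ∃ y₁ ∈ W, ∃ y₂ ∈ W, ∀ x ∈ V, y₁ < x ∧ x < y₂

/-- `(x₀, …, x_{n-1} : V)`, the subtuple of `x` indexed by `V`, in increasing order. -/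
def restrictTuple {A : Type*} {n : ℕ} (x : Fin n → A) (V : Finset (Fin n)) : Fin V.card → A :=
  fun j => x (V.orderEmbOfFin rfl j)

/-! ### Free cumulants and two-state free cumulants -/

/-- The free cumulant functionals `R^ψ(x₀, …, x_{n-1})`: the moment-cumulant formula
`ψ[x₀ ⋯ x_{n-1}] = ∑_{π ∈ NC(n)} ∏_{V ∈ π} R^ψ(x : V)`, solved for the term of the one-block
partition. In the sum all blocks have fewer than `n` elements, so the `else` branch
is never reached (see `moment_eq_sum_freeCumulant`). -/
def freeCumulant {A : Type*} [Ring A] [Algebra ℂ A] (ψ : A →ₗ[ℂ] ℂ) (n : ℕ) (x : Fin n → A) : ℂ :=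
  open Classical in
  ψ (List.ofFn x).prod -
    ∑ π ∈ (NC n).filter (fun π => Finset.univ ∉ π.parts), ∏ V ∈ π.parts,
      if V.card < n then freeCumulant ψ V.card (restrictTuple x V) else 0
termination_by n

/-- The two-state free cumulant functionals `R^{φ,ψ}(x₀, …, x_{n-1})`: the formula
`φ[x₀ ⋯ x_{n-1}] = ∑_{π ∈ NC(n)} ∏_{V outer} R^{φ,ψ}(x : V) ∏_{V inner} R^ψ(x : V)`,
solved for the term of the one-block partition
(see `moment_eq_sum_twoStateCumulant`). -/
def twoStateCumulant {A : Type*} [Ring A] [Algebra ℂ A] (φ ψ : A →ₗ[ℂ] ℂ) (n : ℕ)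
    (x : Fin n → A) : ℂ :=
  open Classical in
  φ (List.ofFn x).prod -
    ∑ π ∈ (NC n).filter (fun π => Finset.univ ∉ π.parts), ∏ V ∈ π.parts,
      if IsInner π V then freeCumulant ψ V.card (restrictTuple x V)
      else if V.card < n then twoStateCumulant φ ψ V.card (restrictTuple x V) else 0
termination_by n

theorem parts_eq_of_univ_mem {n : ℕ} {π : Finpartition (Finset.univ : Finset (Fin n))}
    (h : Finset.univ ∈ π.parts) : π.parts = {Finset.univ} := by
  refine Finset.eq_singleton_iff_unique_mem.mpr ⟨h, fun V hV => ?_⟩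
  obtain ⟨x, hx⟩ := π.nonempty_of_mem_parts hV
  exact π.eq_of_mem_parts hV h hx (Finset.mem_univ x)

theorem card_lt_of_mem_parts {n : ℕ} {π : Finpartition (Finset.univ : Finset (Fin n))}
    (h : Finset.univ ∉ π.parts) {V : Finset (Fin n)} (hV : V ∈ π.parts) : V.card < n := by
  have h1 : V ⊂ Finset.univ :=
    Finset.ssubset_univ_iff.mpr (fun h2 => h (h2 ▸ hV))
  simpa using Finset.card_lt_card h1

open Classical in
theorem sum_NC_eq {n : ℕ} (hn : n ≠ 0)
    (f : Finpartition (Finset.univ : Finset (Fin n)) → Finset (Fin n) → ℂ)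
    (c : ℂ) (hc : ∀ π, Finset.univ ∈ π.parts → f π Finset.univ = c) :
    ∑ π ∈ NC n, ∏ V ∈ π.parts, f π V =
      c + ∑ π ∈ (NC n).filter (fun π => Finset.univ ∉ π.parts), ∏ V ∈ π.parts, f π V := by
  have hne : (Finset.univ : Finset (Fin n)) ≠ ⊥ := by
    have : NeZero n := ⟨hn⟩
    exact Finset.univ_nonempty.ne_empty
  rw [← Finset.sum_filter_add_sum_filter_not (NC n) (fun π => Finset.univ ∈ π.parts)]
  congr 1
  have h1 : (NC n).filter (fun π => Finset.univ ∈ π.parts) = {Finpartition.indiscrete hne} := by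
    ext π
    simp only [Finset.mem_filter, Finset.mem_singleton]
    constructor
    · rintro ⟨-, h⟩
      ext1
      rw [parts_eq_of_univ_mem h]
      rfl
    · rintro rfl
      refine ⟨?_, by simp⟩
      simp only [NC, Finset.mem_filter, Finset.mem_univ, true_and]
      intro U hU V hV _ _ _ _ _ _ _ _ _ _ _
      simp only [Finpartition.indiscrete_parts, Finset.mem_singleton] at hU hV
      rw [hU, hV]
  rw [h1, Finset.sum_singleton, Finpartition.indiscrete_parts, Finset.prod_singleton]
  exact hc _ (by simp)

theorem restrictTuple_univ {A : Type*} {n : ℕ} (x : Fin n → A)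
    (F : (k : ℕ) → (Fin k → A) → ℂ) :
    F (Finset.univ : Finset (Fin n)).card (restrictTuple x Finset.univ) = F n x := by
  have key : ∀ (k : ℕ) (y : Fin k → A) (h : k = n), (∀ j, y j = x (Fin.cast h j)) →
      F k y = F n x := by
    rintro k y rfl h
    congr 1
    funext j
    exact h j
  refine key _ _ (by simp) (fun j => ?_)
  have h := Finset.orderEmbOfFin_unique (s := (Finset.univ : Finset (Fin n))) rfl
    (f := Fin.cast (by simp)) (fun _ => Finset.mem_univ _) (fun _ _ h => h)
  simp only [restrictTuple, ← h]

/-- The defining relation of the free cumulants. -/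
theorem moment_eq_sum_freeCumulant {A : Type*} [Ring A] [Algebra ℂ A] (ψ : A →ₗ[ℂ] ℂ)
    {n : ℕ} (hn : n ≠ 0) (x : Fin n → A) :
    ψ (List.ofFn x).prod =
      ∑ π ∈ NC n, ∏ V ∈ π.parts, freeCumulant ψ V.card (restrictTuple x V) := by
  classical
  rw [sum_NC_eq hn (fun _ V => freeCumulant ψ V.card (restrictTuple x V)) (freeCumulant ψ n x)
    (fun _ _ => restrictTuple_univ x (freeCumulant ψ)), freeCumulant]
  have h : ∀ π ∈ (NC n).filter (fun π => Finset.univ ∉ π.parts),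
      (∏ V ∈ π.parts, if V.card < n then freeCumulant ψ V.card (restrictTuple x V) else 0) =
        ∏ V ∈ π.parts, freeCumulant ψ V.card (restrictTuple x V) := fun π hπ =>
    Finset.prod_congr rfl fun V hV =>
      if_pos (card_lt_of_mem_parts (Finset.mem_filter.mp hπ).2 hV)
  rw [Finset.sum_congr rfl h, sub_add_cancel]

open Classical in
/-- The defining relation of the two-state free cumulants. -/
theorem moment_eq_sum_twoStateCumulant {A : Type*} [Ring A] [Algebra ℂ A] (φ ψ : A →ₗ[ℂ] ℂ)
    {n : ℕ} (hn : n ≠ 0) (x : Fin n → A) :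
    φ (List.ofFn x).prod =
      ∑ π ∈ NC n, ∏ V ∈ π.parts,
        if IsInner π V then freeCumulant ψ V.card (restrictTuple x V)
        else twoStateCumulant φ ψ V.card (restrictTuple x V) := by
  rw [sum_NC_eq hn (fun π V => if IsInner π V then freeCumulant ψ V.card (restrictTuple x V)
        else twoStateCumulant φ ψ V.card (restrictTuple x V)) (twoStateCumulant φ ψ n x)
    (fun π _ => ?_), twoStateCumulant]
  · have h : ∀ π ∈ (NC n).filter (fun π => Finset.univ ∉ π.parts),
        (∏ V ∈ π.parts, if IsInner π V then freeCumulant ψ V.card (restrictTuple x V)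
          else if V.card < n then twoStateCumulant φ ψ V.card (restrictTuple x V) else 0) =
          ∏ V ∈ π.parts, if IsInner π V then freeCumulant ψ V.card (restrictTuple x V)
            else twoStateCumulant φ ψ V.card (restrictTuple x V) := fun π hπ =>
      Finset.prod_congr rfl fun V hV => by
        rw [if_pos (card_lt_of_mem_parts (Finset.mem_filter.mp hπ).2 hV)]
    rw [Finset.sum_congr rfl h, sub_add_cancel]
  · have h2 : ¬ IsInner π Finset.univ := by
      rintro ⟨W, -, y₁, -, y₂, -, h⟩
      exact lt_irrefl _ (h y₁ (Finset.mem_univ _)).1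
    rw [if_neg h2]
    exact restrictTuple_univ x (twoStateCumulant φ ψ)

/-! ### Two-state non-commutative probability spaces -/

/-- `φ` is a positive unital functional on the unital star-algebra `A`. -/
structure IsPositiveUnital {A : Type*} [Ring A] [StarRing A] [Algebra ℂ A]
    (φ : A →ₗ[ℂ] ℂ) : Prop where
  map_one : φ 1 = 1
  nonneg : ∀ a : A, 0 ≤ φ (star a * a)

/-- With `A` identified, through `e`, with the von Neumann algebra `M` acting on `H`, the functional
`φ` is normal, that is, `σ`-weakly continuous: `φ(a) = ∑ₙ ⟨ξₙ, a ηₙ⟩` for square-summable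
sequences `ξ`, `η` of vectors. -/
def IsNormalFunctional {A : Type*} [Ring A] [StarRing A] [Algebra ℂ A]
    {H : Type*} [NormedAddCommGroup H] [InnerProductSpace ℂ H] [CompleteSpace H]
    (M : VonNeumannAlgebra H) (e : A ≃⋆ₐ[ℂ] M.toStarSubalgebra) (φ : A →ₗ[ℂ] ℂ) : Prop :=
  ∃ ξ η : ℕ → H, Summable (fun n => ‖ξ n‖ ^ 2) ∧ Summable (fun n => ‖η n‖ ^ 2) ∧
    ∀ a : A, HasSum (fun n => ⟪ξ n, (e a : H →L[ℂ] H) (η n)⟫_ℂ) (φ a)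

/-- `(A, φ, ψ)` is a two-state `W*`-probability space: `A` is (star-isomorphic to) a von Neumann
algebra, `φ` and `ψ` are normal states on it, and `φ` is faithful. (That `φ` and `ψ` are states
is required separately, in `IsPositiveUnital`.) -/
def IsFaithfulWStarSpace {A : Type u} [Ring A] [StarRing A] [Algebra ℂ A]
    (φ ψ : A →ₗ[ℂ] ℂ) : Prop :=
  (∃ (H : Type u) (_ : NormedAddCommGroup H) (_ : InnerProductSpace ℂ H) (_ : CompleteSpace H)
    (M : VonNeumannAlgebra H) (e : A ≃⋆ₐ[ℂ] M.toStarSubalgebra),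
    IsNormalFunctional M e φ ∧ IsNormalFunctional M e ψ) ∧
  ∀ a : A, φ (star a * a) = 0 → a = 0

/-- The subalgebras `S i` are two-state freely independent: whenever `aⱼ ∈ S (i j)`,
neighbouring indices differ, and `ψ[aⱼ] = 0` for all `j`, then `ψ[a₁ ⋯ aₙ] = 0` and
`φ[a₁ ⋯ aₙ] = φ[a₁] ⋯ φ[aₙ]`. -/
def TwoStateFree {A : Type*} [Ring A] [Algebra ℂ A] (φ ψ : A →ₗ[ℂ] ℂ) {ι : Type*}
    (S : ι → Subalgebra ℂ A) : Prop :=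
  ∀ (n : ℕ) (i : Fin (n + 1) → ι) (a : Fin (n + 1) → A),
    (∀ j, a j ∈ S (i j)) → (∀ j : Fin n, i j.castSucc ≠ i j.succ) → (∀ j, ψ (a j) = 0) →
      ψ (List.ofFn a).prod = 0 ∧ φ (List.ofFn a).prod = ∏ j, φ (a j)

/-! ### Two-state free Brownian motion -/

/-- `{X(t), 0 ≤ t ≤ T}` is a process with two-state freely independent increments: the `X(t)` are
self-adjoint, `X(0) = 0`, `φ[X(t)] = 0`, the `φ`- and `ψ`-distributions of `X(t) - X(s)` depend on
`t - s` only (so they are those of `X(t - s)`), and the unital algebras generated by the increments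
over pairwise disjoint intervals `[s, t)` are two-state freely independent. -/
structure IsTwoStateFreeIncrementProcess {A : Type*} [Ring A] [StarRing A] [Algebra ℂ A]
    (φ ψ : A →ₗ[ℂ] ℂ) (T : ℝ) (X : ℝ → A) : Prop where
  selfAdjoint : ∀ t ∈ Set.Icc 0 T, IsSelfAdjoint (X t)
  zero : X 0 = 0
  mean_zero : ∀ t ∈ Set.Icc 0 T, φ (X t) = 0
  stationary : ∀ s t : ℝ, 0 ≤ s → s ≤ t → t ≤ T → ∀ n : ℕ,
    φ ((X t - X s) ^ n) = φ (X (t - s) ^ n) ∧ ψ ((X t - X s) ^ n) = ψ (X (t - s) ^ n)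
  free : ∀ (k : ℕ) (s t : Fin k → ℝ), (∀ i, 0 ≤ s i ∧ s i ≤ t i ∧ t i ≤ T) →
    Pairwise (fun i j => Disjoint (Set.Ico (s i) (t i)) (Set.Ico (s j) (t j))) →
      TwoStateFree φ ψ (fun i => Algebra.adjoin ℂ {X (t i) - X (s i)})

/-- `{X(t), 0 ≤ t ≤ T}` is an algebraic two-state free Brownian motion: its two-state freely
independent increments have two-state normal distributions (`R^{φ,ψ}_n = 0` for `n > 2`),
`φ`-mean zero, and `φ`-variance `t - s`. -/
structure IsTwoStateFreeBrownianMotion {A : Type*} [Ring A] [StarRing A] [Algebra ℂ A]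
    (φ ψ : A →ₗ[ℂ] ℂ) (T : ℝ) (X : ℝ → A) : Prop
    extends IsTwoStateFreeIncrementProcess φ ψ T X where
  normal : ∀ s t : ℝ, 0 ≤ s → s ≤ t → t ≤ T → ∀ n : ℕ, 2 < n →
    twoStateCumulant φ ψ n (fun _ => X t - X s) = 0
  increment_mean : ∀ s t : ℝ, 0 ≤ s → s ≤ t → t ≤ T → φ (X t - X s) = 0
  increment_variance : ∀ s t : ℝ, 0 ≤ s → s ≤ t → t ≤ T → φ ((X t - X s) ^ 2) = ((t - s : ℝ) : ℂ)

/-- The process has parameter `α`: `R^ψ_1(X(t)) = α t` at every time `t`. -/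
def HasParameter {A : Type*} [Ring A] [Algebra ℂ A] (ψ : A →ₗ[ℂ] ℂ) (T : ℝ) (X : ℝ → A)
    (α : ℝ) : Prop :=
  ∀ t ∈ Set.Icc 0 T, freeCumulant ψ 1 (fun _ => X t) = ((α * t : ℝ) : ℂ)

/-- The `ψ`-distributions have vanishing free cumulants of order `> 2` and `R^ψ_2(X(t)) = t`.
This singles out the processes with a parameter when `φ` is not assumed to be faithful. -/
def HasQuadraticPsiCumulants {A : Type*} [Ring A] [Algebra ℂ A] (ψ : A →ₗ[ℂ] ℂ) (T : ℝ)
    (X : ℝ → A) : Prop :=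
  ∀ t ∈ Set.Icc 0 T, freeCumulant ψ 2 (fun _ => X t) = (t : ℂ) ∧
    ∀ k : ℕ, 2 < k → freeCumulant ψ k (fun _ => X t) = 0

/-! ### Distributions -/

/-- The probability measure `μ` on `ℝ` is a distribution of `a` with respect to `φ`: it has
finite moments of all orders, and these are the moments `φ[aⁿ]`. -/
structure IsDistribution {A : Type*} [Ring A] [Algebra ℂ A] (φ : A →ₗ[ℂ] ℂ) (a : A)
    (μ : Measure ℝ) : Prop where
  prob : IsProbabilityMeasure μ
  integrable : ∀ n : ℕ, Integrable (fun x : ℝ => x ^ n) μ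
  moment : ∀ n : ℕ, φ (a ^ n) = ((∫ x, x ^ n ∂μ : ℝ) : ℂ)

/-- The Cauchy transform `G_ν(z) = ∫ 1 / (z - x) dν(x)`. -/
def cauchyTransform (ν : Measure ℝ) (z : ℂ) : ℂ := ∫ x : ℝ, 1 / (z - (x : ℂ)) ∂ν

/-- `μ = Φ_t[ν]`: `μ` is the probability measure with `G_μ(z) = 1 / (z - t G_ν(z))` on the
upper half-plane. -/
structure IsJacobiShift (t : ℝ) (ν μ : Measure ℝ) : Prop where
  prob : IsProbabilityMeasure μ
  cauchy : ∀ z : ℂ, 0 < z.im →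
    cauchyTransform μ z = 1 / (z - (t : ℂ) * cauchyTransform ν z)

/-- The semicircular distribution with mean `m` and variance `v`. -/
def semicircleLaw (m v : ℝ) : Measure ℝ :=
  volume.withDensity (fun x =>
    ENNReal.ofReal (1 / (2 * Real.pi * v) * Real.sqrt (max (4 * v - (x - m) ^ 2) 0)))

end

/-! ### Weighted sums over non-crossing partitions -/

/-! Everything is decided by moments. If the outer cumulants vanish beyond order two, the block of
the first point is a singleton or a pair, and splitting the non-crossing sum there gives a quadratic
recursion (`ncSum_range_succ`). For `φ`, with mean zero and variance `t`, it reads φ(Xⁿ⁺²) = t ∑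
ψ(Xʲ) φ(Xⁿ⁻ʲ), the moment form of G_μ = 1/(z - t G_ν). What remains is to show that the `ψ`-moments
are semicircular and to solve this equation.

In the algebraic setting the same recursion holds for `ψ`. In the W*-setting the claim is a rigidity
statement. Cut [0, t] into N equal pieces with increments Δᵢ. Free cumulants are additive over free
sums (`IsFreeAppell.add`), so N ψ(Δᵏ) tends to the k-th free cumulant of X(t), while the
`φ`-recursion forces N φ(Δᵏ) → t for k = 2 and → 0 otherwise. For k ≥ 2 the sum ∑ Δᵢᵏ therefore
converges in L²(φ) to a scalar τ, equal to t or 0, and stays bounded in L²(ψ). As `φ` is faithful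
and both states are normal, the `ψ`-means of the sums have the same limit τ
(`IsFaithfulWStarSpace.eq_zero_of_tendsto`). So the second cumulant is t and the higher ones vanish;
the first is the parameter times t. The limit lemma truncates with resolvents, since it assumes only
L² control.

Semicircular moments occur as solutions of a recursion, as moments with two nonzero cumulants, and
as integrals. All three satisfy the three-term recurrence of `semicircleArray`, which pairs powers
with the orthogonal polynomials.

For the `φ`-law, the two quadratic equations combine to M_n + α M_{n+1} = m_n
(`jacobiShift_moment`), that is, (1 + αx) dμ = dν. Hence μ is ν divided by 1 + αx, plus an atom at
the zero of 1 + αx carrying the missing mass. Bounded support makes these laws unique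
(`eq_of_moments`), and the law of 1 + αX(t) is an affine image. -/

/-- The finite set `p` of blocks is a non-crossing partition of `s`. -/
structure IsNCPartition {β : Type*} [LinearOrder β] (s : Finset β) (p : Finset (Finset β)) :
    Prop where
  subset : ∀ V ∈ p, V ⊆ s
  nonempty : ∀ V ∈ p, V.Nonempty
  cover : ∀ x ∈ s, ∃ V ∈ p, x ∈ V
  disj : ∀ U ∈ p, ∀ V ∈ p, ∀ x, x ∈ U → x ∈ V → U = V
  nonCrossing : ∀ U ∈ p, ∀ V ∈ p, ∀ x₁ ∈ U, ∀ x₂ ∈ U, ∀ y₁ ∈ V, ∀ y₂ ∈ V,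
    x₁ < y₁ → y₁ < x₂ → x₂ < y₂ → U = V

/-- The block `V` lies strictly between two elements of one block of `p`. -/
def BlockInner {β : Type*} [LinearOrder β] (p : Finset (Finset β)) (V : Finset β) : Prop :=
  ∃ W ∈ p, ∃ y₁ ∈ W, ∃ y₂ ∈ W, ∀ x ∈ V, y₁ < x ∧ x < y₂

open Classical in
/-- The non-crossing partitions of `s`, as sets of blocks. -/
noncomputable def ncPartitions {β : Type*} [LinearOrder β] (s : Finset β) :
    Finset (Finset (Finset β)) :=
  s.powerset.powerset.filter (IsNCPartition s)

open Classical in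
/-- The weight of a block: `r` for inner blocks and `R` for outer blocks. -/
noncomputable def blockWeight {β : Type*} [LinearOrder β] (R r : ℕ → ℂ)
    (p : Finset (Finset β)) (V : Finset β) : ℂ :=
  if BlockInner p V then r V.card else R V.card

/-- The sum over the non-crossing partitions of `s` of the products of block weights. -/
noncomputable def ncSum {β : Type*} [LinearOrder β] (R r : ℕ → ℂ) (s : Finset β) : ℂ :=
  ∑ p ∈ ncPartitions s, ∏ V ∈ p, blockWeight R r p V

theorem mem_ncPartitions {β : Type*} [LinearOrder β] {s : Finset β} {p : Finset (Finset β)} :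
    p ∈ ncPartitions s ↔ IsNCPartition s p := by
  simp only [ncPartitions, Finset.mem_filter, Finset.mem_powerset, and_iff_right_iff_imp]
  intro h V hV
  exact Finset.mem_powerset.mpr (h.subset V hV)

/-! ### Splitting a non-crossing partition at its first block. -/

section Decomposition

variable {β : Type*} [LinearOrder β] {B s₁ s₂ : Finset β}

/-- `h1` and `hsep` place `s₁` inside a single gap of `B`, and `h2` places `s₂` to its right. Blocks
living in different regions are then nested or side by side, so no crossing arises beyond those
excluded inside `p` and `q`. -/
theorem IsNCPartition.insert_union (hB : B.Nonempty)
    (h1 : ∀ x ∈ s₁, ∃ y₁ ∈ B, ∃ y₂ ∈ B, y₁ < x ∧ x < y₂)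
    (hsep : ∀ y ∈ B, (∀ x ∈ s₁, y < x) ∨ (∀ x ∈ s₁, x < y))
    (h2 : ∀ y ∈ B, ∀ z ∈ s₂, y < z)
    {p q : Finset (Finset β)} (hp : IsNCPartition s₁ p) (hq : IsNCPartition s₂ q) :
    IsNCPartition (B ∪ (s₁ ∪ s₂)) (insert B (p ∪ q)) := by
  have h12 : ∀ x ∈ s₁, ∀ z ∈ s₂, x < z := fun x hx z hz => by
    obtain ⟨_, _, y, hy, _, hxy⟩ := h1 x hx
    exact hxy.trans (h2 y hy z hz)
  have hB1 : ∀ x ∈ B, x ∉ s₁ := fun x hx hx1 => by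
    rcases hsep x hx with h | h <;> exact lt_irrefl _ (h x hx1)
  have hB2 : ∀ x ∈ B, x ∉ s₂ := fun x hx hx1 => lt_irrefl _ (h2 x hx x hx1)
  have hs12 : ∀ x ∈ s₁, x ∉ s₂ := fun x hx hx1 => lt_irrefl _ (h12 x hx x hx1)
  refine ⟨?_, ?_, ?_, ?_, ?_⟩
  · intro V hV
    rcases Finset.mem_insert.mp hV with rfl | hV
    · exact Finset.subset_union_left
    · rcases Finset.mem_union.mp hV with hV | hV
      · exact (hp.subset V hV).trans (Finset.subset_union_left.trans Finset.subset_union_right)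
      · exact (hq.subset V hV).trans (Finset.subset_union_right.trans Finset.subset_union_right)
  · intro V hV
    rcases Finset.mem_insert.mp hV with rfl | hV
    · exact hB
    · rcases Finset.mem_union.mp hV with hV | hV
      exacts [hp.nonempty V hV, hq.nonempty V hV]
  · intro x hx
    rcases Finset.mem_union.mp hx with hx | hx
    · exact ⟨B, Finset.mem_insert_self _ _, hx⟩
    · rcases Finset.mem_union.mp hx with hx | hx
      · obtain ⟨V, hV, hxV⟩ := hp.cover x hx
        exact ⟨V, by simp [hV], hxV⟩
      · obtain ⟨V, hV, hxV⟩ := hq.cover x hx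
        exact ⟨V, by simp [hV], hxV⟩
  · intro U hU V hV x hxU hxV
    simp only [Finset.mem_insert, Finset.mem_union] at hU hV
    rcases hU with rfl | hU | hU <;> rcases hV with rfl | hV | hV
    · rfl
    · exact absurd (hp.subset V hV hxV) (hB1 x hxU)
    · exact absurd (hq.subset V hV hxV) (hB2 x hxU)
    · exact absurd (hp.subset U hU hxU) (hB1 x hxV)
    · exact hp.disj U hU V hV x hxU hxV
    · exact absurd (hq.subset V hV hxV) (hs12 x (hp.subset U hU hxU))
    · exact absurd (hq.subset U hU hxU) (hB2 x hxV)
    · exact absurd (hq.subset U hU hxU) (hs12 x (hp.subset V hV hxV))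
    · exact hq.disj U hU V hV x hxU hxV
  · intro U hU V hV x₁ hx₁ x₂ hx₂ y₁ hy₁ y₂ hy₂ l1 l2 l3
    simp only [Finset.mem_insert, Finset.mem_union] at hU hV
    rcases hU with rfl | hU | hU <;> rcases hV with rfl | hV | hV
    · rfl
    · rcases hsep x₂ hx₂ with h | h
      · exact absurd (h y₁ (hp.subset V hV hy₁)) l2.not_gt
      · exact absurd (h y₂ (hp.subset V hV hy₂)) l3.not_gt
    · exact absurd (h2 x₂ hx₂ y₁ (hq.subset V hV hy₁)) l2.not_gt
    · rcases hsep y₁ hy₁ with h | h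
      · exact absurd (h x₁ (hp.subset U hU hx₁)) l1.not_gt
      · exact absurd (h x₂ (hp.subset U hU hx₂)) l2.not_gt
    · exact hp.nonCrossing U hU V hV x₁ hx₁ x₂ hx₂ y₁ hy₁ y₂ hy₂ l1 l2 l3
    · exact absurd (h12 x₂ (hp.subset U hU hx₂) y₁ (hq.subset V hV hy₁)) l2.not_gt
    · exact absurd (h2 y₁ hy₁ x₁ (hq.subset U hU hx₁)) l1.not_gt
    · exact absurd (h12 y₁ (hp.subset V hV hy₁) x₁ (hq.subset U hU hx₁)) l1.not_gt
    · exact hq.nonCrossing U hU V hV x₁ hx₁ x₂ hx₂ y₁ hy₁ y₂ hy₂ l1 l2 l3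

/-- A block meeting both `s₁` and `s₂` would cross `B`, since it enters a gap of `B` and leaves to
the right. -/
theorem IsNCPartition.subset_or_subset
    (h1 : ∀ x ∈ s₁, ∃ y₁ ∈ B, ∃ y₂ ∈ B, y₁ < x ∧ x < y₂)
    (h2 : ∀ y ∈ B, ∀ z ∈ s₂, y < z)
    {p : Finset (Finset β)} (hp : IsNCPartition (B ∪ (s₁ ∪ s₂)) p) (hBp : B ∈ p)
    {V : Finset β} (hV : V ∈ p) : V = B ∨ V ⊆ s₁ ∨ V ⊆ s₂ := by
  by_cases hVB : V = B
  · exact Or.inl hVB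
  have hmem : ∀ x ∈ V, x ∈ s₁ ∨ x ∈ s₂ := fun x hx => by
    rcases Finset.mem_union.mp (hp.subset V hV hx) with h | h
    · exact absurd (hp.disj V hV B hBp x hx h) hVB
    · exact Finset.mem_union.mp h
  by_cases h : ∃ x ∈ V, x ∈ s₁
  · obtain ⟨x, hxV, hx1⟩ := h
    refine Or.inr (Or.inl fun z hz => (hmem z hz).resolve_right fun hz2 => hVB ?_)
    obtain ⟨y₁, hy₁, y₂, hy₂, l1, l2⟩ := h1 x hx1
    exact (hp.nonCrossing B hBp V hV y₁ hy₁ y₂ hy₂ x hxV z hz l1 l2 (h2 y₂ hy₂ z hz2)).symm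
  · push Not at h
    exact Or.inr (Or.inr fun z hz => (hmem z hz).resolve_left (h z hz))

theorem IsNCPartition.filter_subset {s t : Finset β} {p : Finset (Finset β)}
    (hp : IsNCPartition s p) (h : ∀ V ∈ p, ∀ x ∈ V, x ∈ t → V ⊆ t) (ht : t ⊆ s) :
    IsNCPartition t (p.filter (· ⊆ t)) := by
  refine ⟨fun V hV => (Finset.mem_filter.mp hV).2,
    fun V hV => hp.nonempty V (Finset.mem_filter.mp hV).1, fun x hx => ?_,
    fun U hU V hV => hp.disj U (Finset.mem_filter.mp hU).1 V (Finset.mem_filter.mp hV).1,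
    fun U hU V hV => hp.nonCrossing U (Finset.mem_filter.mp hU).1 V (Finset.mem_filter.mp hV).1⟩
  obtain ⟨V, hV, hxV⟩ := hp.cover x (ht hx)
  exact ⟨V, Finset.mem_filter.mpr ⟨hV, h V hV x hxV hx⟩, hxV⟩

/-- Blocks of `p` become inner because `B` surrounds them, which is why their product carries `r` in
both slots. Nothing surrounds `B`, and neither `B` nor `p` surrounds a block of `q`, so these keep
their status. -/
theorem prod_blockWeight_insert_union (R r : ℕ → ℂ) (hB : B.Nonempty)
    (h1 : ∀ x ∈ s₁, ∃ y₁ ∈ B, ∃ y₂ ∈ B, y₁ < x ∧ x < y₂)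
    (hsep : ∀ y ∈ B, (∀ x ∈ s₁, y < x) ∨ (∀ x ∈ s₁, x < y))
    (h2 : ∀ y ∈ B, ∀ z ∈ s₂, y < z)
    {p q : Finset (Finset β)} (hp : IsNCPartition s₁ p) (hq : IsNCPartition s₂ q) :
    ∏ V ∈ insert B (p ∪ q), blockWeight R r (insert B (p ∪ q)) V =
      R B.card * ((∏ V ∈ p, blockWeight r r p V) * ∏ V ∈ q, blockWeight R r q V) := by
  have h12 : ∀ x ∈ s₁, ∀ z ∈ s₂, x < z := fun x hx z hz => by
    obtain ⟨_, _, y, hy, _, hxy⟩ := h1 x hx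
    exact hxy.trans (h2 y hy z hz)
  have hBp : B ∉ p := fun h => by
    obtain ⟨x, hx⟩ := hB
    rcases hsep x hx with h' | h' <;> exact lt_irrefl _ (h' x (hp.subset B h hx))
  have hBq : B ∉ q := fun h => by
    obtain ⟨x, hx⟩ := hB
    exact lt_irrefl _ (h2 x hx x (hq.subset B h hx))
  have hpq : Disjoint p q := Finset.disjoint_left.mpr fun V hVp hVq => by
    obtain ⟨x, hx⟩ := hp.nonempty V hVp
    exact lt_irrefl _ (h12 x (hp.subset V hVp hx) x (hq.subset V hVq hx))
  rw [Finset.prod_insert (by simp [hBp, hBq]), Finset.prod_union hpq]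
  congr 1
  · refine if_neg ?_
    rintro ⟨W, hW, y₁, hy₁, y₂, hy₂, h⟩
    simp only [Finset.mem_insert, Finset.mem_union] at hW
    rcases hW with rfl | hW | hW
    · exact lt_irrefl _ (h y₁ hy₁).1
    · obtain ⟨b, hb, _, _, hlt, _⟩ := h1 y₁ (hp.subset W hW hy₁)
      exact absurd (h b hb).1 hlt.not_gt
    · obtain ⟨b, hb⟩ := hB
      exact absurd (h b hb).1 (h2 b hb y₁ (hq.subset W hW hy₁)).not_gt
  congr 1
  · refine Finset.prod_congr rfl fun V hV => ?_
    simp only [blockWeight, ite_self]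
    refine if_pos ⟨B, Finset.mem_insert_self _ _, ?_⟩
    obtain ⟨x₀, hx₀⟩ := hp.nonempty V hV
    obtain ⟨y₁, hy₁, y₂, hy₂, l1, l2⟩ := h1 x₀ (hp.subset V hV hx₀)
    refine ⟨y₁, hy₁, y₂, hy₂, fun x hx => ⟨?_, ?_⟩⟩
    · rcases hsep y₁ hy₁ with h | h
      · exact h x (hp.subset V hV hx)
      · exact absurd (h x₀ (hp.subset V hV hx₀)) l1.not_gt
    · rcases hsep y₂ hy₂ with h | h
      · exact absurd (h x₀ (hp.subset V hV hx₀)) l2.not_gt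
      · exact h x (hp.subset V hV hx)
  · refine Finset.prod_congr rfl fun V hV => ?_
    have : BlockInner (insert B (p ∪ q)) V ↔ BlockInner q V := by
      constructor
      · rintro ⟨W, hW, y₁, hy₁, y₂, hy₂, h⟩
        obtain ⟨x, hx⟩ := hq.nonempty V hV
        have hx2 := hq.subset V hV hx
        simp only [Finset.mem_insert, Finset.mem_union] at hW
        rcases hW with rfl | hW | hW
        · exact absurd (h x hx).2 (h2 y₂ hy₂ x hx2).not_gt
        · exact absurd (h x hx).2 (h12 y₂ (hp.subset W hW hy₂) x hx2).not_gt
        · exact ⟨W, hW, y₁, hy₁, y₂, hy₂, h⟩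
      · rintro ⟨W, hW, h⟩
        exact ⟨W, by simp [hW], h⟩
    classical exact if_congr this rfl rfl

/-- The sum over the non-crossing partitions with a given first block `B`, where the only gap of
`B` that contains other points is `s₁`, and `s₂` are the points to the right of `B`. -/
theorem sum_ncPartitions_mem (R r : ℕ → ℂ) (hB : B.Nonempty)
    (h1 : ∀ x ∈ s₁, ∃ y₁ ∈ B, ∃ y₂ ∈ B, y₁ < x ∧ x < y₂)
    (hsep : ∀ y ∈ B, (∀ x ∈ s₁, y < x) ∨ (∀ x ∈ s₁, x < y))
    (h2 : ∀ y ∈ B, ∀ z ∈ s₂, y < z) :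
    ∑ p ∈ ncPartitions (B ∪ (s₁ ∪ s₂)) with B ∈ p, ∏ V ∈ p, blockWeight R r p V =
      R B.card * (ncSum r r s₁ * ncSum R r s₂) := by
  have h12 : ∀ x ∈ s₁, ∀ z ∈ s₂, x < z := fun x hx z hz => by
    obtain ⟨_, _, y, hy, _, hxy⟩ := h1 x hx
    exact hxy.trans (h2 y hy z hz)
  have hs12 : ∀ x ∈ s₁, x ∉ s₂ := fun x hx hx1 => lt_irrefl _ (h12 x hx x hx1)
  have hB1 : ∀ x ∈ B, x ∉ s₁ := fun x hx hx1 => by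
    rcases hsep x hx with h | h <;> exact lt_irrefl _ (h x hx1)
  have hB2 : ∀ x ∈ B, x ∉ s₂ := fun x hx hx1 => lt_irrefl _ (h2 x hx x hx1)
  rw [ncSum, ncSum, Finset.sum_mul_sum, ← Finset.sum_product', Finset.mul_sum]
  symm
  refine Finset.sum_bij' (fun pq _ => insert B (pq.1 ∪ pq.2))
    (fun p _ => (p.filter (· ⊆ s₁), p.filter (· ⊆ s₂))) ?_ ?_ ?_ ?_ ?_
  · rintro ⟨p, q⟩ h
    simp only [Finset.mem_product, mem_ncPartitions] at h
    simp only [Finset.mem_filter, mem_ncPartitions]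
    exact ⟨h.1.insert_union hB h1 hsep h2 h.2, Finset.mem_insert_self _ _⟩
  · intro p h
    simp only [Finset.mem_filter, mem_ncPartitions] at h
    simp only [Finset.mem_product, mem_ncPartitions]
    constructor
    · refine h.1.filter_subset (fun V hV x hxV hx => ?_)
        (Finset.subset_union_left.trans Finset.subset_union_right)
      rcases h.1.subset_or_subset h1 h2 h.2 hV with rfl | h' | h'
      · exact absurd hx (hB1 x hxV)
      · exact h'
      · exact absurd (h' hxV) (hs12 x hx)
    · refine h.1.filter_subset (fun V hV x hxV hx => ?_)
        (Finset.subset_union_right.trans Finset.subset_union_right)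
      rcases h.1.subset_or_subset h1 h2 h.2 hV with rfl | h' | h'
      · exact absurd hx (hB2 x hxV)
      · exact absurd hx (hs12 x (h' hxV))
      · exact h'
  · rintro ⟨p, q⟩ h
    simp only [Finset.mem_product, mem_ncPartitions] at h
    obtain ⟨b, hb⟩ := hB
    simp only [Prod.mk.injEq]
    constructor
    · ext V
      simp only [Finset.mem_filter, Finset.mem_insert, Finset.mem_union]
      constructor
      · rintro ⟨rfl | hV | hV, hs⟩
        · exact absurd (hs hb) (hB1 b hb)
        · exact hV
        · obtain ⟨x, hx⟩ := h.2.nonempty V hV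
          exact absurd (h.2.subset V hV hx) (hs12 x (hs hx))
      · exact fun hV => ⟨Or.inr (Or.inl hV), h.1.subset V hV⟩
    · ext V
      simp only [Finset.mem_filter, Finset.mem_insert, Finset.mem_union]
      constructor
      · rintro ⟨rfl | hV | hV, hs⟩
        · exact absurd (hs hb) (hB2 b hb)
        · obtain ⟨x, hx⟩ := h.1.nonempty V hV
          exact absurd (hs hx) (hs12 x (h.1.subset V hV hx))
        · exact hV
      · exact fun hV => ⟨Or.inr (Or.inr hV), h.2.subset V hV⟩
  · intro p h
    simp only [Finset.mem_filter, mem_ncPartitions] at h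
    ext V
    simp only [Finset.mem_filter, Finset.mem_insert, Finset.mem_union]
    constructor
    · rintro (rfl | hV | hV)
      exacts [h.2, hV.1, hV.1]
    · intro hV
      rcases h.1.subset_or_subset h1 h2 h.2 hV with rfl | h' | h'
      · exact Or.inl rfl
      · exact Or.inr (Or.inl ⟨hV, h'⟩)
      · exact Or.inr (Or.inr ⟨hV, h'⟩)
  · rintro ⟨p, q⟩ h
    simp only [Finset.mem_product, mem_ncPartitions] at h
    exact (prod_blockWeight_insert_union R r hB h1 hsep h2 h.1 h.2).symm

end Decomposition

theorem ncSum_empty {β : Type*} [LinearOrder β] (R r : ℕ → ℂ) : ncSum R r (∅ : Finset β) = 1 := by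
  have : ncPartitions (∅ : Finset β) = {∅} := by
    ext p
    rw [mem_ncPartitions, Finset.mem_singleton]
    constructor
    · intro h
      refine Finset.eq_empty_of_forall_notMem fun V hV => ?_
      obtain ⟨x, hx⟩ := h.nonempty V hV
      exact absurd (h.subset V hV hx) (Finset.notMem_empty x)
    · rintro rfl
      exact ⟨by simp, by simp, by simp, by simp, by simp⟩
  rw [ncSum, this]
  simp

theorem IsNCPartition.map {β γ : Type*} [LinearOrder β] [LinearOrder γ] (f : β ↪o γ)
    {s : Finset β} {p : Finset (Finset β)} (hp : IsNCPartition s p) :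
    IsNCPartition (s.map f.toEmbedding)
      (p.map (Finset.mapEmbedding f.toEmbedding).toEmbedding) := by
  refine ⟨?_, ?_, ?_, ?_, ?_⟩
  · simp only [Finset.mem_map, forall_exists_index, and_imp]
    rintro _ V hV rfl
    exact Finset.map_subset_map.mpr (hp.subset V hV)
  · simp only [Finset.mem_map, forall_exists_index, and_imp]
    rintro _ V hV rfl
    exact (hp.nonempty V hV).map
  · simp only [Finset.mem_map, forall_exists_index, and_imp]
    rintro _ x hx rfl
    obtain ⟨V, hV, hxV⟩ := hp.cover x hx
    exact ⟨_, ⟨V, hV, rfl⟩, Finset.mem_map_of_mem _ hxV⟩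
  · simp only [Finset.mem_map, forall_exists_index, and_imp]
    rintro _ U hU rfl _ V hV rfl x hxU hxV
    obtain ⟨u, hu, rfl⟩ := Finset.mem_map.mp hxU
    rw [hp.disj U hU V hV u hu ((Finset.mem_map' f.toEmbedding).mp hxV)]
  · simp only [Finset.mem_map, forall_exists_index, and_imp]
    rintro _ U hU rfl _ V hV rfl x₁ hx₁ x₂ hx₂ y₁ hy₁ y₂ hy₂ l1 l2 l3
    obtain ⟨x₁, mx₁, rfl⟩ := Finset.mem_map.mp hx₁
    obtain ⟨x₂, mx₂, rfl⟩ := Finset.mem_map.mp hx₂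
    obtain ⟨y₁, my₁, rfl⟩ := Finset.mem_map.mp hy₁
    obtain ⟨y₂, my₂, rfl⟩ := Finset.mem_map.mp hy₂
    rw [hp.nonCrossing U hU V hV x₁ mx₁ x₂ mx₂ y₁ my₁ y₂ my₂ (f.lt_iff_lt.mp l1)
      (f.lt_iff_lt.mp l2) (f.lt_iff_lt.mp l3)]

theorem blockInner_map {β γ : Type*} [LinearOrder β] [LinearOrder γ] (f : β ↪o γ)
    (p : Finset (Finset β)) (V : Finset β) :
    BlockInner (p.map (Finset.mapEmbedding f.toEmbedding).toEmbedding) (V.map f.toEmbedding) ↔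
      BlockInner p V := by
  simp [BlockInner]

theorem ncSum_map {β γ : Type*} [LinearOrder β] [LinearOrder γ] (f : β ↪o γ) (R r : ℕ → ℂ)
    (s : Finset β) : ncSum R r (s.map f.toEmbedding) = ncSum R r s := by
  classical
  symm
  refine Finset.sum_bij (fun p _ => p.map (Finset.mapEmbedding f.toEmbedding).toEmbedding)
    ?_ ?_ ?_ ?_
  · intro p hp
    exact mem_ncPartitions.mpr ((mem_ncPartitions.mp hp).map f)
  · intro p _ q _ h
    exact Finset.map_injective _ h
  · intro q hq
    rw [mem_ncPartitions] at hq
    set p : Finset (Finset β) := s.powerset.filter (fun V => V.map f.toEmbedding ∈ q) with hpdef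
    have hpq : p.map (Finset.mapEmbedding f.toEmbedding).toEmbedding = q := by
      ext V
      simp only [hpdef, Finset.mem_map, Finset.mem_filter, Finset.mem_powerset]
      constructor
      · rintro ⟨U, ⟨_, hU⟩, rfl⟩
        exact hU
      · intro hV
        obtain ⟨U, hU, rfl⟩ := Finset.subset_map_iff.mp (hq.subset V hV)
        exact ⟨U, ⟨hU, hV⟩, rfl⟩
    refine ⟨p, mem_ncPartitions.mpr ⟨?_, ?_, ?_, ?_, ?_⟩, hpq⟩
    · intro V hV
      exact Finset.mem_powerset.mp (Finset.mem_filter.mp hV).1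
    · intro V hV
      exact Finset.map_nonempty.mp (hq.nonempty _ (Finset.mem_filter.mp hV).2)
    · intro x hx
      obtain ⟨V, hV, hxV⟩ := hq.cover _ (Finset.mem_map_of_mem f.toEmbedding hx)
      obtain ⟨U, hU, rfl⟩ := Finset.subset_map_iff.mp (hq.subset V hV)
      exact ⟨U, Finset.mem_filter.mpr ⟨Finset.mem_powerset.mpr hU, hV⟩,
        (Finset.mem_map' _).mp hxV⟩
    · intro U hU V hV x hxU hxV
      exact Finset.map_injective _ (hq.disj _ (Finset.mem_filter.mp hU).2 _
        (Finset.mem_filter.mp hV).2 _ (Finset.mem_map_of_mem _ hxU) (Finset.mem_map_of_mem _ hxV))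
    · intro U hU V hV x₁ hx₁ x₂ hx₂ y₁ hy₁ y₂ hy₂ l1 l2 l3
      exact Finset.map_injective _ (hq.nonCrossing _ (Finset.mem_filter.mp hU).2 _
        (Finset.mem_filter.mp hV).2 _ (Finset.mem_map_of_mem _ hx₁) _ (Finset.mem_map_of_mem _ hx₂)
        _ (Finset.mem_map_of_mem _ hy₁) _ (Finset.mem_map_of_mem _ hy₂) (f.lt_iff_lt.mpr l1)
        (f.lt_iff_lt.mpr l2) (f.lt_iff_lt.mpr l3))
  · intro p _
    rw [Finset.prod_map]
    refine Finset.prod_congr rfl fun V _ => ?_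
    have h : (Finset.mapEmbedding f.toEmbedding).toEmbedding V = V.map f.toEmbedding := rfl
    simp only [blockWeight, h, blockInner_map, Finset.card_map]

theorem ncSum_Ico (R r : ℕ → ℂ) (a b : ℕ) :
    ncSum R r (Finset.Ico a b) = ncSum R r (Finset.range (b - a)) := by
  rw [← ncSum_map (OrderEmbedding.ofStrictMono (fun x => x + a)
    (fun x y h => by simpa using h)) R r (Finset.range (b - a))]
  congr 1
  ext x
  simp only [Finset.mem_Ico, Finset.mem_map, Finset.mem_range]
  constructor
  · intro h
    refine ⟨x - a, by omega, ?_⟩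
    change x - a + a = x
    omega
  · rintro ⟨y, hy, rfl⟩
    change a ≤ y + a ∧ y + a < b
    omega

/-- If outer blocks of more than two elements have weight zero, the sum over the non-crossing
partitions satisfies a quadratic recursion. -/
theorem ncSum_range_succ (R r : ℕ → ℂ) (hR : ∀ k, 2 < k → R k = 0) (n : ℕ) :
    ncSum R r (Finset.range (n + 1)) = R 1 * ncSum R r (Finset.range n) +
      R 2 * ∑ j ∈ Finset.range n,
        ncSum r r (Finset.range j) * ncSum R r (Finset.range (n - 1 - j)) := by
  classical
  set w : Finset (Finset ℕ) → ℂ := fun p => ∏ V ∈ p, blockWeight R r p V with hw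
  set S := ncPartitions (Finset.range (n + 1)) with hS
  have hfirst : ∑ p ∈ S with {0} ∈ p, w p = R 1 * ncSum R r (Finset.range n) := by
    have h := sum_ncPartitions_mem (B := {0}) (s₁ := ∅) (s₂ := Finset.Ico 1 (n + 1)) R r
      (by simp) (by simp) (by simp) (by simp; omega)
    have hs : ({0} ∪ (∅ ∪ Finset.Ico 1 (n + 1)) : Finset ℕ) = Finset.range (n + 1) := by
      ext x
      simp
      omega
    rw [hs, ncSum_empty, ncSum_Ico] at h
    simpa using h
  have hpair : ∀ j ∈ Finset.range n, ∑ p ∈ S with {0, j + 1} ∈ p, w p =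
      R 2 * (ncSum r r (Finset.range j) * ncSum R r (Finset.range (n - 1 - j))) := by
    intro j hj
    rw [Finset.mem_range] at hj
    have h := sum_ncPartitions_mem (B := {0, j + 1}) (s₁ := Finset.Ico 1 (j + 1))
      (s₂ := Finset.Ico (j + 2) (n + 1)) R r (by simp)
      (fun x hx => ⟨0, by simp, j + 1, by simp, by simp at hx; omega⟩)
      (by
        intro y hy
        simp only [Finset.mem_insert, Finset.mem_singleton] at hy
        simp only [Finset.mem_Ico]
        rcases hy with rfl | rfl
        · left
          omega
        · right
          omega)
      (by
        intro y hy
        simp only [Finset.mem_insert, Finset.mem_singleton] at hy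
        simp only [Finset.mem_Ico]
        omega)
    have hs : ({0, j + 1} ∪ (Finset.Ico 1 (j + 1) ∪ Finset.Ico (j + 2) (n + 1)) : Finset ℕ) =
        Finset.range (n + 1) := by
      ext x
      simp
      omega
    rw [hs, ncSum_Ico, ncSum_Ico, Finset.card_pair (by omega)] at h
    rw [h, show j + 1 - 1 = j by omega, show n + 1 - (j + 2) = n - 1 - j by omega]
  -- The indicators are mutually exclusive because only one block contains 0. If none of them holds,
  -- that block has more than two elements; it cannot be inner, as nothing lies below 0, so its
  -- weight `R` is zero.
  have hsplit : ∑ p ∈ S, w p = ∑ p ∈ S, ((if {0} ∈ p then w p else 0) +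
      ∑ j ∈ Finset.range n, if {0, j + 1} ∈ p then w p else 0) := by
    refine Finset.sum_congr rfl fun p hp => ?_
    rw [mem_ncPartitions] at hp
    obtain ⟨B, hB, h0⟩ := hp.cover 0 (by simp)
    have huniq : ∀ V ∈ p, 0 ∈ V → V = B := fun V hV h => hp.disj V hV B hB 0 h h0
    by_cases h1 : {0} ∈ p
    · have hB1 := huniq _ h1 (by simp)
      rw [if_pos h1, Finset.sum_eq_zero, add_zero]
      intro j _
      refine if_neg fun h => ?_
      have := (huniq _ h (by simp)).trans hB1.symm
      have h' : j + 1 ∈ ({0} : Finset ℕ) := this ▸ by simp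
      simp at h'
    rw [if_neg h1, zero_add]
    by_cases h2 : ∃ j ∈ Finset.range n, {0, j + 1} ∈ p
    · obtain ⟨j, hj, hjp⟩ := h2
      rw [Finset.sum_eq_single j, if_pos hjp]
      · intro i _ hij
        refine if_neg fun h => hij ?_
        have := (huniq _ h (by simp)).trans (huniq _ hjp (by simp)).symm
        have h' : i + 1 ∈ ({0, j + 1} : Finset ℕ) := this ▸ by simp
        simpa using h'
      · exact fun h => absurd hj h
    push Not at h2
    rw [Finset.sum_eq_zero fun j hj => if_neg (h2 j hj)]
    have hcard : 2 < B.card := by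
      by_contra! hc
      have h1' : 1 ≤ B.card := Finset.card_pos.mpr ⟨0, h0⟩
      rcases (by omega : B.card = 1 ∨ B.card = 2) with hc | hc
      · obtain ⟨b, rfl⟩ := Finset.card_eq_one.mp hc
        rw [Finset.mem_singleton] at h0
        subst h0
        exact h1 hB
      · have h3 : (B.erase 0).card = 1 := by rw [Finset.card_erase_of_mem h0, hc]
        obtain ⟨b, hb⟩ := Finset.card_eq_one.mp h3
        have hBeq : B = {0, b} := by rw [← Finset.insert_erase h0, hb]
        have hbB : b ∈ B.erase 0 := by rw [hb]; simp
        have hb0 : b ≠ 0 := (Finset.mem_erase.mp hbB).1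
        have hbn := Finset.mem_range.mp (hp.subset B hB (Finset.mem_erase.mp hbB).2)
        refine h2 (b - 1) (Finset.mem_range.mpr (by omega)) ?_
        rw [show b - 1 + 1 = b by omega, ← hBeq]
        exact hB
    refine Finset.prod_eq_zero hB ?_
    rw [blockWeight, if_neg, hR _ hcard]
    rintro ⟨W, _, y₁, _, y₂, _, h⟩
    exact absurd (h 0 h0).1 (Nat.not_lt_zero _)
  rw [ncSum, hsplit, Finset.sum_add_distrib, Finset.sum_comm, ← Finset.sum_filter, hfirst,
    Finset.mul_sum]
  congr 1
  refine Finset.sum_congr rfl fun j hj => ?_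
  rw [← Finset.sum_filter, hpair j hj]

open Classical in
theorem sum_NC_eq_ncSum (R r : ℕ → ℂ) (n : ℕ) :
    ∑ π ∈ NC n, ∏ V ∈ π.parts, (if IsInner π V then r V.card else R V.card) =
      ncSum R r (Finset.range n) := by
  have hmap : (Finset.univ : Finset (Fin n)).map (Fin.valOrderEmb n).toEmbedding =
      Finset.range n := by
    ext x
    simp only [Finset.mem_map, Finset.mem_univ, true_and, Finset.mem_range]
    exact ⟨fun ⟨y, hy⟩ => hy ▸ y.2, fun h => ⟨⟨x, h⟩, rfl⟩⟩
  rw [← hmap, ncSum_map]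
  refine Finset.sum_bij (fun π _ => π.parts) ?_ ?_ ?_ ?_
  · intro π hπ
    simp only [NC, Finset.mem_filter, Finset.mem_univ, true_and] at hπ
    refine mem_ncPartitions.mpr ⟨fun _ _ => Finset.subset_univ _,
      fun V hV => π.nonempty_of_mem_parts hV, fun x hx => ?_,
      fun U hU V hV x hxU hxV => π.eq_of_mem_parts hU hV hxU hxV, hπ⟩
    exact π.exists_mem hx
  · intro π _ σ _ h
    exact Finpartition.ext h
  · intro p hp
    rw [mem_ncPartitions] at hp
    refine ⟨⟨p, ?_, ?_, ?_⟩, ?_, rfl⟩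
    · rw [Finset.supIndep_iff_pairwiseDisjoint]
      intro U hU V hV hUV
      exact Finset.disjoint_left.mpr fun x hxU hxV => hUV (hp.disj U hU V hV x hxU hxV)
    · refine Finset.eq_univ_iff_forall.mpr fun x => ?_
      obtain ⟨V, hV, hxV⟩ := hp.cover x (Finset.mem_univ x)
      exact Finset.mem_sup.mpr ⟨V, hV, hxV⟩
    · intro h
      exact Finset.not_nonempty_empty (hp.nonempty _ h)
    · simp only [NC, Finset.mem_filter, Finset.mem_univ, true_and]
      exact hp.nonCrossing
  · intro π _
    rfl

theorem restrictTuple_const {A : Type*} {n : ℕ} (a : A) (V : Finset (Fin n)) :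
    restrictTuple (fun _ => a) V = fun _ => a := rfl

theorem moment_eq_ncSum_freeCumulant {A : Type*} [Ring A] [Algebra ℂ A] (ψ : A →ₗ[ℂ] ℂ)
    (h1 : ψ 1 = 1) (a : A) (n : ℕ) :
    ψ (a ^ n) = ncSum (fun k => freeCumulant ψ k fun _ => a)
      (fun k => freeCumulant ψ k fun _ => a) (Finset.range n) := by
  rcases Nat.eq_zero_or_pos n with rfl | hn
  · simp [h1, ncSum_empty]
  have h := moment_eq_sum_freeCumulant ψ hn.ne' (fun _ : Fin n => a)
  rw [List.ofFn_const, List.prod_replicate] at h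
  rw [h, ← sum_NC_eq_ncSum]
  simp only [restrictTuple_const, ite_self]

theorem moment_eq_ncSum_twoStateCumulant {A : Type*} [Ring A] [Algebra ℂ A] (φ ψ : A →ₗ[ℂ] ℂ)
    (h1 : φ 1 = 1) (a : A) (n : ℕ) :
    φ (a ^ n) = ncSum (fun k => twoStateCumulant φ ψ k fun _ => a)
      (fun k => freeCumulant ψ k fun _ => a) (Finset.range n) := by
  rcases Nat.eq_zero_or_pos n with rfl | hn
  · simp [h1, ncSum_empty]
  have h := moment_eq_sum_twoStateCumulant φ ψ hn.ne' (fun _ : Fin n => a)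
  rw [List.ofFn_const, List.prod_replicate] at h
  rw [h, ← sum_NC_eq_ncSum]
  simp only [restrictTuple_const]

theorem moment_succ_of_freeCumulant_eq_zero {A : Type*} [Ring A] [Algebra ℂ A]
    (ψ : A →ₗ[ℂ] ℂ) (h1 : ψ 1 = 1) (a : A)
    (h : ∀ k, 2 < k → freeCumulant ψ k (fun _ => a) = 0) (n : ℕ) :
    ψ (a ^ (n + 1)) = freeCumulant ψ 1 (fun _ => a) * ψ (a ^ n) +
      freeCumulant ψ 2 (fun _ => a) * ∑ j ∈ Finset.range n, ψ (a ^ j) * ψ (a ^ (n - 1 - j)) := by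
  simp only [moment_eq_ncSum_freeCumulant ψ h1]
  exact ncSum_range_succ _ _ h n

theorem moment_succ_of_twoStateCumulant_eq_zero {A : Type*} [Ring A] [Algebra ℂ A]
    (φ ψ : A →ₗ[ℂ] ℂ) (hφ : φ 1 = 1) (hψ : ψ 1 = 1) (a : A)
    (h : ∀ k, 2 < k → twoStateCumulant φ ψ k (fun _ => a) = 0) (n : ℕ) :
    φ (a ^ (n + 1)) = φ a * φ (a ^ n) + (φ (a ^ 2) - φ a ^ 2) *
      ∑ j ∈ Finset.range n, ψ (a ^ j) * φ (a ^ (n - 1 - j)) := by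
  have key : ∀ n, φ (a ^ (n + 1)) = twoStateCumulant φ ψ 1 (fun _ => a) * φ (a ^ n) +
      twoStateCumulant φ ψ 2 (fun _ => a) *
        ∑ j ∈ Finset.range n, ψ (a ^ j) * φ (a ^ (n - 1 - j)) := by
    intro n
    simp only [moment_eq_ncSum_twoStateCumulant φ ψ hφ, moment_eq_ncSum_freeCumulant ψ hψ]
    exact ncSum_range_succ _ _ h n
  -- The recursion at 0 and 1 identifies the first two cumulants as the mean and the variance.
  have k0 := key 0
  have k1 := key 1
  simp [hφ, hψ] at k0 k1
  rw [key, k0, k1, ← k0]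
  ring

/-! ### The moments of semicircular functionals -/

/-- The numbers `L(xᵏ bₙ)`, where `b` are the monic orthogonal polynomials of the semicircular
functional `L` with mean `a` and variance `t`. -/
noncomputable def semicircleArray (a t : ℂ) : ℕ → ℕ → ℂ
  | 0, n => if n = 0 then 1 else 0
  | k + 1, 0 => semicircleArray a t k 1 + a * semicircleArray a t k 0
  | k + 1, n + 1 => semicircleArray a t k (n + 2) + a * semicircleArray a t k (n + 1) +
      t * semicircleArray a t k n

/-- The recurrence and the initial row determine the array. This is the common test by which
sequences of different origin are recognised as semicircular moments. -/
theorem eq_semicircleArray {a t : ℂ} {c : ℕ → ℕ → ℂ} (h0 : ∀ n, c 0 n = if n = 0 then 1 else 0)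
    (h1 : ∀ k, c (k + 1) 0 = c k 1 + a * c k 0)
    (h2 : ∀ k n, c (k + 1) (n + 1) = c k (n + 2) + a * c k (n + 1) + t * c k n) (k n : ℕ) :
    c k n = semicircleArray a t k n := by
  induction k generalizing n with
  | zero => rw [h0, semicircleArray]
  | succ k ih =>
    cases n with
    | zero => rw [h1, semicircleArray, ih, ih]
    | succ n => rw [h2, semicircleArray, ih, ih, ih]

open PowerSeries in
-- Two sequences are allowed so that one identity serves both functionals: `m = M` for `ψ`, and `a =
-- 0` with distinct sequences for `φ`.
theorem powerSeries_quadratic {a t : ℂ} {m M : ℕ → ℂ} (h0 : M 0 = 1) (h1 : M 1 = a)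
    (h : ∀ n, M (n + 2) = a * M (n + 1) +
      t * ∑ j ∈ Finset.range (n + 1), m j * M (n - j)) :
    PowerSeries.mk M =
      1 + C a * X * PowerSeries.mk M + C t * X ^ 2 * (PowerSeries.mk m * PowerSeries.mk M) := by
  ext n
  rw [mul_assoc (C a), mul_assoc (C t), map_add, map_add, coeff_C_mul, coeff_C_mul, coeff_mk]
  rcases n with _ | _ | n
  · simp [h0, coeff_X_pow_mul']
  · rw [coeff_succ_X_mul, coeff_X_pow_mul', if_neg (by omega)]
    simp [h0, h1, coeff_one]
  · rw [coeff_succ_X_mul, add_assoc n 1 1, one_add_one_eq_two, coeff_X_pow_mul, coeff_mul, coeff_mk, h,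
      Finset.Nat.sum_antidiagonal_eq_sum_range_succ_mk]
    simp [coeff_one]

open PowerSeries in
-- With M = 1 + aXM + tX²M², the series tⁿXⁿMⁿ⁺¹ generates the pairings of powers with the n-th
-- orthogonal polynomial: multiplying the quadratic equation by tⁿXⁿMⁿ gives the three-term
-- recurrence in n.
theorem eq_semicircleArray_of_recursion {a t : ℂ} {m : ℕ → ℂ} (h0 : m 0 = 1)
    (h : ∀ n, m (n + 1) = a * m n + t * ∑ j ∈ Finset.range n, m j * m (n - 1 - j)) (k : ℕ) :
    m k = semicircleArray a t k 0 := by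
  have hq := powerSeries_quadratic (m := m) h0 (by simpa [h0] using h 0)
    (fun n => by simpa using h (n + 1))
  set M := PowerSeries.mk m with hM
  have key := eq_semicircleArray (a := a) (t := t)
    (c := fun k n => coeff k (C (t ^ n) * (X ^ n * M ^ (n + 1)))) ?_ ?_ ?_ k 0
  · simpa [hM] using key
  · intro n
    rw [coeff_C_mul, coeff_X_pow_mul']
    rcases Nat.eq_zero_or_pos n with rfl | hn
    · simp [hM, h0]
    · simp [hn.ne']
  · intro k
    have e : C (t ^ 0) * (X ^ 0 * M ^ (0 + 1)) =
        1 + X * (C (t ^ 1) * (X ^ 1 * M ^ (1 + 1)) + C a * (C (t ^ 0) * (X ^ 0 * M ^ (0 + 1)))) := by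
      simp only [pow_zero, map_one, one_mul, zero_add, pow_one]
      linear_combination hq
    have e2 := congrArg (coeff (k + 1)) e
    rw [map_add (coeff (k + 1)), coeff_succ_X_mul, map_add, coeff_C_mul (n := k) (a := a)] at e2
    simpa [coeff_one] using e2
  · intro k n
    have e : C (t ^ (n + 1)) * (X ^ (n + 1) * M ^ (n + 1 + 1)) =
        X * (C (t ^ (n + 2)) * (X ^ (n + 2) * M ^ (n + 2 + 1)) +
          C a * (C (t ^ (n + 1)) * (X ^ (n + 1) * M ^ (n + 1 + 1))) +
          C t * (C (t ^ n) * (X ^ n * M ^ (n + 1)))) := by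
      simp only [map_pow]
      linear_combination C t ^ (n + 1) * X ^ (n + 1) * M ^ (n + 1) * hq
    have e2 := congrArg (coeff (k + 1)) e
    rwa [coeff_succ_X_mul, map_add, map_add, coeff_C_mul (n := k) (a := a),
      coeff_C_mul (n := k) (a := t)] at e2

/-- The solution of the moment recursion of the semicircular functionals. -/
noncomputable def semicircleMoment (a t : ℂ) : ℕ → ℂ
  | 0 => 1
  | n + 1 => a * semicircleMoment a t n +
      t * ∑ j : Fin n, semicircleMoment a t j * semicircleMoment a t (n - 1 - j)

/-- The recursion has a solution, built by `semicircleMoment`; the preceding lemma identifies that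
solution with column zero, which therefore inherits the recursion. -/
theorem semicircleArray_zero_recursion (a t : ℂ) (n : ℕ) :
    semicircleArray a t (n + 1) 0 = a * semicircleArray a t n 0 +
      t * ∑ j ∈ Finset.range n, semicircleArray a t j 0 * semicircleArray a t (n - 1 - j) 0 := by
  have h : ∀ n, semicircleMoment a t (n + 1) = a * semicircleMoment a t n +
      t * ∑ j ∈ Finset.range n, semicircleMoment a t j * semicircleMoment a t (n - 1 - j) := by
    intro n
    rw [semicircleMoment, Finset.sum_range
      (fun j => semicircleMoment a t j * semicircleMoment a t (n - 1 - j))]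
  have h' := eq_semicircleArray_of_recursion (by rw [semicircleMoment]) h
  simp only [← h']
  exact h n

open PowerSeries in
/-- The moments of the Jacobi shift of a semicircular functional with mean `α t` and
variance `t`. -/
theorem jacobiShift_moment {α t : ℂ} {M : ℕ → ℂ} (h0 : M 0 = 1) (h1 : M 1 = 0)
    (h : ∀ n, M (n + 2) = t * ∑ j ∈ Finset.range (n + 1),
      semicircleArray (α * t) t j 0 * M (n - j)) (n : ℕ) :
    M n + α * M (n + 1) = semicircleArray (α * t) t n 0 := by
  set m : ℕ → ℂ := fun k => semicircleArray (α * t) t k 0 with hm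
  have hrec := semicircleArray_zero_recursion (α * t) t
  have hm0 : m 0 = 1 := by simp [hm, semicircleArray]
  have q1 := powerSeries_quadratic (a := α * t) (t := t) (m := m) (M := m) hm0
    (by simp [hm, semicircleArray]) (fun n => by simpa using hrec (n + 1))
  have q2 := powerSeries_quadratic (a := 0) (t := t) (m := m) (M := M) h0 h1
    (fun n => by rw [h n]; simp [hm])
  set P := PowerSeries.mk m with hP
  set Q := PowerSeries.mk M with hQ
  -- Combining the two quadratic equations cancels every product of `P` and `Q`. The linear relation
  -- left over is the generating-function form of (1 + αx) dμ = dν.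
  have key : X * P + C α = (X + C α) * Q := by
    simp only [map_mul, map_zero] at q1 q2
    linear_combination (-C α - X * P) * q2 + X * Q * q1
  have e := congrArg (coeff (n + 1)) key
  rw [add_mul, map_add, map_add, coeff_succ_X_mul, coeff_succ_X_mul, coeff_C_mul] at e
  simp [hP, hQ] at e
  exact e.symm

/-! ### Weak limits in von Neumann algebras -/

section WeakLimit

open Filter Topology

variable {H : Type*} [NormedAddCommGroup H] [InnerProductSpace ℂ H] [CompleteSpace H]

/-- Weak compactness of balls: each matrix coefficient stays in a compact disc and so converges
along the ultrafilter. The limits form a bounded sesquilinear form, which is represented by an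
operator. -/
theorem exists_weak_limit (U : Ultrafilter ℕ) (c : ℕ → H →L[ℂ] H) {C : ℝ}
    (hC : ∀ N, ‖c N‖ ≤ C) :
    ∃ S : H →L[ℂ] H, ∀ v w, Tendsto (fun N => ⟪c N v, w⟫_ℂ) U (𝓝 ⟪S v, w⟫_ℂ) := by
  have hbd : ∀ v w N, ‖⟪c N v, w⟫_ℂ‖ ≤ C * ‖v‖ * ‖w‖ := fun v w N =>
    (norm_inner_le_norm _ _).trans (mul_le_mul_of_nonneg_right
      (((c N).le_opNorm v).trans (mul_le_mul_of_nonneg_right (hC N) (norm_nonneg _)))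
      (norm_nonneg _))
  have hlim : ∀ v w, ∃ z ∈ Metric.closedBall (0 : ℂ) (C * ‖v‖ * ‖w‖),
      Tendsto (fun N => ⟪c N v, w⟫_ℂ) U (𝓝 z) := by
    intro v w
    have h := (isCompact_closedBall (0 : ℂ) (C * ‖v‖ * ‖w‖)).ultrafilter_le_nhds'
      (U.map fun N => ⟪c N v, w⟫_ℂ)
      (Filter.mem_map.mpr (Filter.Eventually.of_forall fun N => by simpa using hbd v w N))
    exact h
  choose b hb hlim using hlim
  have e1 : ∀ m₁ m₂ n, b (m₁ + m₂) n = b m₁ n + b m₂ n := fun m₁ m₂ n =>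
    tendsto_nhds_unique (hlim _ _) (by
      simpa only [map_add, inner_add_left] using (hlim m₁ n).add (hlim m₂ n))
  have e2 : ∀ (r : ℂ) m n, b (r • m) n = (starRingEnd ℂ) r • b m n := fun r m n =>
    tendsto_nhds_unique (hlim _ _) (by
      simpa only [map_smul, inner_smul_left, smul_eq_mul] using (hlim m n).const_mul _)
  have e3 : ∀ m n₁ n₂, b m (n₁ + n₂) = b m n₁ + b m n₂ := fun m n₁ n₂ =>
    tendsto_nhds_unique (hlim _ _) (by
      simpa only [inner_add_right] using (hlim m n₁).add (hlim m n₂))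
  have e4 : ∀ (r : ℂ) m n, b m (r • n) = (RingHom.id ℂ) r • b m n := fun r m n =>
    tendsto_nhds_unique (hlim _ _) (by
      simpa only [inner_smul_right, smul_eq_mul, RingHom.id_apply] using (hlim m n).const_mul _)
  set f := LinearMap.mk₂'ₛₗ (starRingEnd ℂ) (RingHom.id ℂ) b e1 e2 e3 e4 with hf
  refine ⟨InnerProductSpace.continuousLinearMapOfBilin (f.mkContinuous₂ C fun v w => ?_),
    fun v w => ?_⟩
  · simpa [hf] using hb v w
  · rw [InnerProductSpace.continuousLinearMapOfBilin_apply]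
    exact hlim v w

theorem VonNeumannAlgebra.mem_of_commute (M : VonNeumannAlgebra H) {S : H →L[ℂ] H}
    (h : ∀ y ∈ M.commutant, Commute S y) : S ∈ M := by
  rw [← M.commutant_commutant, VonNeumannAlgebra.mem_commutant_iff]
  exact fun y hy => (h y hy).eq.symm

theorem VonNeumannAlgebra.commute_of_mem {M : VonNeumannAlgebra H} {S y : H →L[ℂ] H}
    (hS : S ∈ M) (hy : y ∈ M.commutant) : Commute S y :=
  VonNeumannAlgebra.mem_commutant_iff.mp hy S hS

theorem VonNeumannAlgebra.weak_limit_mem (M : VonNeumannAlgebra H) {U : Ultrafilter ℕ}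
    {c : ℕ → H →L[ℂ] H} (hc : ∀ N, c N ∈ M) {S : H →L[ℂ] H}
    (hS : ∀ v w, Tendsto (fun N => ⟪c N v, w⟫_ℂ) U (𝓝 ⟪S v, w⟫_ℂ)) : S ∈ M := by
  refine M.mem_of_commute fun y hy => ?_
  refine ContinuousLinearMap.ext fun v => ext_inner_right ℂ fun w => ?_
  refine tendsto_nhds_unique (hS (y v) w) ?_
  have h := hS v (ContinuousLinearMap.adjoint y w)
  simp only [ContinuousLinearMap.adjoint_inner_right] at h
  refine h.congr fun N => ?_
  rw [← mul_apply_eq_comp, ← (commute_of_mem (hc N) hy).eq]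
  rfl

/-- The square root commutes with whatever commutes with `S`, so it lies in the bicommutant. It puts
positive elements in the form `star Q * Q` on which faithfulness is stated. -/
theorem VonNeumannAlgebra.exists_sqrt (M : VonNeumannAlgebra H) {S : H →L[ℂ] H}
    (hS : S ∈ M) (h0 : 0 ≤ S) : ∃ Q ∈ M, star Q * Q = S := by
  refine ⟨CFC.sqrt S, M.mem_of_commute fun y hy => ?_, ?_⟩
  · exact (commute_of_mem hS hy).cfcₙ_nnreal _
  · rw [(CFC.sqrt_nonneg S).isSelfAdjoint.star_eq, CFC.sqrt_mul_sqrt_self S h0]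

end WeakLimit

section Normal

open Filter Topology

variable {A : Type*} [Ring A] [StarRing A] [Algebra ℂ A]
  {H : Type*} [NormedAddCommGroup H] [InnerProductSpace ℂ H] [CompleteSpace H]

/-- Normal functionals are continuous along bounded weakly convergent sequences. -/
theorem IsNormalFunctional.tendsto {M : VonNeumannAlgebra H} {e : A ≃⋆ₐ[ℂ] M.toStarSubalgebra}
    {χ : A →ₗ[ℂ] ℂ} (hχ : IsNormalFunctional M e χ) {U : Filter ℕ} {c : ℕ → A} {C : ℝ}
    (hC : ∀ N, ‖(e (c N) : H →L[ℂ] H)‖ ≤ C) {d : A}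
    (hd : ∀ v w, Tendsto (fun N => ⟪(e (c N) : H →L[ℂ] H) v, w⟫_ℂ) U
      (𝓝 ⟪(e d : H →L[ℂ] H) v, w⟫_ℂ)) :
    Tendsto (fun N => χ (c N)) U (𝓝 (χ d)) := by
  obtain ⟨ξ, η, hξ, hη, h⟩ := hχ
  simp only [← (h _).tsum_eq]
  refine tendsto_tsum_of_dominated_convergence
    (bound := fun n => C * (‖ξ n‖ ^ 2 + ‖η n‖ ^ 2)) ((hξ.add hη).mul_left C) (fun n => ?_)
    (Eventually.of_forall fun N n => ?_)
  · have h1 := (Complex.continuous_conj.tendsto _).comp (hd (η n) (ξ n))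
    simpa only [Function.comp_def, inner_conj_symm] using h1
  · refine (norm_inner_le_norm _ _).trans ?_
    have h1 : ‖(e (c N) : H →L[ℂ] H) (η n)‖ ≤ C * ‖η n‖ :=
      ((e (c N) : H →L[ℂ] H).le_opNorm _).trans
        (mul_le_mul_of_nonneg_right (hC N) (norm_nonneg _))
    have hC0 : 0 ≤ C := (norm_nonneg _).trans (hC N)
    have h2 := mul_le_mul_of_nonneg_left h1 (norm_nonneg (ξ n))
    nlinarith [mul_nonneg hC0 (sq_nonneg (‖ξ n‖ - ‖η n‖)),
      mul_nonneg hC0 (add_nonneg (sq_nonneg ‖ξ n‖) (sq_nonneg ‖η n‖))]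

/-- For a faithful normal positive functional `φ` and a normal functional `ψ`, convergence to
zero in `φ` of a bounded sequence of positive elements implies convergence to zero in `ψ`. -/
theorem IsNormalFunctional.tendsto_zero_of_faithful {M : VonNeumannAlgebra H}
    {e : A ≃⋆ₐ[ℂ] M.toStarSubalgebra} {φ ψ : A →ₗ[ℂ] ℂ}
    (hφ : IsNormalFunctional M e φ) (hψ : IsNormalFunctional M e ψ)
    (hf : ∀ a : A, φ (star a * a) = 0 → a = 0) (U : Ultrafilter ℕ) {c : ℕ → A} {C : ℝ}
    (hC : ∀ N, ‖(e (c N) : H →L[ℂ] H)‖ ≤ C) (hc : ∀ N, 0 ≤ (e (c N) : H →L[ℂ] H))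
    (h0 : Tendsto (fun N => φ (c N)) U (𝓝 0)) : Tendsto (fun N => ψ (c N)) U (𝓝 0) := by
  obtain ⟨S, hS⟩ := exists_weak_limit U (fun N => (e (c N) : H →L[ℂ] H)) hC
  have hSM : S ∈ M := M.weak_limit_mem (fun N => (e (c N)).2) hS
  have hS0 : 0 ≤ S := by
    rw [ContinuousLinearMap.nonneg_iff_isPositive, ContinuousLinearMap.isPositive_iff_complex]
    intro v
    have hpos : 0 ≤ ⟪S v, v⟫_ℂ := by
      refine ge_of_tendsto (hS v v) (Eventually.of_forall fun N => ?_)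
      have := (ContinuousLinearMap.isPositive_iff_complex _).mp
        ((ContinuousLinearMap.nonneg_iff_isPositive _).mp (hc N)) v
      rw [← this.1]
      exact_mod_cast this.2
    obtain ⟨x, hx, hxe⟩ := RCLike.nonneg_iff_exists_ofReal.mp hpos
    rw [← hxe]
    simpa using hx
  obtain ⟨Q, hQM, hQ⟩ := M.exists_sqrt hSM hS0
  obtain ⟨q, hq⟩ := e.surjective ⟨Q, hQM⟩
  have hqS : (e (star q * q) : H →L[ℂ] H) = S := by
    have hq' : e q = ⟨Q, hQM⟩ := hq
    rw [map_mul, map_star, hq', ← hQ]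
    rfl
  have hlim : ∀ v w, Tendsto (fun N => ⟪(e (c N) : H →L[ℂ] H) v, w⟫_ℂ) U
      (𝓝 ⟪(e (star q * q) : H →L[ℂ] H) v, w⟫_ℂ) := by
    rw [hqS]
    exact hS
  -- Normality lets `φ` pass to the weak limit, and faithfulness then forces that limit to vanish.
  have hq0 : q = 0 := hf q (tendsto_nhds_unique (hφ.tendsto hC hlim) h0)
  have h := hψ.tendsto hC hlim
  simpa [hq0] using h

/-- The resolvent `(1 + a²)⁻¹` of a self-adjoint element. -/
theorem exists_resolvent {M : VonNeumannAlgebra H} (e : A ≃⋆ₐ[ℂ] M.toStarSubalgebra) {a : A}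
    (ha : IsSelfAdjoint a) :
    ∃ r : A, r * (1 + a * a) = 1 ∧ (1 + a * a) * r = 1 ∧ IsSelfAdjoint r ∧
      ‖(e r : H →L[ℂ] H)‖ ≤ 1 := by
  set W : H →L[ℂ] H := (e a).1 with hW
  have hWsa : IsSelfAdjoint W := by
    have : star (e a) = e a := by rw [← map_star, ha.star_eq]
    exact congrArg Subtype.val this
  -- The operator 1 + W² does not shrink vectors, so its inverse is a contraction.
  have hnorm : ∀ v, ‖v‖ ≤ ‖(1 + W * W) v‖ := by
    intro v
    have h1 : ⟪v, W (W v)⟫_ℂ = ((‖W v‖ ^ 2 : ℝ) : ℂ) := by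
      rw [← ContinuousLinearMap.adjoint_inner_left, ← ContinuousLinearMap.star_eq_adjoint,
        hWsa.star_eq, inner_self_eq_norm_sq_to_K]
      norm_cast
    have h2 : ‖(1 + W * W) v‖ ^ 2 = ‖v‖ ^ 2 + 2 * ‖W v‖ ^ 2 + ‖W (W v)‖ ^ 2 := by
      have := @norm_add_sq ℂ _ _ _ _ v (W (W v))
      rw [h1, RCLike.re_eq_complex_re, Complex.ofReal_re] at this
      exact this
    refine le_of_sq_le_sq ?_ (norm_nonneg _)
    nlinarith [sq_nonneg ‖W v‖, sq_nonneg ‖W (W v)‖]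
  -- Factor 1 + W² as (i - W)(-i - W); a self-adjoint operator has real spectrum, so both factors
  -- are invertible.
  have hunit : IsUnit (1 + W * W) := by
    have h1 : IsUnit (algebraMap ℂ (H →L[ℂ] H) Complex.I - W) := by
      by_contra h
      have := hWsa.im_eq_zero_of_mem_spectrum (spectrum.mem_iff.mpr h)
      simp at this
    have h2 : IsUnit (algebraMap ℂ (H →L[ℂ] H) (-Complex.I) - W) := by
      by_contra h
      have := hWsa.im_eq_zero_of_mem_spectrum (spectrum.mem_iff.mpr h)
      simp at this
    have h3 : (1 + W * W) = (algebraMap ℂ (H →L[ℂ] H) Complex.I - W) *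
        (algebraMap ℂ (H →L[ℂ] H) (-Complex.I) - W) := by
      rw [sub_mul, mul_sub, mul_sub, ← map_mul, map_neg, Algebra.commutes Complex.I W]
      simp
      abel
    rw [h3]
    exact h1.mul h2
  obtain ⟨u, hu⟩ := hunit
  have huM : (↑u⁻¹ : H →L[ℂ] H) ∈ M := by
    refine M.mem_of_commute fun y hy => ?_
    have hWy : Commute W y := VonNeumannAlgebra.commute_of_mem (e a).2 hy
    have huy : Commute (u : H →L[ℂ] H) y := by
      rw [hu]
      exact (Commute.one_left y).add_left (hWy.mul_left hWy)
    exact huy.units_inv_left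
  obtain ⟨r, hr⟩ : ∃ r, e r = ⟨_, huM⟩ := e.surjective ⟨_, huM⟩
  have hrv : (e r : H →L[ℂ] H) = ↑u⁻¹ := by rw [hr]
  have hl : r * (1 + a * a) = 1 := by
    apply e.injective
    apply Subtype.ext
    rw [map_mul, map_add, map_one, map_mul]
    change (e r : H →L[ℂ] H) * (1 + W * W) = 1
    rw [hrv, ← hu, u.inv_mul]
  have hrr : (1 + a * a) * r = 1 := by
    apply e.injective
    apply Subtype.ext
    rw [map_mul, map_add, map_one, map_mul]
    change (1 + W * W) * (e r : H →L[ℂ] H) = 1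
    rw [hrv, ← hu, u.mul_inv]
  refine ⟨r, hl, hrr, ?_, ?_⟩
  · have h1 : star r * (1 + a * a) = 1 := by
      have := congrArg star hrr
      simpa [ha.star_eq] using this
    calc star r = star r * ((1 + a * a) * r) := by rw [hrr, mul_one]
      _ = r := by rw [← mul_assoc, h1, one_mul]
  · refine ContinuousLinearMap.opNorm_le_bound _ zero_le_one fun v => ?_
    rw [one_mul]
    refine (hnorm _).trans (le_of_eq ?_)
    rw [← mul_apply_eq_comp, hrv, ← hu, u.mul_inv, one_apply_eq_self]

end Normal

/-! ### From convergence in L²(φ) to convergence of ψ-means. -/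

section Truncation

open Filter Topology

variable {A : Type*} [Ring A] [StarRing A] [Algebra ℂ A] [StarModule ℂ A]

/-- If `aₙ → 0` in `L²(φ)` and `aₙ` is bounded in `L²(ψ)`, then `ψ(aₙ) → 0`. -/
theorem IsFaithfulWStarSpace.eq_zero_of_tendsto {φ ψ : A →ₗ[ℂ] ℂ}
    (hA : IsFaithfulWStarSpace φ ψ) (hφ : IsPositiveUnital φ) (hψ : IsPositiveUnital ψ)
    {a : ℕ → A} (ha : ∀ N, IsSelfAdjoint (a N))
    (h1 : Tendsto (fun N => φ (a N * a N)) atTop (𝓝 0)) {K : ℝ}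
    (hK : ∀ N, ‖ψ (a N * a N)‖ ≤ K) {l : ℂ} (hl : Tendsto (fun N => ψ (a N)) atTop (𝓝 l)) :
    l = 0 := by
  obtain ⟨⟨H, _, _, _, M, e, hφn, hψn⟩, hf⟩ := hA
  choose r hr1 hr2 hrs hrn using fun N => exists_resolvent e (ha N)
  have hcomm : ∀ N, r N * a N = a N * r N := by
    intro N
    have : Commute (1 + a N * a N) (a N) := (Commute.one_left _).add_left
      ((Commute.refl _).mul_left (Commute.refl _))
    calc r N * a N = r N * (a N * ((1 + a N * a N) * r N)) := by rw [hr2, mul_one]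
      _ = r N * ((a N * (1 + a N * a N)) * r N) := by rw [mul_assoc (a N)]
      _ = r N * (((1 + a N * a N) * a N) * r N) := by rw [this.eq]
      _ = (r N * (1 + a N * a N)) * (a N * r N) := by simp only [mul_assoc]
      _ = a N * r N := by rw [hr1, one_mul]
  -- This is a²(1 + a²)⁻¹, a bounded positive substitute for a² that lies below it under `φ`.
  set c : ℕ → A := fun N => 1 - r N with hc
  have hca : ∀ N, r N * (a N * a N) = c N := fun N => by
    rw [hc, eq_sub_iff_add_eq, ← hr1 N, mul_add, mul_one, add_comm]
  have hac : ∀ N, a N * a N * r N = c N := fun N => by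
    rw [hc, eq_sub_iff_add_eq, ← hr2 N, add_mul, one_mul, add_comm]
  have hcara : ∀ N, a N * (r N * a N) = c N := fun N => by
    rw [hcomm, ← mul_assoc, hac]
  have haa : ∀ N, IsSelfAdjoint (a N * a N) := fun N => by
    rw [IsSelfAdjoint, star_mul, (ha N).star_eq]
  -- Writing r = r(1 + a²)r exhibits y r y as a sum of two squares, so positivity of a functional
  -- applies to it without a square root of r.
  have sos : ∀ N (y : A), IsSelfAdjoint y → y * (r N * y) = star (r N * y) * (r N * y) +
      star (a N * (r N * y)) * (a N * (r N * y)) := by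
    intro N y hy
    simp only [star_mul, hy.star_eq, (hrs N).star_eq, (ha N).star_eq]
    calc y * (r N * y) = y * (r N * ((1 + a N * a N) * r N) * y) := by rw [hr2, mul_one]
      _ = _ := by noncomm_ring
  have pos : ∀ (χ : A →ₗ[ℂ] ℂ), IsPositiveUnital χ → ∀ N (y : A), IsSelfAdjoint y →
      0 ≤ χ (y * (r N * y)) := by
    intro χ hχ N y hy
    rw [sos N y hy, map_add]
    exact add_nonneg (hχ.nonneg _) (hχ.nonneg _)
  have hc0 : ∀ N, 0 ≤ (e (c N) : H →L[ℂ] H) := by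
    intro N
    have h : ∀ x : A, 0 ≤ (e (star x * x) : H →L[ℂ] H) := fun x => by
      rw [map_mul, map_star]
      exact star_mul_self_nonneg (e x : H →L[ℂ] H)
    rw [← hcara, sos N _ (ha N), map_add]
    exact add_nonneg (h _) (h _)
  have hcn : ∀ N, ‖(e (c N) : H →L[ℂ] H)‖ ≤ 1 + 1 := by
    intro N
    rw [hc, map_sub, map_one]
    refine (norm_sub_le _ _).trans (add_le_add ContinuousLinearMap.norm_id_le (hrn N))
  have hcφ : ∀ (χ : A →ₗ[ℂ] ℂ), IsPositiveUnital χ → ∀ N, 0 ≤ χ (c N) := fun χ hχ N => by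
    rw [← hcara]
    exact pos χ hχ N _ (ha N)
  have hcle : ∀ N, φ (c N) ≤ φ (a N * a N) := by
    intro N
    have h := pos φ hφ N (a N * a N) (haa N)
    rw [hca, hc, mul_sub, mul_one, hac, map_sub] at h
    exact sub_nonneg.mp h
  have hφc : Tendsto (fun N => φ (c N)) atTop (𝓝 0) :=
    squeeze_zero_norm (fun N => CStarAlgebra.norm_le_norm_of_nonneg_of_le (hcφ φ hφ N) (hcle N))
      (tendsto_zero_iff_norm_tendsto_zero.mp h1)
  -- A free ultrafilter is enough: the limit `l` exists along the whole sequence and can be computed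
  -- along `U`.
  set U := hyperfilter ℕ with hU
  have hUle : (U : Filter ℕ) ≤ atTop := Nat.hyperfilter_le_atTop
  have hψc := hφn.tendsto_zero_of_faithful hψn hf U hcn hc0 (hφc.mono_left hUle)
  -- Take y = η(1 + a²) - a, for which y r y = η²(1 + a²) - 2ηa + c. Nonnegativity for all real η is
  -- Cauchy–Schwarz in the form ψ(a)² ≤ ψ(c)(1 + ψ(a²)).
  have key : ∀ N (η : ℝ), 0 ≤ (η : ℂ) ^ 2 * (1 + ψ (a N * a N)) - 2 * η * ψ (a N) + ψ (c N) := by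
    intro N η
    have hy : IsSelfAdjoint ((η : ℂ) • (1 + a N * a N) - a N) := by
      rw [IsSelfAdjoint, star_sub, star_smul, star_add, star_one, (haa N).star_eq, (ha N).star_eq]
      simp
    have h := pos ψ hψ N _ hy
    have e1 : r N * ((η : ℂ) • (1 + a N * a N) - a N) = (η : ℂ) • 1 - r N * a N := by
      rw [mul_sub, mul_smul_comm, hr1]
    have e2 : ((η : ℂ) • (1 + a N * a N) - a N) * ((η : ℂ) • 1 - r N * a N) =
        ((η : ℂ) ^ 2) • (1 + a N * a N) - (2 * η : ℂ) • a N + c N := by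
      have e3 : (1 + a N * a N) * (r N * a N) = a N := by rw [← mul_assoc, hr2, one_mul]
      rw [sub_mul, mul_sub, mul_sub, smul_mul_assoc _ _ (r N * a N), e3, hcara, mul_smul_comm,
        mul_one, mul_smul_comm, mul_one, smul_smul, two_mul, add_smul, pow_two]
      abel
    rw [e1, e2, map_add, map_sub, map_smul, map_smul, map_add, hψ.map_one] at h
    simpa only [smul_eq_mul] using h
  have hψr : ∀ N, (ψ (a N * a N)).re ≤ K := fun N => (Complex.re_le_norm _).trans (hK N)
  have him : ∀ N, (ψ (a N)).im = 0 := by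
    intro N
    have h2 : 0 ≤ ψ (a N * a N) := by
      have := hψ.nonneg (a N)
      rwa [(ha N).star_eq] at this
    have h := (Complex.le_def.mp (key N 1)).2
    have h3 := (Complex.le_def.mp (hcφ ψ hψ N)).2
    have h4 := (Complex.le_def.mp h2).2
    simp at h h3 h4
    rw [← h3, ← h4] at h
    linarith
  have hlU := hl.mono_left hUle
  have hineq : ∀ η : ℝ, 0 ≤ η ^ 2 * (1 + K) - 2 * η * l.re := by
    intro η
    have t1 : Tendsto (fun N => η ^ 2 * (1 + K) - 2 * η * (ψ (a N)).re + (ψ (c N)).re) U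
        (𝓝 (η ^ 2 * (1 + K) - 2 * η * l.re + (0 : ℂ).re)) :=
      ((((Complex.continuous_re.tendsto _).comp hlU).const_mul _).const_sub _).add
        ((Complex.continuous_re.tendsto _).comp hψc)
    rw [Complex.zero_re, add_zero] at t1
    refine ge_of_tendsto t1 (Eventually.of_forall fun N => ?_)
    have h := (Complex.le_def.mp (key N η)).1
    have e1 : ((η : ℂ) ^ 2 * (1 + ψ (a N * a N)) - 2 * η * ψ (a N) + ψ (c N)).re =
        η ^ 2 * (1 + (ψ (a N * a N)).re) - 2 * η * (ψ (a N)).re + (ψ (c N)).re := by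
      rw [← Complex.ofReal_pow, ← Complex.ofReal_ofNat, ← Complex.ofReal_mul, Complex.add_re,
        Complex.sub_re, Complex.re_ofReal_mul, Complex.re_ofReal_mul, Complex.add_re,
        Complex.one_re]
    rw [e1, Complex.zero_re] at h
    nlinarith [mul_nonneg (sq_nonneg η) (sub_nonneg.mpr (hψr N))]
  have hK0 : 0 ≤ K := (norm_nonneg _).trans (hK 0)
  have hre : l.re = 0 := by
    -- This η minimises the quadratic.
    have h := hineq (l.re / (1 + K))
    have hpos : 0 < 1 + K := by linarith
    have e1 : (l.re / (1 + K)) ^ 2 * (1 + K) - 2 * (l.re / (1 + K)) * l.re =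
        -(l.re ^ 2 / (1 + K)) := by
      field_simp
      ring
    rw [e1] at h
    have h2 : l.re ^ 2 / (1 + K) ≤ 0 := by linarith
    have h3 : l.re ^ 2 ≤ 0 := by
      by_contra! h4
      exact absurd h2 (div_pos h4 hpos).not_ge
    exact pow_eq_zero_iff two_ne_zero |>.mp (le_antisymm h3 (sq_nonneg _))
  have hime : l.im = 0 := by
    refine tendsto_nhds_unique ((Complex.continuous_im.tendsto _).comp hl) ?_
    simp only [Function.comp_def, him]
    exact tendsto_const_nhds
  exact Complex.ext hre hime

end Truncation

/-! ### Free Appell sequences and additivity of free cumulants -/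

section Appell

variable {A : Type*} [Ring A] [Algebra ℂ A]

/-- `b` is the sequence of free Appell elements of `y`, and `r n` is the free cumulant
of `y` of order `n + 1`: `y bₙ = bₙ₊₁ + ∑ rⱼ bₙ₋ⱼ`, `b₀ = 1`, and `ψ(bₙ) = 0` for `n ≥ 1`. -/
structure IsFreeAppell (ψ : A →ₗ[ℂ] ℂ) (y : A) (b : ℕ → A) (r : ℕ → ℂ) : Prop where
  zero : b 0 = 1
  succ : ∀ n, b (n + 1) = y * b n - ∑ j ∈ Finset.range (n + 1), r j • b (n - j)
  map : ∀ n, ψ (b n) = if n = 0 then 1 else 0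

open Polynomial in
/-- The free Appell polynomials of a functional on polynomials. -/
noncomputable def freeAppell (L : ℂ[X] →ₗ[ℂ] ℂ) : ℕ → ℂ[X]
  | 0 => 1
  | n + 1 => X * freeAppell L n - ∑ j : Fin (n + 1), L (X * freeAppell L j) • freeAppell L (n - j)

theorem freeAppell_succ (L : Polynomial ℂ →ₗ[ℂ] ℂ) (n : ℕ) :
    freeAppell L (n + 1) = Polynomial.X * freeAppell L n -
      ∑ j ∈ Finset.range (n + 1), L (Polynomial.X * freeAppell L j) • freeAppell L (n - j) := by
  rw [freeAppell, Finset.sum_range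
    (fun j => L (Polynomial.X * freeAppell L j) • freeAppell L (n - j))]

theorem sum_range_mul_ite (r : ℕ → ℂ) (n : ℕ) :
    ∑ j ∈ Finset.range (n + 1), r j * (if n - j = 0 then 1 else 0) = r n := by
  rw [Finset.sum_eq_single n]
  · simp
  · intro j hj hjn
    rw [Finset.mem_range] at hj
    rw [if_neg (by omega), mul_zero]
  · simp

/-- By induction every term subtracted from X bₙ vanishes under `L` except the one with b₀. Its
coefficient L(X bₙ) is just what centres the next polynomial. -/
theorem isFreeAppell_freeAppell {L : Polynomial ℂ →ₗ[ℂ] ℂ} (h1 : L 1 = 1) :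
    IsFreeAppell L Polynomial.X (freeAppell L) (fun n => L (Polynomial.X * freeAppell L n)) where
  zero := by rw [freeAppell]
  succ := freeAppell_succ L
  map n := by
    induction n using Nat.strong_induction_on with
    | _ n ih =>
      rcases n with _ | n
      · simp [freeAppell, h1]
      · rw [freeAppell_succ, map_sub, map_sum]
        have : ∀ j ∈ Finset.range (n + 1),
            L (L (Polynomial.X * freeAppell L j) • freeAppell L (n - j)) =
              L (Polynomial.X * freeAppell L j) * (if n - j = 0 then 1 else 0) := fun j _ => by
          rw [map_smul, smul_eq_mul, ih (n - j) (by omega)]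
        rw [Finset.sum_congr rfl this, sum_range_mul_ite]
        simp

/-- Elements with the same moments have the same free cumulants. -/
theorem exists_isFreeAppell {ψ : A →ₗ[ℂ] ℂ} (h1 : ψ 1 = 1) (y : A) :
    ∃ r : ℕ → ℂ, ∀ z : A, (∀ n, ψ (z ^ n) = ψ (y ^ n)) → ∃ b, IsFreeAppell ψ z b r := by
  set L : Polynomial ℂ →ₗ[ℂ] ℂ := ψ ∘ₗ (Polynomial.aeval y).toLinearMap with hL
  have h := isFreeAppell_freeAppell (L := L) (by simp [hL, h1])
  refine ⟨fun n => L (Polynomial.X * freeAppell L n), fun z hz =>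
    ⟨fun n => Polynomial.aeval z (freeAppell L n), ?_, fun n => ?_,
    fun n => ?_⟩⟩
  · simp [h.zero]
  · rw [h.succ, map_sub, map_mul, Polynomial.aeval_X, map_sum]
    simp only [map_smul]
  · rw [← h.map n]
    have : ψ ∘ₗ (Polynomial.aeval z).toLinearMap = L := by
      ext n
      simp [hL, hz]
    exact LinearMap.congr_fun this (freeAppell L n)

theorem IsFreeAppell.moment {ψ : A →ₗ[ℂ] ℂ} {y : A} {b : ℕ → A} {r : ℕ → ℂ}
    (h : IsFreeAppell ψ y b r) (n : ℕ) : ψ (y * b n) = r n := by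
  have e : y * b n = b (n + 1) + ∑ j ∈ Finset.range (n + 1), r j • b (n - j) := by
    rw [h.succ, sub_add_cancel]
  rw [e, map_add, map_sum, h.map]
  simp only [map_smul, smul_eq_mul, h.map]
  rw [sum_range_mul_ite]
  simp

/-- The n-th coefficient is recovered as ψ(y bₙ), and bₙ involves only earlier coefficients, so the
two sequences determine each other inductively. -/
theorem IsFreeAppell.unique {ψ : A →ₗ[ℂ] ℂ} {y : A} {b b' : ℕ → A} {r r' : ℕ → ℂ}
    (h : IsFreeAppell ψ y b r) (h' : IsFreeAppell ψ y b' r') (n : ℕ) : r n = r' n := by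
  have key : ∀ n, b n = b' n := by
    intro n
    induction n using Nat.strong_induction_on with
    | _ n ih =>
      rcases n with _ | n
      · rw [h.zero, h'.zero]
      · rw [h.succ, h'.succ, ih n (by omega)]
        congr 1
        refine Finset.sum_congr rfl fun j hj => ?_
        have hj' := Finset.mem_range.mp hj
        rw [ih (n - j) (by omega), ← h.moment, ← h'.moment, ih j hj']
  rw [← h.moment, ← h'.moment, key]

theorem IsFreeAppell.mem_adjoin {ψ : A →ₗ[ℂ] ℂ} {y : A} {b : ℕ → A} {r : ℕ → ℂ}
    (h : IsFreeAppell ψ y b r) (n : ℕ) : b n ∈ Algebra.adjoin ℂ {y} := by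
  induction n using Nat.strong_induction_on with
  | _ n ih =>
    rcases n with _ | n
    · rw [h.zero]
      exact one_mem _
    · rw [h.succ]
      refine sub_mem (mul_mem (Algebra.self_mem_adjoin_singleton ℂ y) (ih n (by omega)))
        (sum_mem fun j _ => Subalgebra.smul_mem _ (ih _ (by omega)) _)

theorem IsFreeAppell.commute {ψ : A →ₗ[ℂ] ℂ} {y : A} {b : ℕ → A} {r : ℕ → ℂ}
    (h : IsFreeAppell ψ y b r) (n : ℕ) : y * b n = b n * y :=
  (Algebra.commute_of_mem_adjoin_self (h.mem_adjoin n)).eq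

theorem isFreeAppell_zero {ψ : A →ₗ[ℂ] ℂ} (h1 : ψ 1 = 1) :
    IsFreeAppell ψ (0 : A) (fun n => if n = 0 then 1 else 0) (fun _ => 0) where
  zero := by simp
  succ n := by simp
  map n := by split_ifs <;> simp [h1]

end Appell

/-! ### Alternating centered words and Appell generating functions. -/

section Words

variable {A : Type*} [Ring A] [Algebra ℂ A]

/-- `x` is a product of `ψ`-centered elements of the subalgebras `S i`, neighbouring factors
lying in different subalgebras, and the last one in `S i`. -/
inductive CenteredWord (ψ : A →ₗ[ℂ] ℂ) {ι : Type*} (S : ι → Subalgebra ℂ A) : ι → A → Prop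
  | single {i : ι} {a : A} : a ∈ S i → ψ a = 0 → CenteredWord ψ S i a
  | snoc {i j : ι} {x a : A} : CenteredWord ψ S j x → j ≠ i → a ∈ S i → ψ a = 0 →
      CenteredWord ψ S i (x * a)

theorem CenteredWord.exists_ofFn {ψ : A →ₗ[ℂ] ℂ} {ι : Type*} {S : ι → Subalgebra ℂ A} {i : ι}
    {x : A} (h : CenteredWord ψ S i x) :
    ∃ (n : ℕ) (f : Fin (n + 1) → ι) (a : Fin (n + 1) → A), (∀ j, a j ∈ S (f j)) ∧
      (∀ j : Fin n, f j.castSucc ≠ f j.succ) ∧ (∀ j, ψ (a j) = 0) ∧ f (Fin.last n) = i ∧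
        (List.ofFn a).prod = x := by
  induction h with
  | @single i a ha h0 => exact ⟨0, fun _ => i, fun _ => a, fun _ => ha, fun j => j.elim0,
      fun _ => h0, rfl, by simp⟩
  | @snoc i j x a _ hij ha h0 ih =>
    obtain ⟨n, f, b, h1, h2, h3, h4, h5⟩ := ih
    refine ⟨n + 1, Fin.snoc f i, Fin.snoc b a, fun k => ?_, fun k => ?_, fun k => ?_, by simp, ?_⟩
    · refine Fin.lastCases ?_ (fun k => ?_) k
      · simpa using ha
      · simpa using h1 k
    · refine Fin.lastCases ?_ (fun k => ?_) k
      · rw [Fin.snoc_castSucc, Fin.succ_last, Fin.snoc_last, h4]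
        exact hij
      · rw [Fin.snoc_castSucc, Fin.succ_castSucc, Fin.snoc_castSucc]
        exact h2 k
    · refine Fin.lastCases ?_ (fun k => ?_) k
      · simpa using h0
      · simpa using h3 k
    · rw [List.ofFn_succ', List.concat_eq_append, List.prod_append, List.prod_singleton,
        Fin.snoc_last]
      simp only [Fin.snoc_castSucc]
      rw [h5]

theorem TwoStateFree.map_centeredWord {φ ψ : A →ₗ[ℂ] ℂ} {ι : Type*} {S : ι → Subalgebra ℂ A}
    (hS : TwoStateFree φ ψ S) {i : ι} {x : A} (h : CenteredWord ψ S i x) : ψ x = 0 := by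
  obtain ⟨n, f, a, h1, h2, h3, -, rfl⟩ := h.exists_ofFn
  exact (hS n f a h1 h2 h3).1

/-- Products of two elements of different two-state free subalgebras. -/
theorem TwoStateFree.map_mul {φ ψ : A →ₗ[ℂ] ℂ} (hφ : φ 1 = 1) (hψ : ψ 1 = 1) {ι : Type*}
    {S : ι → Subalgebra ℂ A} (hS : TwoStateFree φ ψ S) {i j : ι} (hij : i ≠ j) {a b : A}
    (ha : a ∈ S i) (hb : b ∈ S j) : ψ (a * b) = ψ a * ψ b ∧ φ (a * b) = φ a * φ b := by
  set a' := a - ψ a • 1 with ha'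
  set b' := b - ψ b • 1 with hb'
  have h := hS 1 ![i, j] ![a', b'] ?_ ?_ ?_
  · simp only [List.ofFn_succ, List.ofFn_zero, Fin.prod_univ_succ] at h
    simp at h
    have e : a' * b' = a * b - ψ b • a - ψ a • b + (ψ a * ψ b) • 1 := by
      simp only [ha', hb', sub_mul, mul_sub, smul_mul_assoc, mul_smul_comm, one_mul, mul_one,
        smul_sub, smul_smul, mul_comm (ψ b)]
      abel
    rw [e] at h
    simp [hφ, hψ, ha', hb'] at h
    exact ⟨by linear_combination h.1, by linear_combination h.2⟩
  · intro k
    fin_cases k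
    · exact sub_mem ha (Subalgebra.smul_mem _ (one_mem _) _)
    · exact sub_mem hb (Subalgebra.smul_mem _ (one_mem _) _)
  · intro k
    fin_cases k
    exact hij
  · intro k
    fin_cases k <;> simp [ha', hb', hψ]

open PowerSeries in
-- In the variable z the Appell series is the inverse of 1 + zR(z) - zy, where R is the R-transform;
-- together with ψ(bₙ) = 0 for n ≥ 1 this is the resolvent description of free cumulants.
theorem IsFreeAppell.powerSeries {ψ : A →ₗ[ℂ] ℂ} {y : A} {b : ℕ → A} {r : ℕ → ℂ}
    (h : IsFreeAppell ψ y b r) :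
    (1 + PowerSeries.X * PowerSeries.mk (fun n => algebraMap ℂ A (r n)) -
      PowerSeries.X * PowerSeries.C y) * PowerSeries.mk b = 1 := by
  ext n
  rcases n with _ | n
  · simp [h.zero]
  · rw [sub_mul, add_mul, one_mul, mul_assoc, mul_assoc, map_sub, map_add, coeff_succ_X_mul,
      coeff_succ_X_mul, coeff_C_mul, coeff_mk, coeff_mk, h.succ, coeff_mul,
      Finset.Nat.sum_antidiagonal_eq_sum_range_succ_mk]
    simp [Algebra.smul_def, coeff_one]

open PowerSeries in
-- The coefficients bₙ are polynomials in y, so the two series commute and the inverse is two-sided.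
theorem IsFreeAppell.powerSeries' {ψ : A →ₗ[ℂ] ℂ} {y : A} {b : ℕ → A} {r : ℕ → ℂ}
    (h : IsFreeAppell ψ y b r) :
    PowerSeries.mk b * (1 + PowerSeries.X * PowerSeries.mk (fun n => algebraMap ℂ A (r n)) -
      PowerSeries.X * PowerSeries.C y) = 1 := by
  refine Eq.trans ?_ h.powerSeries
  have hX : ∀ f : PowerSeries A, Commute PowerSeries.X f := fun f => (PowerSeries.commute_X f).symm
  have h1 : Commute (PowerSeries.mk b) (PowerSeries.mk fun n => algebraMap ℂ A (r n)) := by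
    ext n
    rw [coeff_mul, coeff_mul, ← Finset.Nat.sum_antidiagonal_swap]
    refine Finset.sum_congr rfl fun p _ => ?_
    simp only [coeff_mk, Prod.fst_swap, Prod.snd_swap]
    exact (Algebra.commutes _ _).symm
  have h2 : Commute (PowerSeries.mk b) (PowerSeries.C y) := by
    ext n
    rw [coeff_mul_C, coeff_C_mul, coeff_mk, h.commute]
  exact (((Commute.one_right _).add_right ((hX _).symm.mul_right h1)).sub_right
    ((hX _).symm.mul_right h2)).eq

end Words

/-! ### Additivity of free cumulants. -/

section Additivity

variable {A : Type*} [Ring A] [Algebra ℂ A]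

open PowerSeries in
theorem isFreeAppell_of_powerSeries {ψ : A →ₗ[ℂ] ℂ} {y : A} {F : PowerSeries A} {r : ℕ → ℂ}
    (h : (1 + PowerSeries.X * PowerSeries.mk (fun n => algebraMap ℂ A (r n)) -
      PowerSeries.X * PowerSeries.C y) * F = 1)
    (hψ : ∀ n, ψ (coeff n F) = if n = 0 then 1 else 0) :
    IsFreeAppell ψ y (fun n => coeff n F) r where
  zero := by
    have e := congrArg (coeff 0) h
    rw [sub_mul, add_mul, one_mul, mul_assoc, mul_assoc] at e
    simpa using e
  succ n := by
    have e := congrArg (coeff (n + 1)) h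
    rw [sub_mul, add_mul, one_mul, mul_assoc, mul_assoc, map_sub, map_add, coeff_succ_X_mul,
      coeff_succ_X_mul, coeff_C_mul, coeff_mul,
      Finset.Nat.sum_antidiagonal_eq_sum_range_succ_mk] at e
    simp only [coeff_mk, coeff_one, Nat.succ_ne_zero, if_false, ← Algebra.smul_def] at e
    rw [sub_eq_zero] at e
    exact eq_sub_of_add_eq e
  map := hψ

open PowerSeries in
/-- Free cumulants are additive for sums of free elements. -/
theorem IsFreeAppell.add {φ ψ : A →ₗ[ℂ] ℂ} {ι : Type*} {S : ι → Subalgebra ℂ A}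
    (hS : TwoStateFree φ ψ S) {i j : ι} (hij : i ≠ j) {y₁ y₂ : A} (hy₁ : y₁ ∈ S i)
    (hy₂ : y₂ ∈ S j) {b₁ b₂ : ℕ → A} {r₁ r₂ : ℕ → ℂ} (h₁ : IsFreeAppell ψ y₁ b₁ r₁)
    (h₂ : IsFreeAppell ψ y₂ b₂ r₂) :
    ∃ b, IsFreeAppell ψ (y₁ + y₂) b (fun n => r₁ n + r₂ n) := by
  have hb₁ : ∀ n, b₁ n ∈ S i := fun n =>
    Algebra.adjoin_le (Set.singleton_subset_iff.mpr hy₁) (h₁.mem_adjoin n)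
  have hb₂ : ∀ n, b₂ n ∈ S j := fun n =>
    Algebra.adjoin_le (Set.singleton_subset_iff.mpr hy₂) (h₂.mem_adjoin n)
  set β₁ := PowerSeries.mk b₁ with hβ₁
  set β₂ := PowerSeries.mk b₂ with hβ₂
  set κ₁ : PowerSeries A := 1 + PowerSeries.X * PowerSeries.mk (fun n => algebraMap ℂ A (r₁ n)) -
      PowerSeries.X * PowerSeries.C y₁ with hκ₁
  set κ₂ : PowerSeries A := 1 + PowerSeries.X * PowerSeries.mk (fun n => algebraMap ℂ A (r₂ n)) -
      PowerSeries.X * PowerSeries.C y₂ with hκ₂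
  have k1 : κ₁ * β₁ = 1 := h₁.powerSeries
  have k2 : κ₂ * β₂ = 1 := h₂.powerSeries
  have k2' : β₂ * κ₂ = 1 := h₂.powerSeries'
  -- Both `u` and `v` have zero constant term and `ψ`-centered coefficients, in the two free
  -- subalgebras respectively. Expanding (1 - uv)⁻¹ thus yields alternating centered words.
  set u : PowerSeries A := 1 - β₁ with hu
  set v : PowerSeries A := 1 - β₂ with hv
  have hu0 : coeff 0 u = 0 := by simp [hu, hβ₁, h₁.zero]
  have hv0 : coeff 0 v = 0 := by simp [hv, hβ₂, h₂.zero]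
  have hun : ∀ n, coeff n u ∈ S i ∧ ψ (coeff n u) = 0 := by
    intro n
    rcases n with _ | n
    · rw [hu0]
      exact ⟨zero_mem _, map_zero _⟩
    · have : coeff (n + 1) u = -b₁ (n + 1) := by simp [hu, hβ₁, coeff_one]
      rw [this, map_neg, h₁.map]
      exact ⟨neg_mem (hb₁ _), by simp⟩
  have hvn : ∀ n, coeff n v ∈ S j ∧ ψ (coeff n v) = 0 := by
    intro n
    rcases n with _ | n
    · rw [hv0]
      exact ⟨zero_mem _, map_zero _⟩
    · have : coeff (n + 1) v = -b₂ (n + 1) := by simp [hv, hβ₂, coeff_one]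
      rw [this, map_neg, h₂.map]
      exact ⟨neg_mem (hb₂ _), by simp⟩
  set E := invOfUnit (1 - u * v) 1 with hE
  have hEm : (1 - u * v) * E = 1 := mul_invOfUnit _ _ (by
    have : constantCoeff v = 0 := by simpa using hv0
    simp [this])
  set F := E * β₁ with hF
  have hFrec : F = β₁ + u * (v * F) := by
    have : (1 - u * v) * F = β₁ := by rw [hF, ← mul_assoc, hEm, one_mul]
    rw [← this]
    noncomm_ring
  have hFn : ∀ n, coeff n F = b₁ n + ∑ p ∈ Finset.HasAntidiagonal.antidiagonal n,
      ∑ q ∈ Finset.HasAntidiagonal.antidiagonal p.2, coeff p.1 u * (coeff q.1 v * coeff q.2 F) := by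
    intro n
    nth_rewrite 1 [hFrec]
    rw [map_add, coeff_mul]
    simp only [coeff_mul, Finset.mul_sum]
    simp [hβ₁]
  -- Substituting F = β₁ + uvF lengthens the word and strictly lowers the degree left in F, since
  -- `u` has no constant term. The induction on the degree must therefore cover all words at once.
  have hword : ∀ n x, CenteredWord ψ S j x → ψ (x * coeff n F) = 0 := by
    intro n
    induction n using Nat.strong_induction_on with
    | _ n ih =>
      intro x hx
      rw [hFn, mul_add, map_add, Finset.mul_sum, map_sum, Finset.sum_eq_zero, add_zero]
      · rcases n with _ | n
        · rw [h₁.zero, mul_one]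
          exact hS.map_centeredWord hx
        · exact hS.map_centeredWord (hx.snoc hij.symm (hb₁ _) (by simp [h₁.map]))
      · rintro ⟨p1, p2⟩ hp
        rw [Finset.HasAntidiagonal.mem_antidiagonal] at hp
        rw [Finset.mul_sum, map_sum, Finset.sum_eq_zero]
        rintro ⟨q1, q2⟩ hq
        rw [Finset.HasAntidiagonal.mem_antidiagonal] at hq
        simp only at hp hq ⊢
        rcases Nat.eq_zero_or_pos p1 with rfl | hp1
        · simp [hu0]
        rw [← mul_assoc, ← mul_assoc]
        exact ih q2 (by omega) _
          ((hx.snoc hij.symm (hun _).1 (hun _).2).snoc hij (hvn _).1 (hvn _).2)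
  have hψF : ∀ n, ψ (coeff n F) = if n = 0 then 1 else 0 := by
    intro n
    rw [hFn, map_add, h₁.map, map_sum, Finset.sum_eq_zero, add_zero]
    intro p _
    rw [map_sum, Finset.sum_eq_zero]
    intro q _
    rw [← mul_assoc]
    exact hword _ _ ((CenteredWord.single (hun _).1 (hun _).2).snoc hij (hvn _).1 (hvn _).2)
  refine ⟨fun n => coeff n (β₂ * F), isFreeAppell_of_powerSeries ?_ ?_⟩
  -- Since 1 - uv = β₁ + β₂ - β₁β₂, the product κ₁(1 - uv)κ₂ collapses to κ₁ + κ₂ - 1, the kernel of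
  -- the sum. Its inverse is β₂(1 - uv)⁻¹β₁.
  · have hκ : (1 + PowerSeries.X * PowerSeries.mk (fun n => algebraMap ℂ A (r₁ n + r₂ n)) -
        PowerSeries.X * PowerSeries.C (y₁ + y₂)) = κ₁ * (1 - u * v) * κ₂ := by
      have e1 : κ₁ * (1 - u * v) * κ₂ = κ₁ * (β₂ * κ₂) + (κ₁ * β₁) * κ₂ -
          (κ₁ * β₁) * (β₂ * κ₂) := by
        rw [hu, hv]
        noncomm_ring
      rw [e1, k1, k2']
      have e2 : PowerSeries.mk (fun n => algebraMap ℂ A (r₁ n + r₂ n)) =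
          PowerSeries.mk (fun n => algebraMap ℂ A (r₁ n)) +
            PowerSeries.mk (fun n => algebraMap ℂ A (r₂ n)) := by
        ext n
        simp
      rw [e2, map_add, hκ₁, hκ₂]
      noncomm_ring
    rw [hκ, mul_assoc, ← mul_assoc κ₂, k2, one_mul, mul_assoc, hF, ← mul_assoc _ E, hEm, one_mul,
      k1]
  · intro n
    have : β₂ * F = F - v * F := by
      rw [hv]
      noncomm_ring
    rw [this, map_sub, map_sub, hψF, coeff_mul, map_sum, Finset.sum_eq_zero, sub_zero]
    intro p _
    exact hword _ _ (CenteredWord.single (hvn _).1 (hvn _).2)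

end Additivity

/-! ### Moments in terms of free cumulants, and their small-time asymptotics. -/

section CumulantArray

open Filter Topology

/-- The numbers `ψ(yᵏ bₙ)` in terms of the free cumulants `r j` of order `j + 1`. -/
noncomputable def cumulantArray (r : ℕ → ℂ) : ℕ → ℕ → ℂ
  | 0, n => if n = 0 then 1 else 0
  | k + 1, n => cumulantArray r k (n + 1) +
      ∑ j ∈ Finset.range (n + 1), r j * cumulantArray r k (n - j)

theorem IsFreeAppell.moment_eq_cumulantArray {A : Type*} [Ring A] [Algebra ℂ A]
    {ψ : A →ₗ[ℂ] ℂ} {y : A} {b : ℕ → A} {r : ℕ → ℂ} (h : IsFreeAppell ψ y b r) (k : ℕ) :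
    ψ (y ^ k) = cumulantArray r k 0 := by
  have key : ∀ k n, ψ (y ^ k * b n) = cumulantArray r k n := by
    intro k
    induction k with
    | zero =>
      intro n
      rw [pow_zero, one_mul, h.map, cumulantArray]
    | succ k ih =>
      intro n
      have e : y * b n = b (n + 1) + ∑ j ∈ Finset.range (n + 1), r j • b (n - j) := by
        rw [h.succ, sub_add_cancel]
      rw [pow_succ, mul_assoc, e, mul_add, map_add, ih, Finset.mul_sum, map_sum, cumulantArray]
      simp only [mul_smul_comm, map_smul, smul_eq_mul, ih]
  simpa [h.zero] using key k 0

/-- If all cumulants of order greater than `2` vanish, the moments are semicircular. -/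
theorem cumulantArray_eq_semicircleArray {r : ℕ → ℂ} (hr : ∀ j, 2 ≤ j → r j = 0) (k : ℕ) :
    cumulantArray r k 0 = semicircleArray (r 0) (r 1) k 0 := by
  refine eq_semicircleArray (c := cumulantArray r) (fun n => ?_) (fun k => ?_) (fun k n => ?_) k 0
  · rw [cumulantArray]
  · rw [cumulantArray]
    simp
  · rw [cumulantArray, Finset.sum_range_succ', Finset.sum_range_succ', Finset.sum_eq_zero]
    · simp only [zero_add, Nat.sub_zero, Nat.add_sub_cancel]
      ring
    · intro j _
      rw [hr _ (by omega), zero_mul]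

/-- The moments of elements with cumulants `ρ / N` are asymptotically `ρ / N`. -/
theorem tendsto_mul_cumulantArray {r : ℕ → ℕ → ℂ} {ρ : ℕ → ℂ} {N : ℕ → ℂ}
    (hN : ∀ m, N m ≠ 0) (hN' : Tendsto (fun m => (N m)⁻¹) atTop (𝓝 0))
    (hr : ∀ m j, ρ j = N m * r m j) (k n : ℕ) :
    Tendsto (fun m => N m * cumulantArray (r m) (k + 1) n) atTop (𝓝 (ρ (n + k))) := by
  induction k generalizing n with
  | zero =>
    refine tendsto_const_nhds.congr fun m => ?_
    rw [cumulantArray]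
    simp only [cumulantArray]
    rw [sum_range_mul_ite, if_neg (Nat.succ_ne_zero n), zero_add, ← hr, add_zero]
  | succ k ih =>
    have h1 : ∀ n, Tendsto (fun m => cumulantArray (r m) (k + 1) n) atTop (𝓝 0) := by
      intro n
      have := hN'.mul (ih n)
      rw [zero_mul] at this
      refine this.congr fun m => ?_
      rw [← mul_assoc, inv_mul_cancel₀ (hN m), one_mul]
    -- The factor N is absorbed by one cumulant; the moment multiplying it still tends to zero, so
    -- only the shifted term survives.
    have h2 : Tendsto (fun m => N m * cumulantArray (r m) (k + 1) (n + 1) +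
        ∑ j ∈ Finset.range (n + 1), ρ j * cumulantArray (r m) (k + 1) (n - j)) atTop
        (𝓝 (ρ (n + 1 + k) + ∑ j ∈ Finset.range (n + 1), ρ j * 0)) :=
      (ih (n + 1)).add (tendsto_finsetSum (Finset.range (n + 1)) fun j _ => (h1 (n - j)).const_mul _)
    simp only [mul_zero, Finset.sum_const_zero, add_zero] at h2
    rw [show n + 1 + k = n + (k + 1) by omega] at h2
    refine h2.congr fun m => ?_
    simp only [cumulantArray, mul_add, Finset.mul_sum, hr m, mul_assoc]

end CumulantArray

/-! ### Cumulants and power sums of increments. -/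

section IncrementProcess

open Filter Topology

variable {A : Type*} [Ring A] [StarRing A] [Algebra ℂ A] {φ ψ : A →ₗ[ℂ] ℂ} {T : ℝ} {X : ℝ → A}

theorem IsTwoStateFreeIncrementProcess.free_pair (hX : IsTwoStateFreeIncrementProcess φ ψ T X)
    {s₁ t₁ s₂ t₂ : ℝ} (h₁ : 0 ≤ s₁ ∧ s₁ ≤ t₁ ∧ t₁ ≤ T) (h₂ : 0 ≤ s₂ ∧ s₂ ≤ t₂ ∧ t₂ ≤ T)
    (h : t₁ ≤ s₂) :
    TwoStateFree φ ψ (fun i : Fin 2 => Algebra.adjoin ℂ {X (![t₁, t₂] i) - X (![s₁, s₂] i)}) := by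
  have hd : Disjoint (Set.Ico s₁ t₁) (Set.Ico s₂ t₂) := by
    rw [Set.disjoint_left]
    exact fun x hx hx' => absurd (hx.2.trans_le h) hx'.1.not_gt
  refine hX.free 2 ![s₁, s₂] ![t₁, t₂] (fun i => ?_) (fun i j hij => ?_)
  · fin_cases i
    exacts [h₁, h₂]
  · fin_cases i <;> fin_cases j
    · exact absurd rfl hij
    · exact hd
    · exact hd.symm
    · exact absurd rfl hij

/-- Each further step adds an increment free from the past and with the `ψ`-moments of X(h). The
hypothesis on `r` is phrased for every element with those moments precisely so that it applies to
increments. -/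
theorem IsTwoStateFreeIncrementProcess.isFreeAppell_mul
    (hX : IsTwoStateFreeIncrementProcess φ ψ T X) (hψ : ψ 1 = 1) {h : ℝ} (hh : 0 ≤ h)
    {r : ℕ → ℂ}
    (hr : ∀ z, (∀ n, ψ (z ^ n) = ψ (X h ^ n)) → ∃ b, IsFreeAppell ψ z b r) (m : ℕ)
    (hm : m * h ≤ T) : ∃ b, IsFreeAppell ψ (X (m * h)) b (fun n => m * r n) := by
  induction m with
  | zero =>
    simp only [Nat.cast_zero, zero_mul, hX.zero]
    exact ⟨_, isFreeAppell_zero hψ⟩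
  | succ m ih =>
    push_cast at hm
    have hm0 : 0 ≤ (m : ℝ) * h := by positivity
    have hmT : (m : ℝ) * h ≤ T := by linarith
    obtain ⟨b₁, hb₁⟩ := ih hmT
    obtain ⟨b₂, hb₂⟩ := hr (X ((m + 1) * h) - X (m * h)) fun n => by
      have := (hX.stationary (m * h) ((m + 1) * h) hm0 (by linarith) hm n).2
      rwa [show ((m : ℝ) + 1) * h - m * h = h by ring] at this
    have hS := hX.free_pair (s₁ := 0) (t₁ := m * h) (s₂ := m * h) (t₂ := (m + 1) * h)
      ⟨le_rfl, hm0, hmT⟩ ⟨hm0, by linarith, hm⟩ le_rfl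
    obtain ⟨b, hb⟩ := IsFreeAppell.add hS (i := 0) (j := 1) (by simp)
      (by simp [hX.zero])
      (by simp) hb₁ hb₂
    refine ⟨b, ?_⟩
    have e : (fun n => ((m + 1 : ℕ) : ℂ) * r n) = fun n => m * r n + r n := by
      funext n
      push_cast
      ring
    rw [e]
    convert hb using 1
    push_cast
    abel

/-- The moments of sums of powers of increments. -/
theorem IsTwoStateFreeIncrementProcess.map_sum_pow_mul
    (hX : IsTwoStateFreeIncrementProcess φ ψ T X) (hφ : φ 1 = 1) (hψ : ψ 1 = 1) {h : ℝ}
    (hh : 0 ≤ h) (n : ℕ) (hn : n * h ≤ T) (k : ℕ) (χ : A →ₗ[ℂ] ℂ) (hχ : χ = φ ∨ χ = ψ) :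
    χ (∑ i ∈ Finset.range n, (X ((i + 1) * h) - X (i * h)) ^ k) = n * χ (X h ^ k) ∧
    χ ((∑ i ∈ Finset.range n, (X ((i + 1) * h) - X (i * h)) ^ k) *
        ∑ i ∈ Finset.range n, (X ((i + 1) * h) - X (i * h)) ^ k) =
      n * χ (X h ^ (2 * k)) + n * (n - 1) * χ (X h ^ k) ^ 2 := by
  have hi : ∀ i < n, 0 ≤ (i : ℝ) * h ∧ (i : ℝ) * h ≤ (i + 1) * h ∧ ((i : ℝ) + 1) * h ≤ T := by
    intro i hi
    refine ⟨by positivity, by nlinarith, le_trans ?_ hn⟩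
    have : (i : ℝ) + 1 ≤ n := by exact_mod_cast hi
    exact mul_le_mul_of_nonneg_right this hh
  have hmom : ∀ i < n, ∀ k, χ ((X ((i + 1) * h) - X (i * h)) ^ k) = χ (X h ^ k) := by
    intro i hin k
    obtain ⟨h1, h2, h3⟩ := hi i hin
    have := hX.stationary _ _ h1 h2 h3 k
    rw [show ((i : ℝ) + 1) * h - i * h = h by ring] at this
    rcases hχ with rfl | rfl
    exacts [this.1, this.2]
  have hpair : ∀ i < n, ∀ j < n, i ≠ j →
      χ ((X ((i + 1) * h) - X (i * h)) ^ k * (X ((j + 1) * h) - X (j * h)) ^ k) =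
        χ (X h ^ k) ^ 2 := by
    intro i hin j hjn hij
    have aux : ∀ {s₁ t₁ s₂ t₂ : ℝ} (_ : TwoStateFree φ ψ
        (fun i : Fin 2 => Algebra.adjoin ℂ {X (![t₁, t₂] i) - X (![s₁, s₂] i)})) (p q : Fin 2)
        (_ : p ≠ q),
        χ ((X (![t₁, t₂] p) - X (![s₁, s₂] p)) ^ k * (X (![t₁, t₂] q) - X (![s₁, s₂] q)) ^ k) =
          χ ((X (![t₁, t₂] p) - X (![s₁, s₂] p)) ^ k) *
            χ ((X (![t₁, t₂] q) - X (![s₁, s₂] q)) ^ k) := by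
      intro s₁ t₁ s₂ t₂ hS p q hpq
      have := hS.map_mul hφ hψ hpq (pow_mem (Algebra.self_mem_adjoin_singleton ℂ _) k)
        (pow_mem (Algebra.self_mem_adjoin_singleton ℂ _) k)
      rcases hχ with rfl | rfl
      exacts [this.2, this.1]
    rcases lt_or_gt_of_ne hij with hlt | hlt
    · have hle : ((i : ℝ) + 1) * h ≤ j * h :=
        mul_le_mul_of_nonneg_right (by exact_mod_cast hlt) hh
      have := aux (hX.free_pair (hi i hin) (hi j hjn) hle) 0 1 (by simp)
      simp only [Matrix.cons_val_zero, Matrix.cons_val_one] at this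
      rw [this, hmom i hin, hmom j hjn, pow_two]
    · have hle : ((j : ℝ) + 1) * h ≤ i * h :=
        mul_le_mul_of_nonneg_right (by exact_mod_cast hlt) hh
      have := aux (hX.free_pair (hi j hjn) (hi i hin) hle) 1 0 (by simp)
      simp only [Matrix.cons_val_zero, Matrix.cons_val_one] at this
      rw [this, hmom i hin, hmom j hjn, pow_two]
  constructor
  · rw [map_sum, Finset.sum_congr rfl fun i hin => hmom i (Finset.mem_range.mp hin) k]
    simp
  · rw [Finset.sum_mul_sum, map_sum]
    have : ∀ i ∈ Finset.range n, χ (∑ j ∈ Finset.range n,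
        (X ((i + 1) * h) - X (i * h)) ^ k * (X ((j + 1) * h) - X (j * h)) ^ k) =
          χ (X h ^ (2 * k)) + (n - 1) * χ (X h ^ k) ^ 2 := by
      intro i hin
      rw [map_sum, ← Finset.add_sum_erase _ _ hin, ← pow_add, ← two_mul,
        hmom i (Finset.mem_range.mp hin)]
      congr 1
      rw [Finset.sum_congr rfl fun j hj => hpair i (Finset.mem_range.mp hin) j
        (Finset.mem_range.mp (Finset.mem_of_mem_erase hj)) (Finset.ne_of_mem_erase hj).symm,
        Finset.sum_const, Finset.card_erase_of_mem hin, Finset.card_range, nsmul_eq_mul,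
        Nat.cast_sub (by have := Finset.mem_range.mp hin; omega), Nat.cast_one]
    rw [Finset.sum_congr rfl this, Finset.sum_const, Finset.card_range, nsmul_eq_mul]
    ring

theorem IsTwoStateFreeBrownianMotion.map_sq (hX : IsTwoStateFreeBrownianMotion φ ψ T X) {h : ℝ}
    (hh : 0 ≤ h) (hT : h ≤ T) : φ (X h ^ 2) = h := by
  have := hX.increment_variance 0 h le_rfl hh hT
  rwa [hX.zero, sub_zero, sub_zero] at this

theorem IsTwoStateFreeBrownianMotion.moment_recursion
    (hX : IsTwoStateFreeBrownianMotion φ ψ T X) (hφ : φ 1 = 1) (hψ : ψ 1 = 1) {h : ℝ}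
    (hh : 0 ≤ h) (hT : h ≤ T) (n : ℕ) :
    φ (X h ^ (n + 2)) =
      h * ∑ j ∈ Finset.range (n + 1), ψ (X h ^ j) * φ (X h ^ (n - j)) := by
  have h0 := hX.mean_zero h ⟨hh, hT⟩
  have := moment_succ_of_twoStateCumulant_eq_zero φ ψ hφ hψ (X h)
    (fun k hk => by simpa [hX.zero] using hX.normal 0 h le_rfl hh hT k hk) (n + 1)
  rw [h0, hX.map_sq hh hT] at this
  simpa using this

variable [StarModule ℂ A]

/-- In the `W*`-setting, the `ψ`-distributions of a two-state free Brownian motion are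
semicircular. -/
theorem IsTwoStateFreeBrownianMotion.moment_eq_semicircleArray
    (hX : IsTwoStateFreeBrownianMotion φ ψ T X) (hφ : IsPositiveUnital φ)
    (hψ : IsPositiveUnital ψ) (hA : IsFaithfulWStarSpace φ ψ) {t : ℝ} (ht : 0 < t) (htT : t ≤ T)
    (k : ℕ) : ψ (X t ^ k) = semicircleArray (ψ (X t)) t k 0 := by
  obtain ⟨ρ, hρ⟩ := exists_isFreeAppell hψ.map_one (X t)
  obtain ⟨b, hb⟩ := hρ (X t) fun _ => rfl
  choose r hr using fun N : ℕ => exists_isFreeAppell hψ.map_one (X (t / (N + 1)))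
  set M : ℕ → ℂ := fun N => (N : ℂ) + 1 with hM
  have hM0 : ∀ N, M N ≠ 0 := fun N => Nat.cast_add_one_ne_zero N
  have hMr : ∀ N : ℕ, (N : ℝ) + 1 ≠ 0 := fun N => Nat.cast_add_one_ne_zero N
  have hMinv : Tendsto (fun N => (M N)⁻¹) atTop (𝓝 0) := by
    have := tendsto_one_div_add_atTop_nhds_zero_nat (𝕜 := ℂ)
    simpa only [one_div] using this
  have hh : ∀ N : ℕ, 0 ≤ t / (N + 1) := fun N => by positivity
  have hhT : ∀ N : ℕ, ((N + 1 : ℕ) : ℝ) * (t / (N + 1)) = t := fun N => by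
    push_cast
    field_simp [hMr N]
  have hhle : ∀ N : ℕ, t / (N + 1) ≤ T := fun N =>
    (div_le_self ht.le (by linarith [(Nat.cast_nonneg N : (0 : ℝ) ≤ N)])).trans htT
  have hρr : ∀ N j, ρ j = M N * r N j := by
    intro N j
    obtain ⟨b', hb'⟩ := hX.isFreeAppell_mul hψ.map_one (hh N) (hr N) (N + 1)
      (by rw [hhT]; exact htT)
    rw [hhT] at hb'
    have := hb.unique hb' j
    simpa [hM] using this
  -- asymptotics of the moments of small increments
  have hm : ∀ k, Tendsto (fun N : ℕ => M N * ψ (X (t / (N + 1)) ^ (k + 1))) atTop (𝓝 (ρ k)) := by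
    intro k
    have h := tendsto_mul_cumulantArray hM0 hMinv hρr k 0
    rw [zero_add] at h
    refine h.congr fun N => ?_
    obtain ⟨b', hb'⟩ := hr N _ fun _ => rfl
    rw [hb'.moment_eq_cumulantArray]
  have hto0 : ∀ {f : ℕ → ℂ} {z : ℂ}, Tendsto (fun N => M N * f N) atTop (𝓝 z) →
      Tendsto f atTop (𝓝 0) := by
    intro f z hf
    have := hMinv.mul hf
    rw [zero_mul] at this
    refine this.congr fun N => ?_
    rw [← mul_assoc, inv_mul_cancel₀ (hM0 N), one_mul]
  -- The recursion for `φ` carries a factor h that cancels M. All moments of positive order tend to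
  -- zero, so in the remaining sum only the product of two zeroth moments has a nonzero limit, and
  -- it occurs only for the second moment.
  have hp1 : ∀ k, Tendsto (fun N : ℕ => M N * φ (X (t / (N + 1)) ^ (k + 1))) atTop
      (𝓝 (if k = 1 then (t : ℂ) else 0)) := by
    intro k
    induction k using Nat.strong_induction_on with
    | _ k ih =>
      rcases k with _ | k
      · refine tendsto_const_nhds.congr fun N => ?_
        rw [zero_add, pow_one, hX.mean_zero _ ⟨hh N, hhle N⟩]
        simp
      have hrec : ∀ N : ℕ, M N * φ (X (t / (N + 1)) ^ (k + 1 + 1)) =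
          t * ∑ j ∈ Finset.range (k + 1),
            ψ (X (t / (N + 1)) ^ j) * φ (X (t / (N + 1)) ^ (k - j)) := by
        intro N
        rw [hX.moment_recursion hφ.map_one hψ.map_one (hh N) (hhle N), ← mul_assoc]
        congr 1
        push_cast
        exact mul_div_cancel₀ _ (hM0 N)
      simp only [hrec]
      have hφ0 : ∀ j < k + 1, Tendsto (fun N : ℕ => φ (X (t / (N + 1)) ^ j)) atTop
          (𝓝 (if j = 0 then 1 else 0)) := by
        intro j hj
        rcases j with _ | j
        · simp [hφ.map_one]
        · simpa using hto0 (ih j (by omega))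
      have hψ0 : ∀ j, Tendsto (fun N : ℕ => ψ (X (t / (N + 1)) ^ j)) atTop
          (𝓝 (if j = 0 then 1 else 0)) := by
        intro j
        rcases j with _ | j
        · simp [hψ.map_one]
        · simpa using hto0 (hm j)
      have hlim := (tendsto_finsetSum (Finset.range (k + 1)) fun j hj =>
        (hψ0 j).mul (hφ0 (k - j) (by omega))).const_mul (t : ℂ)
      refine hlim.trans (le_of_eq (congrArg 𝓝 ?_))
      rw [Finset.sum_eq_single 0]
      · simp
      · intro j _ hj
        simp [hj]
      · simp
  -- sums of powers of the increments
  have key : ∀ k, ρ (k + 1) = if k = 0 then (t : ℂ) else 0 := by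
    intro k
    set τ : ℝ := if k = 0 then t else 0 with hτ
    have hτc : (if k = 0 then (t : ℂ) else 0) = τ := by
      rw [hτ]
      split_ifs <;> simp
    rw [hτc]
    set Z : ℕ → A := fun N => ∑ i ∈ Finset.range (N + 1),
      (X ((i + 1) * (t / (N + 1))) - X (i * (t / (N + 1)))) ^ (k + 2) with hZ
    have hZsa : ∀ N, IsSelfAdjoint (Z N - (τ : ℂ) • 1) := by
      intro N
      refine IsSelfAdjoint.sub ?_ ?_
      · rw [IsSelfAdjoint, hZ, star_sum]
        refine Finset.sum_congr rfl fun i hi => ?_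
        have hi' := Finset.mem_range.mp hi
        have h1 : ((i : ℝ) + 1) * (t / (N + 1)) ≤ T := by
          refine le_trans (mul_le_mul_of_nonneg_right ?_ (hh N)) ((hhT N).le.trans htT)
          exact_mod_cast hi'
        have h2 : 0 ≤ (i : ℝ) * (t / (N + 1)) := mul_nonneg (Nat.cast_nonneg i) (hh N)
        have h3 : (i : ℝ) * (t / (N + 1)) ≤ (i + 1) * (t / (N + 1)) :=
          mul_le_mul_of_nonneg_right (by linarith) (hh N)
        rw [star_pow, star_sub, (hX.selfAdjoint _ ⟨h2.trans h3, h1⟩).star_eq,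
          (hX.selfAdjoint _ ⟨h2, h3.trans h1⟩).star_eq]
      · rw [IsSelfAdjoint, star_smul, star_one]
        simp
    -- The M(M - 1) off-diagonal pairs are written as a square minus a correction, so that every
    -- term is a product of factors whose limits are known, for either functional.
    have hsum : ∀ (χ : A →ₗ[ℂ] ℂ), (χ = φ ∨ χ = ψ) → χ 1 = 1 → ∀ N : ℕ,
        χ (Z N - (τ : ℂ) • 1) = M N * χ (X (t / (N + 1)) ^ (k + 1 + 1)) - τ ∧
        χ ((Z N - (τ : ℂ) • 1) * (Z N - (τ : ℂ) • 1)) =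
          M N * χ (X (t / (N + 1)) ^ (2 * k + 3 + 1)) +
            (M N * χ (X (t / (N + 1)) ^ (k + 1 + 1))) ^ 2 -
            χ (X (t / (N + 1)) ^ (k + 1 + 1)) * (M N * χ (X (t / (N + 1)) ^ (k + 1 + 1))) -
            2 * τ * (M N * χ (X (t / (N + 1)) ^ (k + 1 + 1))) + τ ^ 2 := by
      intro χ hχ hχ1 N
      have h := hX.map_sum_pow_mul hφ.map_one hψ.map_one (hh N) (N + 1)
        (by rw [hhT]; exact htT) (k + 2) χ hχ
      obtain ⟨e1, e2⟩ := h
      rw [show ∑ i ∈ Finset.range (N + 1), (X ((i + 1) * (t / (N + 1))) -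
        X (i * (t / (N + 1)))) ^ (k + 2) = Z N from rfl] at e1 e2
      constructor
      · rw [map_sub, map_smul, e1, hχ1]
        simp [hM]
      · have e3 : (Z N - (τ : ℂ) • 1) * (Z N - (τ : ℂ) • 1) =
            Z N * Z N - (2 * τ : ℂ) • Z N + ((τ : ℂ) ^ 2) • 1 := by
          rw [sub_mul, mul_sub, mul_sub, smul_mul_assoc, smul_mul_assoc, mul_smul_comm,
            mul_smul_comm, mul_one, one_mul, one_mul, smul_smul, two_mul, add_smul, pow_two]
          abel
        rw [e3, map_add, map_sub, map_smul, map_smul, e1, e2, hχ1,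
          show 2 * (k + 2) = 2 * k + 3 + 1 by ring]
        simp only [hM, smul_eq_mul]
        push_cast
        ring
    have hlimφ := hp1 (k + 1)
    have hif : (if k + 1 = 1 then (t : ℂ) else 0) = τ := by
      rw [← hτc]
      simp
    rw [hif] at hlimφ
    -- The diagonal moments have order at least four and disappear in the limit; the rest tends to
    -- τ² - 2τ² + τ².
    have h1 : Tendsto (fun N => φ ((Z N - (τ : ℂ) • 1) * (Z N - (τ : ℂ) • 1))) atTop (𝓝 0) := by
      have h := (((((hp1 (2 * k + 3)).add (hlimφ.pow 2)).sub ((hto0 hlimφ).mul hlimφ)).sub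
        (hlimφ.const_mul (2 * (τ : ℂ)))).add_const ((τ : ℂ) ^ 2))
      rw [if_neg (by omega)] at h
      refine (h.congr fun N => ?_).trans (le_of_eq (congrArg 𝓝 ?_))
      · exact ((hsum φ (Or.inl rfl) hφ.map_one N).2).symm
      · ring
    -- Under `ψ` the limit of the second moment is not yet known to vanish, but convergence already
    -- gives the required bound.
    have h2 : ∃ K : ℝ, ∀ N, ‖ψ ((Z N - (τ : ℂ) • 1) * (Z N - (τ : ℂ) • 1))‖ ≤ K := by
      have h := (((((hm (2 * k + 3)).add ((hm (k + 1)).pow 2)).sub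
        ((hto0 (hm (k + 1))).mul (hm (k + 1)))).sub
        ((hm (k + 1)).const_mul (2 * (τ : ℂ)))).add_const ((τ : ℂ) ^ 2))
      have h' := (h.congr fun N => ((hsum ψ (Or.inr rfl) hψ.map_one N).2).symm).norm
      obtain ⟨K, hK⟩ := h'.bddAbove_range
      exact ⟨K, fun N => hK ⟨N, rfl⟩⟩
    obtain ⟨K, hK⟩ := h2
    have h3 : Tendsto (fun N => ψ (Z N - (τ : ℂ) • 1)) atTop (𝓝 (ρ (k + 1) - τ)) :=
      ((hm (k + 1)).sub_const (τ : ℂ)).congr fun N => ((hsum ψ (Or.inr rfl) hψ.map_one N).1).symm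
    exact sub_eq_zero.mp (hA.eq_zero_of_tendsto hφ hψ hZsa h1 hK h3)
  have hρ0 : ρ 0 = ψ (X t) := by
    rw [← hb.moment, hb.zero, mul_one]
  have hρ1 : ρ 1 = t := by simpa using key 0
  rw [hb.moment_eq_cumulantArray, cumulantArray_eq_semicircleArray (fun j hj => ?_), hρ0, hρ1]
  obtain ⟨i, rfl⟩ := Nat.exists_eq_add_of_le' hj
  simpa using key (i + 1)

end IncrementProcess

/-! ### Determinacy of measures with bounded support -/

section Determinacy

open Filter Topology

theorem integrable_of_ae_abs_le {E : Type*} [NormedAddCommGroup E] {μ : Measure ℝ}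
    [IsFiniteMeasure μ] {C : ℝ} (hμ : ∀ᵐ x ∂μ, |x| ≤ C) {f : ℝ → E}
    (hf : ContinuousOn f (Set.Icc (-C) C)) (hm : AEStronglyMeasurable f μ) : Integrable f μ := by
  obtain ⟨K, hK⟩ := isCompact_Icc.exists_bound_of_continuousOn hf
  exact Integrable.of_bound hm K (hμ.mono fun x hx => hK x (abs_le.mp hx))

/-- Markov's inequality for the even moments bounds ν(|x| ≥ C + 1) by (C/(C + 1))²ⁿ, which tends to
zero. -/
theorem ae_abs_le_of_moments {μ ν : Measure ℝ} [IsProbabilityMeasure μ] [IsProbabilityMeasure ν]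
    {C : ℝ} (hμ : ∀ᵐ x ∂μ, |x| ≤ C) (hν : ∀ n : ℕ, Integrable (fun x : ℝ => x ^ n) ν)
    (h : ∀ n : ℕ, ∫ x, x ^ n ∂ν = ∫ x, x ^ n ∂μ) : ∀ᵐ x ∂ν, |x| ≤ C + 1 := by
  have hC : 0 ≤ C := by
    obtain ⟨x, hx⟩ := hμ.exists
    exact (abs_nonneg x).trans hx
  have hbound : ∀ n : ℕ, ν.real {x | C + 1 ≤ |x|} ≤ ((C / (C + 1)) ^ 2) ^ n := by
    intro n
    have h1 := mul_meas_ge_le_integral_of_nonneg (μ := ν) (f := fun x : ℝ => x ^ (2 * n))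
      (Eventually.of_forall fun x => (even_two_mul n).pow_nonneg x) (hν _) ((C + 1) ^ (2 * n))
    have h2 : ∫ x, x ^ (2 * n) ∂μ ≤ C ^ (2 * n) := by
      have : ∫ x, x ^ (2 * n) ∂μ ≤ ∫ _, C ^ (2 * n) ∂μ := by
        refine integral_mono_of_nonneg
          (Eventually.of_forall fun x => (even_two_mul n).pow_nonneg x) (integrable_const _)
          (hμ.mono fun x hx => ?_)
        have := pow_le_pow_left₀ (abs_nonneg x) hx (2 * n)
        rwa [(even_two_mul n).pow_abs] at this
      simpa using this
    have h3 : ν.real {x | C + 1 ≤ |x|} ≤ ν.real {x | (C + 1) ^ (2 * n) ≤ x ^ (2 * n)} := by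
      refine measureReal_mono fun x hx => ?_
      simp only [Set.mem_ofPred_eq] at hx ⊢
      have := pow_le_pow_left₀ (by linarith) hx (2 * n)
      rwa [(even_two_mul n).pow_abs] at this
    rw [h] at h1
    rw [← pow_mul, div_pow, le_div_iff₀ (by positivity), mul_comm]
    exact (mul_le_mul_of_nonneg_left h3 (by positivity)).trans (h1.trans h2)
  have hlt : (C / (C + 1)) ^ 2 < 1 := by
    rw [sq_lt_one_iff₀ (by positivity), div_lt_one (by positivity)]
    linarith
  have h0 : ν.real {x | C + 1 ≤ |x|} = 0 :=
    le_antisymm (ge_of_tendsto' (tendsto_pow_atTop_nhds_zero_of_lt_one (sq_nonneg _) hlt) hbound)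
      measureReal_nonneg
  rw [measureReal_eq_zero_iff] at h0
  refine (ae_iff.mpr ?_ : ∀ᵐ x ∂ν, ¬ (C + 1 ≤ |x|)).mono fun x hx => (not_le.mp hx).le
  simpa using h0

theorem integral_polynomial_eq {μ ν : Measure ℝ} (hμ : ∀ n : ℕ, Integrable (fun x : ℝ => x ^ n) μ)
    (hν : ∀ n : ℕ, Integrable (fun x : ℝ => x ^ n) ν)
    (h : ∀ n : ℕ, ∫ x, x ^ n ∂ν = ∫ x, x ^ n ∂μ) (p : Polynomial ℝ) :
    Integrable (fun x => p.eval x) μ ∧ Integrable (fun x => p.eval x) ν ∧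
      ∫ x, p.eval x ∂ν = ∫ x, p.eval x ∂μ := by
  induction p using Polynomial.induction_on' with
  | add p q hp hq =>
    simp only [Polynomial.eval_add]
    refine ⟨hp.1.add hq.1, hp.2.1.add hq.2.1, ?_⟩
    rw [integral_add hp.2.1 hq.2.1, integral_add hp.1 hq.1, hp.2.2, hq.2.2]
  | monomial n c =>
    simp only [Polynomial.eval_monomial]
    refine ⟨(hμ n).const_mul c, (hν n).const_mul c, ?_⟩
    rw [integral_const_mul, integral_const_mul, h]

/-- A probability measure with bounded support is determined by its moments. -/
theorem eq_of_moments {μ ν : Measure ℝ} [IsProbabilityMeasure μ] [IsProbabilityMeasure ν]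
    {C : ℝ} (hμ : ∀ᵐ x ∂μ, |x| ≤ C) (hν : ∀ n : ℕ, Integrable (fun x : ℝ => x ^ n) ν)
    (h : ∀ n : ℕ, ∫ x, x ^ n ∂ν = ∫ x, x ^ n ∂μ) : ν = μ := by
  have hν' := ae_abs_le_of_moments hμ hν h
  have hμ' : ∀ᵐ x ∂μ, |x| ≤ C + 1 := hμ.mono fun x hx => by linarith
  have hμi : ∀ n : ℕ, Integrable (fun x : ℝ => x ^ n) μ := fun n =>
    integrable_of_ae_abs_le hμ (continuous_pow n).continuousOn
      (continuous_pow n).aestronglyMeasurable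
  refine ext_of_forall_integral_eq_of_IsFiniteMeasure fun f => ?_
  refine eq_of_forall_dist_le fun ε hε => ?_
  obtain ⟨p, hp⟩ := exists_polynomial_near_of_continuousOn (-(C + 1)) (C + 1) f
    f.continuous.continuousOn (ε / 2) (half_pos hε)
  obtain ⟨hpμ, hpν, hpe⟩ := integral_polynomial_eq hμi hν h p
  have key : ∀ (χ : Measure ℝ) [IsProbabilityMeasure χ], (∀ᵐ x ∂χ, |x| ≤ C + 1) →
      Integrable (fun x => p.eval x) χ → |∫ x, f x ∂χ - ∫ x, p.eval x ∂χ| ≤ ε / 2 := by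
    intro χ _ hχ hpχ
    have hf : Integrable f χ := f.integrable χ
    rw [← integral_sub hf hpχ]
    have := norm_integral_le_of_norm_le_const (μ := χ) (f := fun x => f x - p.eval x)
      (C := ε / 2) (hχ.mono fun x hx => by
        have := (hp x (abs_le.mp hx)).le
        rwa [abs_sub_comm] at this)
    simpa using this
  have k1 := key ν hν' hpν
  have k2 := key μ hμ' hpμ
  rw [hpe] at k1
  rw [Real.dist_eq]
  rw [abs_sub_comm] at k2
  calc |∫ x, f x ∂ν - ∫ x, f x ∂μ|
      ≤ |∫ x, f x ∂ν - ∫ x, p.eval x ∂μ| + |∫ x, p.eval x ∂μ - ∫ x, f x ∂μ| := abs_sub_le _ _ _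
    _ ≤ ε := by linarith

/-- A distribution with bounded support is the only distribution. -/
theorem IsDistribution.iff_eq {A : Type*} [Ring A] [Algebra ℂ A] {χ : A →ₗ[ℂ] ℂ} {a : A}
    {μ : Measure ℝ} (hμ : IsDistribution χ a μ) {C : ℝ} (hC : ∀ᵐ x ∂μ, |x| ≤ C)
    (ν : Measure ℝ) : IsDistribution χ a ν ↔ ν = μ := by
  constructor
  · intro hν
    have := hμ.prob
    have := hν.prob
    exact eq_of_moments hC hν.integrable fun n => by
      have h := (hν.moment n).symm.trans (hμ.moment n)
      exact_mod_cast h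
  · rintro rfl
    exact hμ

theorem isDistribution_of_moments {A : Type*} [Ring A] [Algebra ℂ A] {χ : A →ₗ[ℂ] ℂ} {a : A}
    {μ : Measure ℝ} (hp : IsProbabilityMeasure μ) {C : ℝ} (hC : ∀ᵐ x ∂μ, |x| ≤ C)
    (h : ∀ n : ℕ, χ (a ^ n) = ∫ x, (x : ℂ) ^ n ∂μ) : IsDistribution χ a μ where
  prob := hp
  integrable n := integrable_of_ae_abs_le hC (continuous_pow n).continuousOn
    (continuous_pow n).aestronglyMeasurable
  moment n := by
    rw [h, ← integral_complex_ofReal]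
    push_cast
    rfl

theorem IsDistribution.map_aeval {A : Type*} [Ring A] [Algebra ℂ A] {χ : A →ₗ[ℂ] ℂ} {a : A}
    {μ : Measure ℝ} (hμ : IsDistribution χ a μ) (p : Polynomial ℂ) :
    Integrable (fun x : ℝ => p.eval (x : ℂ)) μ ∧
      χ (Polynomial.aeval a p) = ∫ x : ℝ, p.eval (x : ℂ) ∂μ := by
  induction p using Polynomial.induction_on' with
  | add p q hp hq =>
    simp only [Polynomial.eval_add, map_add]
    refine ⟨hp.1.add hq.1, ?_⟩
    rw [integral_add hp.1 hq.1, hp.2, hq.2]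
  | monomial n c =>
    have hi : Integrable (fun x : ℝ => (x : ℂ) ^ n) μ := by
      simpa using (hμ.integrable n).ofReal (𝕜 := ℂ)
    simp only [Polynomial.eval_monomial, Polynomial.aeval_monomial]
    refine ⟨hi.const_mul c, ?_⟩
    rw [integral_const_mul, ← Algebra.smul_def, map_smul, hμ.moment, ← integral_complex_ofReal,
      smul_eq_mul]
    push_cast
    rfl

end Determinacy

/-! ### Semicircular distributions -/

section Semicircle

open Filter Topology

/-- The measure `(2/π) sin² θ dθ` on `(0, π)`. -/
noncomputable def sinSqMeasure : Measure ℝ :=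
  (volume.restrict (Set.Ioo 0 Real.pi)).withDensity
    (fun θ => ENNReal.ofReal (2 / Real.pi * Real.sin θ ^ 2))

theorem image_cos_Ioo {m v : ℝ} (hv : 0 < v) :
    (fun θ => m + 2 * √v * Real.cos θ) '' Set.Ioo 0 Real.pi =
      Set.Ioo (m - 2 * √v) (m + 2 * √v) := by
  have hs : 0 < √v := Real.sqrt_pos.mpr hv
  ext x
  constructor
  · rintro ⟨θ, hθ, rfl⟩
    have h1 := Real.strictAntiOn_cos ⟨hθ.1.le, hθ.2.le⟩ ⟨Real.pi_pos.le, le_rfl⟩ hθ.2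
    have h2 := Real.strictAntiOn_cos ⟨le_rfl, Real.pi_pos.le⟩ ⟨hθ.1.le, hθ.2.le⟩ hθ.1
    rw [Real.cos_pi] at h1
    rw [Real.cos_zero] at h2
    constructor <;> simp only <;> nlinarith
  · intro hx
    have h1 : -1 < (x - m) / (2 * √v) := by
      rw [lt_div_iff₀ (by positivity)]
      linarith [hx.1]
    have h2 : (x - m) / (2 * √v) < 1 := by
      rw [div_lt_iff₀ (by positivity)]
      linarith [hx.2]
    refine ⟨Real.arccos ((x - m) / (2 * √v)), ⟨Real.arccos_pos.mpr h2, ?_⟩, ?_⟩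
    · refine lt_of_le_of_ne (Real.arccos_le_pi _) fun h => ?_
      exact absurd (Real.arccos_eq_pi.mp h) (not_le.mpr h1)
    · simp only
      rw [Real.cos_arccos h1.le h2.le]
      field_simp
      ring

/-- Under x = m + 2√v cos θ the square root and the Jacobian are both 2√v sin θ. All integrals
against the law thus become trigonometric integrals on (0, π). -/
theorem semicircleLaw_eq_map {m v : ℝ} (hv : 0 < v) :
    semicircleLaw m v = sinSqMeasure.map (fun θ => m + 2 * √v * Real.cos θ) := by
  classical
  have hs : 0 < √v := Real.sqrt_pos.mpr hv
  set f : ℝ → ℝ := fun θ => m + 2 * √v * Real.cos θ with hf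
  have hfm : Measurable f := by fun_prop
  ext s hsm
  rw [Measure.map_apply hfm hsm, sinSqMeasure, withDensity_apply _ (hfm hsm), semicircleLaw,
    withDensity_apply _ hsm, ← lintegral_indicator hsm, ← lintegral_indicator (hfm hsm)]
  have hD : ∀ x, x ∉ f '' Set.Ioo 0 Real.pi →
      1 / (2 * Real.pi * v) * Real.sqrt (max (4 * v - (x - m) ^ 2) 0) = 0 := by
    intro x hx
    rw [hf, image_cos_Ioo hv, Set.mem_Ioo, not_and_or, not_lt, not_lt] at hx
    have hsq : √v ^ 2 = v := Real.sq_sqrt hv.le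
    rw [max_eq_right, Real.sqrt_zero, mul_zero]
    rcases hx with hx | hx <;> nlinarith
  have himg : MeasurableSet (f '' Set.Ioo 0 Real.pi) := by
    rw [hf, image_cos_Ioo hv]
    exact measurableSet_Ioo
  have hsupp : ∫⁻ x, s.indicator (fun x => ENNReal.ofReal
        (1 / (2 * Real.pi * v) * Real.sqrt (max (4 * v - (x - m) ^ 2) 0))) x =
      ∫⁻ x in f '' Set.Ioo 0 Real.pi, s.indicator (fun x => ENNReal.ofReal
        (1 / (2 * Real.pi * v) * Real.sqrt (max (4 * v - (x - m) ^ 2) 0))) x := by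
    rw [← lintegral_indicator himg]
    refine lintegral_congr fun x => ?_
    by_cases hx : x ∈ f '' Set.Ioo 0 Real.pi
    · rw [Set.indicator_of_mem hx]
    · rw [Set.indicator_of_notMem hx, Set.indicator_apply]
      split_ifs
      · rw [hD x hx, ENNReal.ofReal_zero]
      · rfl
  rw [hsupp, lintegral_image_eq_lintegral_abs_deriv_mul measurableSet_Ioo
    (f' := fun θ => 2 * √v * -Real.sin θ)]
  · refine setLIntegral_congr_fun measurableSet_Ioo fun θ hθ => ?_
    have hsin : 0 < Real.sin θ := Real.sin_pos_of_mem_Ioo hθ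
    simp only [Set.indicator_apply, Set.mem_preimage]
    split_ifs
    · rw [← ENNReal.ofReal_mul (abs_nonneg _)]
      congr 1
      have h1 : 4 * v - (f θ - m) ^ 2 = (2 * √v * Real.sin θ) ^ 2 := by
        have hsq : √v ^ 2 = v := Real.sq_sqrt hv.le
        have := Real.sin_sq_add_cos_sq θ
        simp only [hf]
        linear_combination (-4 * v) * this + (4 * Real.cos θ ^ 2 * (-1) - 4 * Real.sin θ ^ 2) * hsq
      rw [h1, max_eq_left (sq_nonneg _), Real.sqrt_sq (by positivity), mul_neg, abs_neg,
        abs_of_pos (by positivity)]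
      have hsq : √v * √v = v := Real.mul_self_sqrt hv.le
      have hpi := Real.pi_pos
      field_simp
      linear_combination hsq
    · rw [mul_zero]
  · intro θ _
    have := ((Real.hasDerivAt_cos θ).const_mul (2 * √v)).const_add m
    exact this.hasDerivWithinAt
  · intro x hx y hy hxy
    have : Real.cos x = Real.cos y := by
      have h := add_left_cancel hxy
      exact mul_left_cancel₀ (by positivity) h
    exact Real.injOn_cos ⟨hx.1.le, hx.2.le⟩ ⟨hy.1.le, hy.2.le⟩ this

theorem ae_sinSqMeasure : ∀ᵐ θ ∂sinSqMeasure, θ ∈ Set.Ioo 0 Real.pi :=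
  (withDensity_absolutelyContinuous _ _).ae_le (ae_restrict_mem measurableSet_Ioo)

theorem integral_sinSqMeasure {E : Type*} [NormedAddCommGroup E] [NormedSpace ℝ E] (f : ℝ → E) :
    ∫ θ, f θ ∂sinSqMeasure = ∫ θ in (0)..Real.pi, (2 / Real.pi * Real.sin θ ^ 2) • f θ := by
  have hpi := Real.pi_pos
  rw [intervalIntegral.integral_of_le hpi.le, integral_Ioc_eq_integral_Ioo, sinSqMeasure,
    integral_withDensity_eq_integral_toReal_smul (by fun_prop) (by simp)]
  refine setIntegral_congr_fun measurableSet_Ioo fun θ _ => ?_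
  rw [ENNReal.toReal_ofReal (by positivity)]

theorem integral_semicircleLaw {E : Type*} [NormedAddCommGroup E] [NormedSpace ℝ E] {m v : ℝ}
    (hv : 0 < v) {f : ℝ → E} (hf : AEStronglyMeasurable f (semicircleLaw m v)) :
    ∫ x, f x ∂semicircleLaw m v =
      ∫ θ in (0)..Real.pi, (2 / Real.pi * Real.sin θ ^ 2) • f (m + 2 * √v * Real.cos θ) := by
  rw [semicircleLaw_eq_map hv] at hf ⊢
  rw [integral_map (by fun_prop) hf, integral_sinSqMeasure]

theorem ae_semicircleLaw {m v : ℝ} (hv : 0 < v) :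
    ∀ᵐ x ∂semicircleLaw m v, x ∈ Set.Ioo (m - 2 * √v) (m + 2 * √v) := by
  rw [semicircleLaw_eq_map hv]
  refine (ae_map_iff (p := fun x => x ∈ Set.Ioo (m - 2 * √v) (m + 2 * √v)) (by fun_prop)
    measurableSet_Ioo).mpr ?_
  refine ae_sinSqMeasure.mono fun θ hθ => ?_
  rw [← image_cos_Ioo hv]
  exact ⟨θ, hθ, rfl⟩

theorem integral_cos_nat_mul {n : ℕ} (hn : n ≠ 0) :
    ∫ θ in (0)..Real.pi, Real.cos (n * θ) = 0 := by
  have hn' : (n : ℝ) ≠ 0 := Nat.cast_ne_zero.mpr hn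
  rw [intervalIntegral.integral_comp_mul_left (fun x => Real.cos x) hn', integral_cos,
    Real.sin_nat_mul_pi]
  simp

/-- Orthogonality of the Chebyshev polynomials of the second kind to constants, after multiplication
by the weight sin² θ. -/
theorem integral_sin_mul_sin (n : ℕ) :
    ∫ θ in (0)..Real.pi, Real.sin θ * Real.sin ((n + 1) * θ) =
      if n = 0 then Real.pi / 2 else 0 := by
  have h : ∀ θ : ℝ, Real.sin θ * Real.sin ((n + 1) * θ) =
      1 / 2 * Real.cos (n * θ) - 1 / 2 * Real.cos ((n + 2 : ℕ) * θ) := by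
    intro θ
    push_cast
    rw [show (n : ℝ) * θ = (n + 1) * θ - θ by ring, show ((n : ℝ) + 2) * θ = (n + 1) * θ + θ by ring,
      Real.cos_sub, Real.cos_add]
    ring
  simp only [h]
  rw [intervalIntegral.integral_sub (Continuous.intervalIntegrable (by fun_prop) _ _)
    (Continuous.intervalIntegrable (by fun_prop) _ _), intervalIntegral.integral_const_mul,
    intervalIntegral.integral_const_mul, integral_cos_nat_mul (n := n + 2) (by omega)]
  split_ifs with hn
  · subst hn
    simp
    ring
  · rw [integral_cos_nat_mul hn]
    simp

instance isProbabilityMeasure_sinSqMeasure : IsProbabilityMeasure sinSqMeasure := by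
  have hpi := Real.pi_pos
  refine ⟨?_⟩
  have hint : ∫ θ in Set.Ioo 0 Real.pi, 2 / Real.pi * Real.sin θ ^ 2 = 1 := by
    rw [← integral_Ioc_eq_integral_Ioo, ← intervalIntegral.integral_of_le hpi.le,
      intervalIntegral.integral_const_mul]
    have := integral_sin_mul_sin 0
    simp only [Nat.cast_zero, zero_add, one_mul, if_true, ← pow_two] at this
    rw [this]
    field_simp
  rw [sinSqMeasure, withDensity_apply _ MeasurableSet.univ, Measure.restrict_univ,
    ← ofReal_integral_eq_lintegral_ofReal, hint, ENNReal.ofReal_one]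
  · exact (Continuous.integrableOn_Icc (by fun_prop)).mono_set Set.Ioo_subset_Icc_self
  · exact Eventually.of_forall fun θ => by positivity

theorem isProbabilityMeasure_semicircleLaw {m v : ℝ} (hv : 0 < v) :
    IsProbabilityMeasure (semicircleLaw m v) := by
  rw [semicircleLaw_eq_map hv]
  exact Measure.isProbabilityMeasure_map (by fun_prop)

theorem semicircleLaw_ae_abs_le {m v : ℝ} (hv : 0 < v) :
    ∀ᵐ x ∂semicircleLaw m v, |x| ≤ |m| + 2 * √v := by
  refine (ae_semicircleLaw hv).mono fun x hx => abs_le.mpr ⟨?_, ?_⟩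
  · linarith [hx.1, neg_abs_le m]
  · linarith [hx.2, le_abs_self m]

/-- The moments of the semicircular distributions. -/
theorem integral_pow_semicircleLaw {m v : ℝ} (hv : 0 < v) (k : ℕ) :
    ∫ x : ℝ, (x : ℂ) ^ k ∂semicircleLaw m v = semicircleArray m v k 0 := by
  have hpi := Real.pi_pos
  have hsq : √v * √v = v := Real.mul_self_sqrt hv.le
  -- The integrand of xᵏ against the monic orthogonal polynomial √vⁿ sin((n + 1)θ)/sin θ; one factor
  -- of sin² θ cancels the denominator.
  set g : ℕ → ℕ → ℝ → ℂ := fun k n θ => (((2 / Real.pi * √v ^ n) *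
    (Real.sin θ * Real.sin ((n + 1) * θ)) * (m + 2 * √v * Real.cos θ) ^ k : ℝ) : ℂ) with hg
  have hgi : ∀ k n, IntervalIntegrable (g k n) volume 0 Real.pi := fun k n =>
    Continuous.intervalIntegrable (by fun_prop) _ _
  have key := eq_semicircleArray (a := m) (t := v)
    (c := fun k n => ∫ θ in (0)..Real.pi, g k n θ) ?_ ?_ ?_ k 0
  · rw [← key, integral_semicircleLaw hv (Continuous.aestronglyMeasurable (by fun_prop))]
    refine intervalIntegral.integral_congr fun θ _ => ?_
    simp only [hg, Nat.cast_zero, zero_add, one_mul, pow_zero, mul_one, Complex.real_smul]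
    push_cast
    ring
  · intro n
    simp only [hg, pow_zero, mul_one]
    rw [intervalIntegral.integral_ofReal, intervalIntegral.integral_const_mul, integral_sin_mul_sin]
    split_ifs with hn
    · subst hn
      rw [pow_zero, mul_one]
      norm_cast
      field_simp
    · simp
  · intro k
    rw [← intervalIntegral.integral_const_mul, ← intervalIntegral.integral_add (hgi _ _)
      ((hgi _ _).const_mul _)]
    refine intervalIntegral.integral_congr fun θ _ => ?_
    simp only [hg]
    rw [← Complex.ofReal_mul, ← Complex.ofReal_add]
    congr 1
    push_cast
    rw [zero_add, one_mul, one_add_one_eq_two, Real.sin_two_mul]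
    ring
  · intro k n
    rw [← intervalIntegral.integral_const_mul, ← intervalIntegral.integral_const_mul,
      ← intervalIntegral.integral_add (hgi _ _) ((hgi _ _).const_mul _),
      ← intervalIntegral.integral_add ((hgi _ _).add ((hgi _ _).const_mul _))
        ((hgi _ _).const_mul _)]
    refine intervalIntegral.integral_congr fun θ _ => ?_
    simp only [hg]
    rw [← Complex.ofReal_mul, ← Complex.ofReal_mul, ← Complex.ofReal_add, ← Complex.ofReal_add]
    congr 1
    push_cast
    -- The sine addition formulas around (n + 2)θ supply the three-term recurrence.
    have e1 : Real.sin (((n : ℝ) + 2 + 1) * θ) = Real.sin ((n + 1 + 1) * θ) * Real.cos θ +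
        Real.cos ((n + 1 + 1) * θ) * Real.sin θ := by
      rw [← Real.sin_add]
      ring_nf
    have e2 : Real.sin (((n : ℝ) + 1) * θ) = Real.sin ((n + 1 + 1) * θ) * Real.cos θ -
        Real.cos ((n + 1 + 1) * θ) * Real.sin θ := by
      rw [← Real.sin_sub]
      ring_nf
    rw [e1, e2, pow_succ (√v) n, pow_add (√v) n 2, pow_two (√v), hsq]
    generalize Real.sin ((n + 1 + 1) * θ) = S
    generalize Real.cos ((n + 1 + 1) * θ) = K
    linear_combination (2 / Real.pi * √v ^ n * Real.sin θ * S * 2 * Real.cos θ *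
      (m + 2 * √v * Real.cos θ) ^ k) * hsq

end Semicircle

/-! ### Cauchy transforms of semicircular laws. -/

section Cauchy

open Filter Topology

/-- The generating function of the numbers `sin ((n + 1) θ)`. -/
theorem tsum_pow_mul_sin {q : ℂ} (hq : ‖q‖ < 1) (θ : ℝ) :
    (1 + q ^ 2 - 2 * q * Real.cos θ) * ∑' n : ℕ, q ^ n * (Real.sin ((n + 1) * θ) : ℂ) =
      Real.sin θ := by
  have hs : ∀ j : ℕ, Summable fun n : ℕ => q ^ n * (Real.sin ((n + j) * θ) : ℂ) := fun j => by
    refine Summable.of_norm_bounded (summable_geometric_of_lt_one (norm_nonneg q) hq) fun n => ?_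
    rw [norm_mul, norm_pow, Complex.norm_real]
    exact mul_le_of_le_one_right (by positivity) (Real.abs_sin_le_one _)
  have e0 := (hs 0).tsum_eq_zero_add
  have e1 := (hs 1).tsum_eq_zero_add
  have e2 : ∑' n : ℕ, q ^ n * (Real.sin ((n + (0 : ℕ)) * θ) : ℂ) +
      ∑' n : ℕ, q ^ n * (Real.sin ((n + (2 : ℕ)) * θ) : ℂ) =
        2 * Real.cos θ * ∑' n : ℕ, q ^ n * (Real.sin ((n + (1 : ℕ)) * θ) : ℂ) := by
    rw [← (hs 0).tsum_add (hs 2), ← tsum_mul_left]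
    refine tsum_congr fun n => ?_
    have h : Real.sin ((n + (0 : ℕ)) * θ) + Real.sin ((n + (2 : ℕ)) * θ) =
        2 * Real.cos θ * Real.sin ((n + (1 : ℕ)) * θ) := by
      push_cast
      rw [show ((n : ℝ) + 0) * θ = (n + 1) * θ - θ by ring,
        show ((n : ℝ) + 2) * θ = (n + 1) * θ + θ by ring, Real.sin_sub, Real.sin_add]
      ring
    rw [← mul_add, ← Complex.ofReal_add, h]
    push_cast
    ring
  have f0 : ∑' n : ℕ, q ^ (n + 1) * (Real.sin (((n + 1 : ℕ) + (0 : ℕ)) * θ) : ℂ) =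
      q * ∑' n : ℕ, q ^ n * (Real.sin ((n + (1 : ℕ)) * θ) : ℂ) := by
    rw [← tsum_mul_left]
    refine tsum_congr fun n => ?_
    push_cast
    ring_nf
  have f1 : ∑' n : ℕ, q ^ (n + 1) * (Real.sin (((n + 1 : ℕ) + (1 : ℕ)) * θ) : ℂ) =
      q * ∑' n : ℕ, q ^ n * (Real.sin ((n + (2 : ℕ)) * θ) : ℂ) := by
    rw [← tsum_mul_left]
    refine tsum_congr fun n => ?_
    push_cast
    ring_nf
  rw [f0] at e0
  rw [f1] at e1
  simp only [Nat.cast_zero, pow_zero, zero_add, zero_mul, Real.sin_zero, Complex.ofReal_zero,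
    mul_zero, Nat.cast_one, one_mul] at e0 e1
  simp only [Nat.cast_zero, Nat.cast_one] at e2
  linear_combination e1 + q * e2 - q * e0

/-- The Cauchy transform integral of the semicircular distributions. -/
theorem integral_sin_sq_div {q : ℂ} (hq : ‖q‖ < 1) :
    ∫ θ in (0)..Real.pi, (2 / Real.pi * Real.sin θ ^ 2 : ℝ) • (1 + q ^ 2 - 2 * q * Real.cos θ)⁻¹ =
      (1 : ℂ) := by
  have hpi := Real.pi_pos
  have hs : ∀ θ : ℝ, Summable fun n : ℕ => q ^ n * (Real.sin ((n + 1) * θ) : ℂ) := fun θ => by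
    refine Summable.of_norm_bounded (summable_geometric_of_lt_one (norm_nonneg q) hq) fun n => ?_
    rw [norm_mul, norm_pow, Complex.norm_real]
    exact mul_le_of_le_one_right (by positivity) (Real.abs_sin_le_one _)
  have h := intervalIntegral.hasSum_integral_of_dominated_convergence (μ := volume)
    (a := 0) (b := Real.pi)
    (F := fun (n : ℕ) (θ : ℝ) =>
      ((2 / Real.pi * Real.sin θ : ℝ) : ℂ) * (q ^ n * (Real.sin ((n + 1) * θ) : ℂ)))
    (f := fun θ => (2 / Real.pi * Real.sin θ ^ 2 : ℝ) • (1 + q ^ 2 - 2 * q * Real.cos θ)⁻¹)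
    (fun n _ => 2 / Real.pi * ‖q‖ ^ n) (fun n => (by fun_prop : Continuous _).aestronglyMeasurable)
    (fun n => Eventually.of_forall fun θ _ => ?_) (Eventually.of_forall fun θ _ => ?_) ?_
    (Eventually.of_forall fun θ _ => ?_)
  · refine h.unique ?_
    have hn : ∀ n : ℕ, ∫ θ in (0)..Real.pi, ((2 / Real.pi * Real.sin θ : ℝ) : ℂ) *
        (q ^ n * (Real.sin ((n + 1) * θ) : ℂ)) = if n = 0 then 1 else 0 := by
      intro n
      have e : ∀ θ : ℝ, ((2 / Real.pi * Real.sin θ : ℝ) : ℂ) *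
          (q ^ n * (Real.sin ((n + 1) * θ) : ℂ)) =
          (2 / Real.pi * q ^ n) * ((Real.sin θ * Real.sin ((n + 1) * θ) : ℝ) : ℂ) := by
        intro θ
        push_cast
        ring
      simp only [e]
      rw [intervalIntegral.integral_const_mul, intervalIntegral.integral_ofReal,
        integral_sin_mul_sin]
      split_ifs with h0
      · subst h0
        have : (Real.pi : ℂ) ≠ 0 := by exact_mod_cast hpi.ne'
        push_cast
        field_simp
      · simp
    simp only [hn]
    exact hasSum_ite_eq 0 1
  · rw [norm_mul, norm_mul, norm_pow, Complex.norm_real, Complex.norm_real, norm_mul,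
      Real.norm_of_nonneg (by positivity)]
    have h1 : ‖Real.sin θ‖ ≤ 1 := Real.abs_sin_le_one _
    have h2 : ‖Real.sin ((n + 1) * θ)‖ ≤ 1 := Real.abs_sin_le_one _
    exact mul_le_mul (mul_le_of_le_one_right (by positivity) h1)
      (mul_le_of_le_one_right (by positivity) h2) (by positivity) (by positivity)
  · exact (summable_geometric_of_lt_one (norm_nonneg q) hq).mul_left _
  · exact intervalIntegrable_const
  · have e : (2 / Real.pi * Real.sin θ ^ 2 : ℝ) • (1 + q ^ 2 - 2 * q * Real.cos θ)⁻¹ =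
        ((2 / Real.pi * Real.sin θ : ℝ) : ℂ) *
          ∑' n : ℕ, q ^ n * (Real.sin ((n + 1) * θ) : ℂ) := by
      have h := tsum_pow_mul_sin hq θ
      rw [Complex.real_smul]
      by_cases hD : 1 + q ^ 2 - 2 * q * Real.cos θ = 0
      · rw [hD, zero_mul] at h
        have h' : Real.sin θ = 0 := by exact_mod_cast h.symm
        rw [h']
        simp
      · rw [← div_eq_mul_inv, div_eq_iff hD]
        push_cast at h ⊢
        linear_combination (-(2 / Real.pi * Complex.sin θ : ℂ)) * h
    rw [e]
    exact (hs θ).hasSum.mul_left _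

/-- The two roots have product 1. Were they on the unit circle they would be conjugate, making their
sum w real, so one of them lies strictly inside. -/
theorem exists_joukowski {w : ℂ} (hw : 0 < w.im) : ∃ q : ℂ, ‖q‖ < 1 ∧ q ≠ 0 ∧ q ^ 2 + 1 = w * q := by
  obtain ⟨s, hs⟩ := IsAlgClosed.exists_pow_nat_eq (w ^ 2 - 4) (n := 2) two_pos
  have key : ∀ q q' : ℂ, q * q' = 1 → q + q' = w →
      ‖q‖ < 1 → ∃ q : ℂ, ‖q‖ < 1 ∧ q ≠ 0 ∧ q ^ 2 + 1 = w * q := by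
    intro q q' h1 h2 h3
    refine ⟨q, h3, left_ne_zero_of_mul_eq_one h1, ?_⟩
    rw [← h2]
    linear_combination -h1
  have h1 : (w + s) / 2 * ((w - s) / 2) = 1 := by linear_combination (-1 / 4 : ℂ) * hs
  have h2 : (w + s) / 2 + (w - s) / 2 = w := by ring
  have hn : ‖(w + s) / 2‖ * ‖(w - s) / 2‖ = 1 := by rw [← norm_mul, h1, norm_one]
  rcases lt_trichotomy ‖(w + s) / 2‖ 1 with h | h | h
  · exact key _ _ h1 h2 h
  · exfalso
    set q := (w + s) / 2
    have hc : (w - s) / 2 = (starRingEnd ℂ) q := by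
      have h3 : q * (starRingEnd ℂ) q = 1 := by
        rw [Complex.mul_conj, Complex.normSq_eq_norm_sq, h]
        simp
      have hq0 : q ≠ 0 := left_ne_zero_of_mul_eq_one h1
      exact mul_left_cancel₀ hq0 (h1.trans h3.symm)
    rw [hc] at h2
    rw [← h2] at hw
    simp at hw
  · refine key _ _ (by rw [mul_comm]; exact h1) (by rw [add_comm]; exact h2) ?_
    by_contra! h3
    nlinarith [norm_nonneg ((w - s) / 2)]

/-- With (z - m)/√v = q + 1/q and |q| < 1 the transform equals q/√v. The quadratic equation suffices
later, so no branch of a square root is chosen. -/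
theorem cauchyTransform_semicircleLaw {m v : ℝ} (hv : 0 < v) {z : ℂ} (hz : 0 < z.im) :
    v * cauchyTransform (semicircleLaw m v) z ^ 2 -
      (z - m) * cauchyTransform (semicircleLaw m v) z + 1 = 0 := by
  have hs : 0 < √v := Real.sqrt_pos.mpr hv
  have hsc : (√v : ℂ) ≠ 0 := by exact_mod_cast hs.ne'
  have hsq : (√v : ℂ) * √v = v := by
    rw [← Complex.ofReal_mul, Real.mul_self_sqrt hv.le]
  obtain ⟨q, hq, hq0, hqe⟩ := exists_joukowski (w := (z - m) / √v) (by
    rw [Complex.div_ofReal_im]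
    have : (z - m).im = z.im := by simp
    rw [this]
    positivity)
  have hzm : z - m = √v * (q ^ 2 + 1) / q := by
    rw [hqe]
    field_simp
  have hG : cauchyTransform (semicircleLaw m v) z = q / √v := by
    have hcont : Continuous fun x : ℝ => 1 / (z - (x : ℂ)) := by
      refine Continuous.div continuous_const (by fun_prop) fun x h => ?_
      have := congrArg Complex.im h
      simp at this
      exact hz.ne' this
    rw [cauchyTransform, integral_semicircleLaw hv hcont.aestronglyMeasurable]
    have e : ∀ θ : ℝ, (2 / Real.pi * Real.sin θ ^ 2 : ℝ) •
        (1 / (z - ((m + 2 * √v * Real.cos θ : ℝ) : ℂ))) =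
        (q / √v) * ((2 / Real.pi * Real.sin θ ^ 2 : ℝ) •
          (1 + q ^ 2 - 2 * q * Real.cos θ)⁻¹) := by
      intro θ
      have e1 : z - ((m + 2 * √v * Real.cos θ : ℝ) : ℂ) =
          (√v / q) * (1 + q ^ 2 - 2 * q * Real.cos θ) := by
        have : z - ((m + 2 * √v * Real.cos θ : ℝ) : ℂ) = (z - m) - 2 * √v * Real.cos θ := by
          push_cast
          ring
        rw [this, hzm]
        field_simp
        ring
      rw [e1, one_div, mul_inv, inv_div, mul_smul_comm]
    simp only [e]
    rw [intervalIntegral.integral_const_mul, integral_sin_sq_div hq, mul_one]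
  rw [hG, hzm]
  field_simp
  linear_combination (-q ^ 2) * hsq

end Cauchy

/-! ### The Jacobi shift of a semicircular distribution -/

section JacobiShift

open Filter Topology

theorem one_add_mul_pos {c θ : ℝ} (hc : c ≠ 0) (hθ : θ ∈ Set.Ioo 0 Real.pi) :
    0 < 1 + c ^ 2 + 2 * c * Real.cos θ := by
  have hsin : 0 < Real.sin θ := Real.sin_pos_of_mem_Ioo hθ
  have h := Real.sin_sq_add_cos_sq θ
  have e : 1 + c ^ 2 + 2 * c * Real.cos θ =
      (1 + c * Real.cos θ) ^ 2 + c ^ 2 * Real.sin θ ^ 2 := by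
    linear_combination (-c ^ 2) * h
  rw [e]
  positivity

theorem integral_sin_sq_div_real {q : ℝ} (hq : |q| < 1) :
    ∫ θ in (0)..Real.pi, 2 / Real.pi * Real.sin θ ^ 2 * (1 + q ^ 2 - 2 * q * Real.cos θ)⁻¹ = 1 := by
  have h := integral_sin_sq_div (q := q) (by simpa using hq)
  apply Complex.ofReal_injective
  rw [← intervalIntegral.integral_ofReal, Complex.ofReal_one, ← h]
  refine intervalIntegral.integral_congr fun θ _ => ?_
  simp only [Complex.real_smul]
  push_cast
  rfl

/-- For |c| < 1 this is the previous integral at q = -c; for |c| > 1, factor out c² and use q =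
-1/c. For |c| = 1 the denominator vanishes at an endpoint, but cancels on the open interval to leave
(1 - c cos θ)/π; hence the continuous representative `k`. The minimum is the source of the atom's
threshold. -/
theorem exists_continuous_sin_sq_div {c : ℝ} (hc : c ≠ 0) :
    ∃ k : ℝ → ℝ, Continuous k ∧ (∀ θ ∈ Set.Ioo 0 Real.pi,
      2 / Real.pi * Real.sin θ ^ 2 * (1 + c ^ 2 + 2 * c * Real.cos θ)⁻¹ = k θ) ∧
      ∫ θ in (0)..Real.pi, k θ = min 1 (1 / c ^ 2) := by
  have hc2 : 0 < c ^ 2 := by positivity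
  have hcont : |c| ≠ 1 → Continuous fun θ =>
      2 / Real.pi * Real.sin θ ^ 2 * (1 + c ^ 2 + 2 * c * Real.cos θ)⁻¹ := by
    intro h
    refine Continuous.mul (by fun_prop) (Continuous.inv₀ (by fun_prop) fun θ => ne_of_gt ?_)
    have h1 : -(2 * |c|) ≤ 2 * c * Real.cos θ := by
      have : |2 * c * Real.cos θ| ≤ 2 * |c| := by
        rw [abs_mul, abs_mul, abs_two]
        exact mul_le_of_le_one_right (by positivity) (Real.abs_cos_le_one θ)
      exact (abs_le.mp this).1
    have h2 : 0 < (1 - |c|) ^ 2 := by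
      have : 1 - |c| ≠ 0 := sub_ne_zero.mpr (Ne.symm h)
      positivity
    nlinarith [sq_abs c]
  rcases lt_trichotomy |c| 1 with h | h | h
  · refine ⟨_, hcont h.ne, fun θ _ => rfl, ?_⟩
    have := integral_sin_sq_div_real (q := -c) (by rwa [abs_neg])
    rw [min_eq_left]
    · refine Eq.trans ?_ this
      refine intervalIntegral.integral_congr fun θ _ => ?_
      ring_nf
    · rw [le_div_iff₀ hc2, one_mul]
      exact ((sq_lt_one_iff_abs_lt_one c).mpr h).le
  · have hcc : c ^ 2 = 1 := by rw [← sq_abs, h, one_pow]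
    refine ⟨fun θ => (1 - c * Real.cos θ) / Real.pi, by fun_prop, fun θ hθ => ?_, ?_⟩
    · have hD := one_add_mul_pos hc hθ
      have hpi := Real.pi_pos
      rw [← div_eq_mul_inv, div_eq_iff hD.ne', div_mul_eq_mul_div, div_mul_eq_mul_div]
      congr 1
      have := Real.sin_sq_add_cos_sq θ
      linear_combination 2 * this + (2 * Real.cos θ ^ 2 + c * Real.cos θ - 1) * hcc
    · rw [hcc, div_one, min_self]
      simp only [sub_div]
      rw [intervalIntegral.integral_sub (Continuous.intervalIntegrable (by fun_prop) _ _)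
        (Continuous.intervalIntegrable (by fun_prop) _ _), intervalIntegral.integral_div,
        intervalIntegral.integral_div, intervalIntegral.integral_const_mul, integral_cos]
      have hpi := Real.pi_pos
      simp
  · refine ⟨_, hcont h.ne', fun θ _ => rfl, ?_⟩
    have hinv : |-(1 / c)| < 1 := by
      rw [abs_neg, abs_div, abs_one, div_lt_one (by linarith)]
      exact h
    have := integral_sin_sq_div_real hinv
    rw [min_eq_right]
    · refine Eq.trans ?_ ((congrArg (fun x => 1 / c ^ 2 * x) this).trans (mul_one (1 / c ^ 2)))
      rw [← intervalIntegral.integral_const_mul]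
      refine intervalIntegral.integral_congr fun θ _ => ?_
      have e : 1 + c ^ 2 + 2 * c * Real.cos θ =
          c ^ 2 * (1 + (-(1 / c)) ^ 2 - 2 * -(1 / c) * Real.cos θ) := by
        field_simp
        ring
      rw [e, mul_inv]
      ring
    · rw [div_le_one hc2]
      nlinarith [sq_abs c]

/-- In the angular variable 1 + αx is 1 + c² + 2c cos θ with c = α√v, which can vanish only at an
endpoint. -/
theorem one_add_mul_pos_ae {α v : ℝ} (hα : α ≠ 0) (hv : 0 < v) :
    ∀ᵐ x ∂semicircleLaw (α * v) v, 0 < 1 + α * x := by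
  have hs : 0 < √v := Real.sqrt_pos.mpr hv
  have hsq : √v * √v = v := Real.mul_self_sqrt hv.le
  refine (ae_semicircleLaw hv).mono fun x hx => ?_
  rw [← image_cos_Ioo hv] at hx
  obtain ⟨θ, hθ, rfl⟩ := hx
  have := one_add_mul_pos (c := α * √v) (by positivity) hθ
  have e : 1 + α * (α * v + 2 * √v * Real.cos θ) =
      1 + (α * √v) ^ 2 + 2 * (α * √v) * Real.cos θ := by
    linear_combination (-α ^ 2) * hsq
  simp only
  rw [e]
  exact this

theorem lintegral_inv_semicircleLaw {α v : ℝ} (hα : α ≠ 0) (hv : 0 < v) :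
    ∫⁻ x, ENNReal.ofReal (1 + α * x)⁻¹ ∂semicircleLaw (α * v) v =
      ENNReal.ofReal (min 1 (1 / (α ^ 2 * v))) := by
  have hs : 0 < √v := Real.sqrt_pos.mpr hv
  have hsq : √v * √v = v := Real.mul_self_sqrt hv.le
  have hpi := Real.pi_pos
  obtain ⟨k, hk, hkg, hki⟩ := exists_continuous_sin_sq_div (c := α * √v) (by positivity)
  rw [show (α * √v) ^ 2 = α ^ 2 * v by linear_combination α ^ 2 * hsq] at hki
  rw [semicircleLaw_eq_map hv, lintegral_map (by fun_prop) (by fun_prop), sinSqMeasure,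
    lintegral_withDensity_eq_lintegral_mul _ (by fun_prop) (by fun_prop), ← hki,
    intervalIntegral.integral_of_le hpi.le, integral_Ioc_eq_integral_Ioo,
    ofReal_integral_eq_lintegral_ofReal]
  · refine setLIntegral_congr_fun measurableSet_Ioo fun θ hθ => ?_
    rw [← hkg θ hθ]
    simp only [Pi.mul_apply]
    rw [← ENNReal.ofReal_mul (by positivity)]
    congr 3
    linear_combination (-α ^ 2) * hsq
  · exact (hk.integrableOn_Icc (a := 0) (b := Real.pi)).mono_set Set.Ioo_subset_Icc_self
  · refine (ae_restrict_mem measurableSet_Ioo).mono fun θ hθ => ?_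
    rw [← hkg θ hθ]
    have := one_add_mul_pos (c := α * √v) (by positivity) hθ
    simp only [Pi.zero_apply]
    positivity

/-- The Jacobi shift of the semicircular distribution with mean `α v` and variance `v`: a free
Poisson distribution up to an affine transformation. -/
noncomputable def jacobiShiftLaw (α v : ℝ) : Measure ℝ :=
  (semicircleLaw (α * v) v).withDensity (fun x => ENNReal.ofReal (1 + α * x)⁻¹) +
    ENNReal.ofReal (max (1 - 1 / (α ^ 2 * v)) 0) • Measure.dirac (-1 / α)

variable {α v : ℝ}

theorem isProbabilityMeasure_jacobiShiftLaw (hα : α ≠ 0) (hv : 0 < v) :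
    IsProbabilityMeasure (jacobiShiftLaw α v) := by
  refine ⟨?_⟩
  rw [jacobiShiftLaw, Measure.add_apply, withDensity_apply _ MeasurableSet.univ,
    Measure.restrict_univ, lintegral_inv_semicircleLaw hα hv, Measure.smul_apply,
    Measure.dirac_apply_of_mem (Set.mem_univ _), smul_eq_mul, mul_one,
    ← ENNReal.ofReal_add (by positivity) (le_max_right _ _), ← ENNReal.ofReal_one]
  congr 1
  rcases le_total 1 (1 / (α ^ 2 * v)) with h | h
  · rw [min_eq_left h, max_eq_right (by linarith), add_zero]
  · rw [min_eq_right h, max_eq_left (by linarith)]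
    ring

theorem jacobiShiftLaw_ae_abs_le (hv : 0 < v) :
    ∀ᵐ x ∂jacobiShiftLaw α v, |x| ≤ |α * v| + 2 * √v + |-1 / α| := by
  rw [jacobiShiftLaw, ae_add_measure_iff]
  constructor
  · filter_upwards [(withDensity_absolutelyContinuous _ _).ae_le (semicircleLaw_ae_abs_le hv)]
      with x hx
    linarith [abs_nonneg (-1 / α)]
  · refine Measure.ae_smul_measure ?_ _
    refine (ae_dirac_iff ?_).mpr ?_
    · exact measurableSet_le (by fun_prop) (by fun_prop)
    · have : 0 ≤ |α * v| + 2 * √v := by positivity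
      linarith

/-- The factor 1 + αx cancels the density and kills the atom. Moments and Cauchy transform of the
shifted law both follow from this. -/
theorem integral_one_add_mul_jacobiShiftLaw (hα : α ≠ 0) (hv : 0 < v) {f : ℝ → ℂ}
    (hf : Continuous f) :
    ∫ x, (1 + α * x : ℝ) • f x ∂jacobiShiftLaw α v = ∫ x, f x ∂semicircleLaw (α * v) v := by
  have := isProbabilityMeasure_jacobiShiftLaw hα hv
  have hi : Integrable (fun x => (1 + α * x : ℝ) • f x) (jacobiShiftLaw α v) :=
    integrable_of_ae_abs_le (jacobiShiftLaw_ae_abs_le hv)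
      (Continuous.continuousOn (by fun_prop)) (Continuous.aestronglyMeasurable (by fun_prop))
  rw [jacobiShiftLaw] at hi ⊢
  rw [integrable_add_measure] at hi
  rw [integral_add_measure hi.1 hi.2, integral_smul_measure, integral_dirac,
    integral_withDensity_eq_integral_toReal_smul (by fun_prop) (by simp)]
  have h0 : (1 + α * (-1 / α) : ℝ) = 0 := by
    field_simp
    ring
  rw [h0, zero_smul, smul_zero, add_zero]
  refine integral_congr_ae ((one_add_mul_pos_ae hα hv).mono fun x hx => ?_)
  simp only
  rw [ENNReal.toReal_ofReal (by positivity), smul_smul, inv_mul_cancel₀ hx.ne', one_smul]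

/-- Testing with 1/(z - x) gives (1 + αz)G_μ = G_ν + α, while the quadratic equation for G_ν is the
factorisation (G_ν + α)(z - vG_ν) = 1 + αz. -/
theorem isJacobiShift_jacobiShiftLaw (hα : α ≠ 0) (hv : 0 < v) :
    IsJacobiShift v (semicircleLaw (α * v) v) (jacobiShiftLaw α v) where
  prob := isProbabilityMeasure_jacobiShiftLaw hα hv
  cauchy z hz := by
    have := isProbabilityMeasure_jacobiShiftLaw hα hv
    have hne : ∀ x : ℝ, z - (x : ℂ) ≠ 0 := fun x h => by
      have := congrArg Complex.im h
      simp at this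
      exact hz.ne' this
    have hcont : Continuous fun x : ℝ => 1 / (z - (x : ℂ)) :=
      Continuous.div continuous_const (by fun_prop) hne
    have hi : Integrable (fun x : ℝ => 1 / (z - (x : ℂ))) (jacobiShiftLaw α v) :=
      integrable_of_ae_abs_le (jacobiShiftLaw_ae_abs_le hv) hcont.continuousOn
        hcont.aestronglyMeasurable
    have hq := cauchyTransform_semicircleLaw (m := α * v) hv hz
    have h := integral_one_add_mul_jacobiShiftLaw hα hv hcont
    have e : ∀ x : ℝ, (1 + α * x : ℝ) • (1 / (z - (x : ℂ))) =
        (1 + α * z) * (1 / (z - (x : ℂ))) - α := by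
      intro x
      have := hne x
      rw [Complex.real_smul]
      push_cast
      field_simp
      ring
    simp only [e] at h
    rw [integral_sub (hi.const_mul _) (integrable_const _), integral_const_mul,
      integral_const, probReal_univ, one_smul] at h
    change (1 + α * z) * cauchyTransform (jacobiShiftLaw α v) z - α =
      cauchyTransform (semicircleLaw (α * v) v) z at h
    set G := cauchyTransform (semicircleLaw (α * v) v) z
    have hz1 : 1 + α * z ≠ 0 := fun h => by
      have := congrArg Complex.im h
      simp at this
      rcases this with h | h
      exacts [hα h, hz.ne' h]
    have hGz : (G + α) * (z - v * G) = 1 + α * z := by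
      push_cast at hq
      linear_combination -hq
    have hne2 : z - v * G ≠ 0 := right_ne_zero_of_mul (hGz ▸ hz1)
    rw [eq_div_iff hne2]
    apply mul_left_cancel₀ hz1
    rw [mul_one, ← mul_assoc, sub_eq_iff_eq_add.mp h, hGz]

theorem isJacobiShift_semicircleLaw (hv : 0 < v) :
    IsJacobiShift v (semicircleLaw 0 v) (semicircleLaw 0 v) where
  prob := isProbabilityMeasure_semicircleLaw hv
  cauchy z hz := by
    have hq := cauchyTransform_semicircleLaw (m := 0) hv hz
    set G := cauchyTransform (semicircleLaw 0 v) z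
    have h : G * (z - v * G) = 1 := by
      push_cast at hq
      linear_combination -hq
    rw [eq_div_iff (right_ne_zero_of_mul_eq_one h), h]

theorem jacobiShiftLaw_eq (α v : ℝ) (hv : 0 < v) :
    jacobiShiftLaw α v = volume.withDensity (fun x => ENNReal.ofReal
        (1 / (2 * Real.pi * v) * Real.sqrt (max (4 * v - (x - α * v) ^ 2) 0) / (1 + α * x))) +
      ENNReal.ofReal (max (1 - 1 / (α ^ 2 * v)) 0) • Measure.dirac (-1 / α) := by
  have hpi := Real.pi_pos
  rw [jacobiShiftLaw, semicircleLaw, ← withDensity_mul _ (by fun_prop) (by fun_prop)]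
  congr 2
  funext x
  rw [Pi.mul_apply, ← ENNReal.ofReal_mul (by positivity), ← div_eq_mul_inv]

theorem map_affine_withDensity (hα : α ≠ 0) (g : ℝ → ENNReal) :
    (volume.withDensity g).map (fun x => 1 + α * x) =
      volume.withDensity (fun y => ENNReal.ofReal |α|⁻¹ * g ((y - 1) / α)) := by
  ext s hs
  have hf : Measurable fun x => 1 + α * x := by fun_prop
  have himg : (fun x => 1 + α * x) '' ((fun x => 1 + α * x) ⁻¹' s) = s :=
    Set.image_preimage_eq s fun y => ⟨(y - 1) / α, by field_simp; ring⟩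
  rw [Measure.map_apply hf hs, withDensity_apply _ (hf hs), withDensity_apply _ hs]
  nth_rewrite 2 [← himg]
  rw [lintegral_image_eq_lintegral_abs_deriv_mul (hf hs) (f' := fun _ => α)]
  · refine setLIntegral_congr_fun (hf hs) fun x _ => ?_
    rw [← mul_assoc, ← ENNReal.ofReal_mul (abs_nonneg _),
      mul_inv_cancel₀ (abs_ne_zero.mpr hα), ENNReal.ofReal_one, one_mul, add_sub_cancel_left,
      mul_div_cancel_left₀ _ hα]
  · intro x _
    simpa using (((hasDerivAt_id x).const_mul α).const_add 1).hasDerivWithinAt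
  · intro x _ y _ hxy
    exact mul_left_cancel₀ hα (add_left_cancel hxy)

theorem map_jacobiShiftLaw (hα : α ≠ 0) (hv : 0 < v) :
    (jacobiShiftLaw α v).map (fun x => 1 + α * x) =
      volume.withDensity (fun y => ENNReal.ofReal
        (1 / (2 * Real.pi) * (1 / (α ^ 2 * v))
          * Real.sqrt (max (((1 + α * Real.sqrt v) ^ 2 - y)
              * (y - (1 - α * Real.sqrt v) ^ 2)) 0) / y)) +
        ENNReal.ofReal (max (1 - 1 / (α ^ 2 * v)) 0) • Measure.dirac 0 := by
  have hpi := Real.pi_pos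
  have hsq : √v ^ 2 = v := Real.sq_sqrt hv.le
  have hα2 : |α| ^ 2 = α ^ 2 := sq_abs α
  have habs : 0 < |α| := abs_pos.mpr hα
  have hf : Measurable fun x => 1 + α * x := by fun_prop
  rw [jacobiShiftLaw_eq α v hv, Measure.map_add _ _ hf, map_affine_withDensity hα,
    Measure.map_smul, Measure.map_dirac' hf]
  congr 2
  · funext y
    rw [← ENNReal.ofReal_mul (by positivity)]
    have e1 : 1 + α * ((y - 1) / α) = y := by
      field_simp
      ring
    -- A difference of squares: after multiplication by α² the factors are 2α√v ± (y - 1 - α²v).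
    have e2 : max (4 * v - ((y - 1) / α - α * v) ^ 2) 0 =
        max (((1 + α * √v) ^ 2 - y) * (y - (1 - α * √v) ^ 2)) 0 / |α| ^ 2 := by
      rw [hα2, ← max_div_div_right (by positivity), zero_div]
      congr 1
      rw [eq_div_iff (by positivity)]
      field_simp
      ring_nf
      rw [show √v ^ 4 = (√v ^ 2) ^ 2 by ring, hsq]
      ring
    rw [e1, e2, Real.sqrt_div' _ (by positivity), Real.sqrt_sq habs.le]
    rw [← hα2]
    field_simp
  · congr 1
    field_simp
    ring

end JacobiShift

/-! ### Identification of the laws from the moments. -/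

theorem freeCumulant_one {A : Type*} [Ring A] [Algebra ℂ A] (ψ : A →ₗ[ℂ] ℂ) (a : A) :
    freeCumulant ψ 1 (fun _ => a) = ψ a := by
  rw [freeCumulant, Finset.sum_eq_zero, sub_zero]
  · simp
  · intro π hπ
    refine absurd ?_ (Finset.mem_filter.mp hπ).2
    obtain ⟨V, hV, hxV⟩ := π.exists_mem (Finset.mem_univ 0)
    have : V = Finset.univ := Finset.eq_univ_iff_forall.mpr fun x => by
      rwa [Subsingleton.elim x 0]
    exact this ▸ hV

/-- As α ≠ 0, the relation expresses each moment through the preceding one, and the integrals obey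
the same relation. -/
theorem integral_pow_jacobiShiftLaw {α v : ℝ} (hα : α ≠ 0) (hv : 0 < v) {M : ℕ → ℂ}
    (h0 : M 0 = 1) (hM : ∀ n, M n + α * M (n + 1) = semicircleArray (α * v) v n 0) (n : ℕ) :
    M n = ∫ x : ℝ, (x : ℂ) ^ n ∂jacobiShiftLaw α v := by
  have := isProbabilityMeasure_jacobiShiftLaw hα hv
  have hi : ∀ n, Integrable (fun x : ℝ => (x : ℂ) ^ n) (jacobiShiftLaw α v) := fun n =>
    integrable_of_ae_abs_le (jacobiShiftLaw_ae_abs_le hv)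
      (Continuous.continuousOn (by fun_prop)) (Continuous.aestronglyMeasurable (by fun_prop))
  induction n with
  | zero => simp [h0]
  | succ n ih =>
    have h := integral_one_add_mul_jacobiShiftLaw hα hv (f := fun x : ℝ => (x : ℂ) ^ n)
      (by fun_prop)
    have e : ∀ x : ℝ, (1 + α * x : ℝ) • (x : ℂ) ^ n = (x : ℂ) ^ n + α * (x : ℂ) ^ (n + 1) := by
      intro x
      rw [Complex.real_smul]
      push_cast
      ring
    simp only [e] at h
    rw [integral_add (hi n) ((hi (n + 1)).const_mul _), integral_const_mul,
      integral_pow_semicircleLaw hv, Complex.ofReal_mul, ← hM n, ← ih] at h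
    exact (mul_left_cancel₀ (Complex.ofReal_ne_zero.mpr hα) (add_left_cancel h)).symm

theorem IsDistribution.one_add_smul {A : Type*} [Ring A] [Algebra ℂ A] {χ : A →ₗ[ℂ] ℂ} {a : A}
    {μ : Measure ℝ} (hμ : IsDistribution χ a μ) {C : ℝ} (hC : ∀ᵐ x ∂μ, |x| ≤ C) (α : ℝ)
    (ρ : Measure ℝ) : IsDistribution χ (1 + (α : ℂ) • a) ρ ↔
      ρ = μ.map (fun x => 1 + α * x) := by
  have := hμ.prob
  have hf : Measurable fun x : ℝ => 1 + α * x := by fun_prop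
  have hb : ∀ᵐ y ∂μ.map (fun x => 1 + α * x), |y| ≤ 1 + |α| * C := by
    refine (ae_map_iff (p := fun y => |y| ≤ 1 + |α| * C) hf.aemeasurable
      (measurableSet_le (by fun_prop) (by fun_prop))).mpr (hC.mono fun x hx => ?_)
    calc |1 + α * x| ≤ |1| + |α * x| := abs_add_le _ _
      _ ≤ 1 + |α| * C := by
        rw [abs_one, abs_mul]
        have := mul_le_mul_of_nonneg_left hx (abs_nonneg α)
        linarith
  refine IsDistribution.iff_eq (isDistribution_of_moments
    (Measure.isProbabilityMeasure_map hf.aemeasurable) hb fun n => ?_) hb ρ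
  have h := (hμ.map_aeval ((1 + Polynomial.C (α : ℂ) * Polynomial.X) ^ n)).2
  rw [integral_map hf.aemeasurable (Continuous.aestronglyMeasurable (by fun_prop))]
  simpa [Algebra.smul_def] using h

theorem mainTheorem3 {A : Type*} [Ring A] [StarRing A] [Algebra ℂ A] [StarModule ℂ A]
    (φ ψ : A →ₗ[ℂ] ℂ) (hφ : IsPositiveUnital φ) (hψ : IsPositiveUnital ψ)
    (T : ℝ) (X : ℝ → A) (hX : IsTwoStateFreeBrownianMotion φ ψ T X)
    (α : ℝ) (hα : HasParameter ψ T X α)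
    (hA : IsFaithfulWStarSpace φ ψ ∨ HasQuadraticPsiCumulants ψ T X)
    (t : ℝ) (ht : 0 < t) (htT : t ≤ T) :
    (∀ ν : Measure ℝ, IsDistribution ψ (X t) ν ↔ ν = semicircleLaw (α * t) t) ∧
    ∃ μ : Measure ℝ,
      (∀ μ' : Measure ℝ, IsDistribution φ (X t) μ' ↔ μ' = μ) ∧
      IsJacobiShift t (semicircleLaw (α * t) t) μ ∧
      (α ≠ 0 →
        μ = volume.withDensity (fun x => ENNReal.ofReal
              (1 / (2 * Real.pi * t) * Real.sqrt (max (4 * t - (x - α * t) ^ 2) 0)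
                / (1 + α * x)))
            + ENNReal.ofReal (max (1 - 1 / (α ^ 2 * t)) 0) • Measure.dirac (-1 / α) ∧
        ∀ ρ : Measure ℝ, IsDistribution φ (1 + (α : ℂ) • X t) ρ ↔
          ρ = volume.withDensity (fun y => ENNReal.ofReal
                (1 / (2 * Real.pi) * (1 / (α ^ 2 * t))
                  * Real.sqrt (max (((1 + α * Real.sqrt t) ^ 2 - y)
                      * (y - (1 - α * Real.sqrt t) ^ 2)) 0) / y))
              + ENNReal.ofReal (max (1 - 1 / (α ^ 2 * t)) 0) • Measure.dirac 0) := by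
  have ht' : t ∈ Set.Icc 0 T := ⟨ht.le, htT⟩
  have hmean : ψ (X t) = α * t := by
    rw [← freeCumulant_one, hα t ht']
    push_cast
    rfl
  have hm : ∀ k, ψ (X t ^ k) = semicircleArray (α * t) t k 0 := by
    intro k
    rcases hA with hA | hA
    · rw [hX.moment_eq_semicircleArray hφ hψ hA ht htT, hmean]
    · refine eq_semicircleArray_of_recursion (m := fun k => ψ (X t ^ k))
        (by simp [hψ.map_one]) (fun n => ?_) k
      have h := moment_succ_of_freeCumulant_eq_zero ψ hψ.map_one (X t) (hA t ht').2 n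
      rwa [freeCumulant_one, hmean, (hA t ht').1] at h
  have hM0 : φ (X t ^ 0) = 1 := by rw [pow_zero, hφ.map_one]
  have hM : ∀ n, φ (X t ^ n) + α * φ (X t ^ (n + 1)) = semicircleArray (α * t) t n 0 := by
    intro n
    refine jacobiShift_moment (M := fun n => φ (X t ^ n)) hM0
      (by simpa using hX.mean_zero t ht') (fun n => ?_) n
    rw [hX.moment_recursion hφ.map_one hψ.map_one ht.le htT]
    simp only [hm]
  have hνp := isProbabilityMeasure_semicircleLaw (m := α * t) ht
  have hνb := semicircleLaw_ae_abs_le (m := α * t) ht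
  have hν : IsDistribution ψ (X t) (semicircleLaw (α * t) t) :=
    isDistribution_of_moments hνp hνb fun n => by
      rw [hm, integral_pow_semicircleLaw ht, Complex.ofReal_mul]
  refine ⟨hν.iff_eq hνb, ?_⟩
  -- At α = 0 the centred semicircle is its own shift. This case is separate because there
  -- `jacobiShiftLaw`, with 1/0 = 0, would acquire a spurious unit atom.
  by_cases hα0 : α = 0
  · subst hα0
    rw [zero_mul] at hνp hνb ⊢
    refine ⟨semicircleLaw 0 t, (isDistribution_of_moments hνp hνb fun n => ?_).iff_eq hνb,
      isJacobiShift_semicircleLaw ht, fun h => absurd rfl h⟩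
    rw [integral_pow_semicircleLaw ht]
    simpa using hM n
  · have hμb := jacobiShiftLaw_ae_abs_le (α := α) ht
    have hμ : IsDistribution φ (X t) (jacobiShiftLaw α t) :=
      isDistribution_of_moments (isProbabilityMeasure_jacobiShiftLaw hα0 ht) hμb
        (integral_pow_jacobiShiftLaw (M := fun n => φ (X t ^ n)) hα0 ht hM0 hM)
    refine ⟨jacobiShiftLaw α t, hμ.iff_eq hμb, isJacobiShift_jacobiShiftLaw hα0 ht,
      fun _ => ⟨jacobiShiftLaw_eq α t ht, fun ρ => ?_⟩⟩
    rw [hμ.one_add_smul hμb α ρ, map_jacobiShiftLaw hα0 ht]
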